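/- Let $N\ge 1$, $s\in(0,1)$, $T>0$, $p\ge 1$, $\alpha\in\mathbb R$, $\beta>0$, and $S_T=\mathbb R^N\times(0,T]$, $\bar S_T=\mathbb R^N\times[0,T]$. Put $\psi(x)=(1+|x|^2)^{-\beta/2}$ and $$\mathcal L^s(\mathbb R^N)=\Big\{f:\mathbb R^N\to\mathbb R \text{ measurable}\ :\ \int_{\mathbb R^N}\frac{|f(x)|}{1+|x|^{N+2s}}\,dx<\infty\Big\}.$$ Let $\rho\in C(\mathbb R^N)$ with $\rho>0$ everywhere. Consider the bound $$(\mathrm H_\alpha)\qquad \rho(x)\ge K(1+|x|^2)^{-\alpha/2}\ \text{ for all }x\in\mathbb R^N,\ \text{for some } K>0.$$ A function $u$ is a solution of the problem $$\rho\,\partial_t u+(-\Delta)^s u=0\ \text{ in } S_T,\qquad u=0\ \text{ in }\mathbb R^N\times\{0\}, \tag{P}$$ if the following hold. - $u\in C(\bar S_T)$, $\partial_t u$ exists in $S_T$ (one-sided at $t=T$), $\partial_t u\in C(S_T)\cap L^1_{loc}(\bar S_T)$, and $u\in L^1((0,T);\mathcal L^s(\mathbb R^N))$. - For each $t\in(0,T]$,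 $u(\cdot,t)\in\mathcal L^s(\mathbb R^N)$ and, for some $\gamma>0$ (possibly depending on $t$), $u(\cdot,t)\in C^{2s+\gamma}_{loc}(\mathbb R^N)$ if $s<\frac12$, or $u(\cdot,t)\in C^{1,2s+\gamma-1}_{loc}(\mathbb R^N)$ if $s\ge\frac12$. - For all $(x,t)\in S_T$, $$\rho(x)\,\partial_t u(x,t)+C_{N,s}\,\mathrm{P.V.}\!\int_{\mathbb R^N}\frac{u(x,t)-u(y,t)}{|x-y|^{N+2s}}\,dy=0,\qquad C_{N,s}=\frac{2^{2s-1}\,2s\,\Gamma((N+2s)/2)}{\pi^{N/2}\,\Gamma(1-s)}.$$ - $u(x,0)=0$ for all $x\in\mathbb R^N$. **Theorem 2.5.** Let $u$ be a solution of (P) such that $|u(\cdot,t)|^p\in\mathcal L^s(\mathbb R^N)$ for each $t\in(0,T]$ and $u\in L^p_\psi(S_T)$, i.e. $\int_0^T\!\int_{\mathbb R^N}|u|^p\,\psi\,dx\,dt<\infty$. Suppose that one of the following conditions holds: (i) $0<\beta\le N-2s$ and $(\mathrm H_\alpha)$ holds (with no restriction on $\alpha\in\mathbb R$); (ii) $N-2s<\beta<N$,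 $\alpha\le 2s$, and $(\mathrm H_\alpha)$ holds; (iii) $\beta=N$, and either $\alpha<2s$ and $(\mathrm H_\alpha)$ holds, or instead $\rho(x)\ge K(1+|x|^2)^{-s}\log(1+|x|^2)$ for all $x\in\mathbb R^N$, for some $K>0$; (iv) $\beta>N$, $\alpha+\beta\le N+2s$, and $(\mathrm H_\alpha)$ holds. Then $u\equiv 0$ in $S_T$. -/

import Mathlib

open MeasureTheory Set Filter Topology

/-- The space `ℝ^N` with its Euclidean norm. -/
abbrev RN (N : ℕ) : Type := EuclideanSpace ℝ (Fin N)

/-- `S_T = ℝ^N × (0, T]`. -/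
def slab (N : ℕ) (T : ℝ) : Set (RN N × ℝ) := univ ×ˢ Ioc 0 T

/-- `ℝ^N × [0, T]`, the closure of `S_T`. -/
def closedSlab (N : ℕ) (T : ℝ) : Set (RN N × ℝ) := univ ×ˢ Icc 0 T

/-- The space `𝓛^s(ℝ^N)`: measurable `f` with `∫ |f(x)| / (1 + |x|^{N+2s}) dx < ∞`. -/
def MemLs {N : ℕ} (s : ℝ) (f : RN N → ℝ) : Prop :=
  Measurable f ∧ Integrable (fun x => f x / (1 + ‖x‖ ^ ((N : ℝ) + 2 * s)))

/-- `u ∈ L¹((0, T); 𝓛^s(ℝ^N))` for a function `u` that is continuous on `ℝ^N × [0, T]`: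
by Tonelli, joint integrability of `u(x, t) / (1 + |x|^{N+2s})` on `ℝ^N × (0, T)`. -/
def MemL1Ls {N : ℕ} (s T : ℝ) (u : RN N → ℝ → ℝ) : Prop :=
  IntegrableOn (fun z : RN N × ℝ => u z.1 z.2 / (1 + ‖z.1‖ ^ ((N : ℝ) + 2 * s)))
    (univ ×ˢ Ioo 0 T)

/-- The weighted space `L^p_φ(S_T)`: functions `u`, measurable on `S_T`, with
`∫₀ᵀ ∫ |u|^p φ dx dt < ∞`. -/
def MemWeightedLp {N : ℕ} (p T : ℝ) (φ : RN N × ℝ → ℝ) (u : RN N → ℝ → ℝ) : Prop :=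
  Measurable (fun z : slab N T => u z.1.1 z.1.2) ∧
    IntegrableOn (fun z : RN N × ℝ => |u z.1 z.2| ^ p * φ z) (slab N T)

/-- The weight `ψ(x) = (1 + |x|²)^{-β/2}`. -/
noncomputable def psiWeight {N : ℕ} (β : ℝ) (x : RN N) : ℝ := (1 + ‖x‖ ^ 2) ^ (-(β / 2))

/-- `f` is Hölder continuous of exponent `θ` on every compact set. -/
def IsLocHolder {N : ℕ} {F : Type*} [NormedAddCommGroup F] (θ : ℝ) (f : RN N → F) : Prop :=
  ∀ K : Set (RN N), IsCompact K →
    ∃ C : ℝ, ∀ x ∈ K, ∀ y ∈ K, ‖f x - f y‖ ≤ C * ‖x - y‖ ^ θ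

/-- The regularity class of solutions: for some `γ > 0`, `f` is of class `C^{2s+γ}_loc` if
`s < 1/2`, and of class `C^{1, 2s+γ-1}_loc` if `s ≥ 1/2`. These local classes decrease in `γ`, so
that `γ` may be taken small enough for the Hölder exponent to be at most `1`. -/
def FracRegular {N : ℕ} (s : ℝ) (f : RN N → ℝ) : Prop :=
  (s < 1 / 2 → ∃ γ > 0, 2 * s + γ ≤ 1 ∧ IsLocHolder (2 * s + γ) f) ∧
  (1 / 2 ≤ s → ∃ γ > 0, 2 * s + γ - 1 ≤ 1 ∧ ContDiff ℝ 1 f ∧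
    IsLocHolder (2 * s + γ - 1) (fderiv ℝ f))

/-- The normalizing constant `C_{N,s}` of the fractional Laplacian. -/
noncomputable def fracConst (N : ℕ) (s : ℝ) : ℝ :=
  2 ^ (2 * s - 1) * (2 * s) * Real.Gamma (((N : ℝ) + 2 * s) / 2) /
    (Real.pi ^ ((N : ℝ) / 2) * Real.Gamma (1 - s))

/-- The principal value `C_{N,s} P.V. ∫ (f(x) - f(y)) / |x - y|^{N+2s} dy`, that is, the
fractional Laplacian `(-Δ)^s f(x)`, exists and equals `L`. -/
def HasFracLaplacianAt {N : ℕ} (s : ℝ) (f : RN N → ℝ) (x : RN N) (L : ℝ) : Prop :=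
  (∀ ε > 0, IntegrableOn (fun y => (f x - f y) / ‖x - y‖ ^ ((N : ℝ) + 2 * s))
    {y | ε < ‖x - y‖}) ∧
  Tendsto (fun ε : ℝ => fracConst N s *
      ∫ y in {y | ε < ‖x - y‖}, (f x - f y) / ‖x - y‖ ^ ((N : ℝ) + 2 * s))
    (𝓝[>] 0) (𝓝 L)

/-- The time derivative `∂ₜu(x, t)` in `S_T` (one-sided at `t = T`). -/
noncomputable def timeDeriv {N : ℕ} (T : ℝ) (u : RN N → ℝ → ℝ) (x : RN N) (t : ℝ) : ℝ :=
  derivWithin (u x) (Ioc 0 T) t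

/-- `u` is a (pointwise) solution of `ρ ∂ₜu + (-Δ)^s u = 0` in `S_T`. -/
structure IsEquationSolution {N : ℕ} (s T : ℝ) (ρ : RN N → ℝ) (u : RN N → ℝ → ℝ) : Prop where
  continuousOn : ContinuousOn (fun z : RN N × ℝ => u z.1 z.2) (slab N T)
  memLs : ∀ t ∈ Ioc 0 T, MemLs s (fun x => u x t)
  regular : ∀ t ∈ Ioc 0 T, FracRegular s (fun x => u x t)
  differentiableOn : ∀ x, DifferentiableOn ℝ (u x) (Ioc 0 T)
  continuousOn_timeDeriv :
    ContinuousOn (fun z : RN N × ℝ => timeDeriv T u z.1 z.2) (slab N T)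
  equation : ∀ x, ∀ t ∈ Ioc 0 T, ∃ L : ℝ,
    HasFracLaplacianAt s (fun y => u y t) x L ∧ ρ x * timeDeriv T u x t + L = 0

/-- `u` is a solution of the Cauchy problem `ρ ∂ₜu + (-Δ)^s u = 0` in `S_T`, `u(·, 0) = 0`. -/
structure IsCauchySolution {N : ℕ} (s T : ℝ) (ρ : RN N → ℝ) (u : RN N → ℝ → ℝ) : Prop where
  continuousOn_closed : ContinuousOn (fun z : RN N × ℝ => u z.1 z.2) (closedSlab N T)
  timeDeriv_locallyIntegrable :
    LocallyIntegrableOn (fun z : RN N × ℝ => timeDeriv T u z.1 z.2) (closedSlab N T)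
  memL1Ls : MemL1Ls s T u
  isEquationSolution : IsEquationSolution s T ρ u
  initial : ∀ x, u x 0 = 0

/-- The bound `ρ(x) ≥ K (1 + |x|²)^{-α/2}` on `ℝ^N`, for some `K > 0`. -/
def PowerLowerBound {N : ℕ} (ρ : RN N → ℝ) (α : ℝ) : Prop :=
  ∃ K > 0, ∀ x, K * (1 + ‖x‖ ^ 2) ^ (-(α / 2)) ≤ ρ x

/-- The bound `ρ(x) ≥ K (1 + |x|²)^{-s} log(1 + |x|²)` on `ℝ^N`, for some `K > 0`. -/
def LogLowerBound {N : ℕ} (ρ : RN N → ℝ) (s : ℝ) : Prop :=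
  ∃ K > 0, ∀ x, K * (1 + ‖x‖ ^ 2) ^ (-s) * Real.log (1 + ‖x‖ ^ 2) ≤ ρ x

/-! The proof is a weighted energy estimate with a convex function of `u`. Let `G` be convex, `C¹`,
nonnegative and zero only at `0`. Convexity gives `(-Δ)^s G(u) ≤ G'(u) (-Δ)^s u`, hence `ρ ∂ₜG(u) +
(-Δ)^s G(u) ≤ 0`. Pairing with a compactly supported `φ ≥ 0` and moving the operator onto `φ` bounds
the time derivative of `∫ ρ φ G(u)` by `∫ G(u) (-(-Δ)^s φ)`. The choice `G(a) = (√(1 + a²) - 1)^p`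
lies below `|a|^p` and is `C¹` even for `p = 1`, so the integrability assumption on `u` passes to
`G(u)`.

The test function is `φ_R = v χ(·/R)` with `v` positive of class `C^{1,1}` and `v = |x|^{-b}` for
`|x| ≥ 1`. At a point of the ball of radius `R`, `φ_R = v`, while `φ_R ≤ v` everywhere, so `-(-Δ)^s
φ_R ≤ -(-Δ)^s v` there. If `v` is a supersolution, `-(-Δ)^s v ≤ C ρ v` (`AdmissibleDecay`), this
part is absorbed by an exponential factor in time. Outside the ball, `|(-Δ)^s φ_R| ≤ C (1 +
|x|)^{-b}` uniformly in `R`; this needs `b ≤ N + 2s`, the decay that the nonlocal kernel preserves.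
The remaining error is a tail of the convergent integral of `G(u) (1 + |x|)^{-b}`, which vanishes as
`R → ∞` (`IsCauchySolution.comp_eq_zero`).

The operator is handled through its truncation, with the ball `|x - y| ≤ ε` removed. All integrals
then converge absolutely, so convexity and Fubini apply directly. For `u`, the limit `ε → 0` is
taken by dominated convergence on the support of `φ_R`, using the spatial regularity of `u`. For
`v`, only estimates uniform in `ε`, up to an error `D ε^{2-2s}`, are needed.

Everything thus reduces to the choice of `b`. For `b = N - 2s`, the function `|x|^{-b}` is
`s`-harmonic off the origin, lies above `v`, and agrees with `v` for `|x| ≥ 1`; hence `-(-Δ)^s v ≤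
0` there, and positivity of `ρ` on the unit ball suffices. For other `b`, `|(-Δ)^s v|` is at most a
multiple of `|x|^{-b-2s}` plus `|x|^{-N-2s}` times the mass of `(1 + |y|)^{-b}` in `|y| ≤ |x|`. That
mass is of order `|x|^{N-b}`, at most logarithmic, or bounded, as `b < N`, `b = N` or `b > N`, which
produces the three conditions on `ρ`. When `β > N + 2s`, the membership `u ∈ L¹((0,T); 𝓛^s)`
supplies the weight with exponent `N + 2s` and `p = 1`. -/

/-! ### Integrals of radial functions -/

theorem integrableOn_radial_iff {N : ℕ} (hN : 1 ≤ N) {S : Set ℝ} (hS : MeasurableSet S)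
    (g : ℝ → ℝ) :
    IntegrableOn (fun z : RN N => g ‖z‖) {z | ‖z‖ ∈ S} ↔
      IntegrableOn (fun t : ℝ => t ^ (N - 1) * g t) (Ioi 0 ∩ S) := by
  have : Nonempty (Fin N) := ⟨⟨0, hN⟩⟩
  have hmeas : MeasurableSet {z : RN N | ‖z‖ ∈ S} := measurable_norm hS
  have h := integrable_fun_norm_addHaar (E := RN N) volume (f := S.indicator g)
  have e1 : (fun z : RN N => S.indicator g ‖z‖) =
      {z : RN N | ‖z‖ ∈ S}.indicator (fun z => g ‖z‖) := by
    ext z; simp only [indicator, mem_ofPred_eq]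
  have e2 : (fun t : ℝ => t ^ (Module.finrank ℝ (RN N) - 1) • S.indicator g t) =
      S.indicator (fun t => t ^ (N - 1) * g t) := by
    ext t; by_cases ht : t ∈ S <;> simp [ht]
  rw [e1, integrable_indicator_iff hmeas, e2] at h
  rw [h, IntegrableOn, integrable_indicator_iff hS, IntegrableOn, Measure.restrict_restrict hS,
    inter_comm, IntegrableOn]

theorem setIntegral_radial {N : ℕ} (hN : 1 ≤ N) {S : Set ℝ} (hS : MeasurableSet S)
    (g : ℝ → ℝ) :
    ∫ z in {z : RN N | ‖z‖ ∈ S}, g ‖z‖ =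
      (N * volume.real (Metric.ball (0 : RN N) 1)) *
        ∫ t in Ioi 0 ∩ S, t ^ (N - 1) * g t := by
  have : Nonempty (Fin N) := ⟨⟨0, hN⟩⟩
  have hmeas : MeasurableSet {z : RN N | ‖z‖ ∈ S} := measurable_norm hS
  have h := integral_fun_norm_addHaar (E := RN N) volume (f := S.indicator g)
  have e1 : (fun z : RN N => S.indicator g ‖z‖) =
      {z : RN N | ‖z‖ ∈ S}.indicator (fun z => g ‖z‖) := by
    ext z; simp only [indicator, mem_ofPred_eq]
  have e2 : (fun t : ℝ => t ^ (Module.finrank ℝ (RN N) - 1) • S.indicator g t) =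
      S.indicator (fun t => t ^ (N - 1) * g t) := by
    ext t; by_cases ht : t ∈ S <;> simp [ht]
  rw [e1, integral_indicator hmeas, e2, setIntegral_indicator hS] at h
  rw [h]; simp [mul_assoc]

/-- The surface measure of the unit sphere. -/
noncomputable def sphereArea (N : ℕ) : ℝ := N * volume.real (Metric.ball (0 : RN N) 1)

theorem sphereArea_nonneg (N : ℕ) : 0 ≤ sphereArea N := by
  unfold sphereArea; positivity

theorem pow_pred_mul_rpow {N : ℕ} (hN : 1 ≤ N) {t : ℝ} (ht : 0 < t) (q : ℝ) :
    t ^ (N - 1) * t ^ q = t ^ (q + N - 1) := by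
  rw [← Real.rpow_natCast, ← Real.rpow_add ht, Nat.cast_sub hN]
  congr 1; push_cast; ring

theorem integrableOn_norm_rpow_le {N : ℕ} (hN : 1 ≤ N) {γ : ℝ} (hγ : 0 < γ) (r : ℝ) :
    IntegrableOn (fun z : RN N => ‖z‖ ^ (γ - N)) {z | ‖z‖ ≤ r} := by
  refine (integrableOn_radial_iff hN measurableSet_Iic (fun t => t ^ (γ - N))).2 ?_
  have h := (intervalIntegral.intervalIntegrable_rpow' (a := 0) (b := max r 0)
    (r := γ - 1) (by linarith)).1
  refine IntegrableOn.congr_fun (f := fun t => t ^ (γ - 1)) (h.mono_set ?_) ?_ (by measurability)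
  · rintro t ⟨h0, h1⟩; exact ⟨h0, le_trans h1 (le_max_left _ _)⟩
  · rintro t ⟨h0, h1⟩
    simp only [pow_pred_mul_rpow hN h0]; congr 1; ring

theorem setIntegral_norm_rpow_le {N : ℕ} (hN : 1 ≤ N) {γ : ℝ} (hγ : 0 < γ) {r : ℝ} (hr : 0 ≤ r) :
    ∫ z in {z : RN N | ‖z‖ ≤ r}, ‖z‖ ^ (γ - N) = sphereArea N * (r ^ γ / γ) := by
  have := setIntegral_radial hN (measurableSet_Iic (a := r)) (fun t => t ^ (γ - N))
  simp only [mem_Iic] at this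
  rw [this, ← sphereArea]
  congr 1
  have e : Ioi 0 ∩ Iic r = Ioc 0 r := rfl
  rw [e, setIntegral_congr_fun (g := fun t => t ^ (γ - 1)) measurableSet_Ioc,
    ← intervalIntegral.integral_of_le hr, integral_rpow (Or.inl (by linarith))]
  · simp [hγ.ne']
  · rintro t ⟨h0, h1⟩
    simp only [pow_pred_mul_rpow hN h0]; congr 1; ring

theorem integrableOn_norm_rpow_gt {N : ℕ} (hN : 1 ≤ N) {σ : ℝ} (hσ : 0 < σ) {r : ℝ} (hr : 0 < r) :
    IntegrableOn (fun z : RN N => ‖z‖ ^ (-((N : ℝ) + σ))) {z | r < ‖z‖} := by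
  refine (integrableOn_radial_iff hN measurableSet_Ioi (fun t => t ^ (-((N : ℝ) + σ)))).2 ?_
  have h := integrableOn_Ioi_rpow_of_lt (a := -σ - 1) (by linarith) hr
  refine IntegrableOn.congr_fun (f := fun t => t ^ (-σ - 1)) (h.mono_set ?_) ?_ (by measurability)
  · rintro t ⟨h0, h1⟩; exact h1
  · rintro t ⟨h0, h1⟩
    simp only [pow_pred_mul_rpow hN h0]; congr 1; ring

theorem setIntegral_norm_rpow_gt {N : ℕ} (hN : 1 ≤ N) {σ : ℝ} (hσ : 0 < σ) {r : ℝ} (hr : 0 < r) :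
    ∫ z in {z : RN N | r < ‖z‖}, ‖z‖ ^ (-((N : ℝ) + σ)) = sphereArea N * (r ^ (-σ) / σ) := by
  have := setIntegral_radial hN (measurableSet_Ioi (a := r)) (fun t => t ^ (-((N : ℝ) + σ)))
  simp only [mem_Ioi] at this
  rw [this, ← sphereArea]
  congr 1
  have e : Ioi 0 ∩ Ioi r = Ioi r := by
    ext t; simp only [mem_inter_iff, mem_Ioi]; exact ⟨fun h => h.2, fun h => ⟨hr.trans h, h⟩⟩
  rw [e, setIntegral_congr_fun (g := fun t => t ^ (-σ - 1)) measurableSet_Ioi,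
    integral_Ioi_rpow_of_lt (by linarith) hr]
  · have : -σ - 1 + 1 = -σ := by ring
    rw [this, neg_div_neg_eq]
  · intro t h0
    simp only [pow_pred_mul_rpow hN (hr.trans h0)]; congr 1; ring

/-- Logarithmic growth of the mass of `(1 + |y|)^{-N}` in balls. -/
theorem setIntegral_one_add_norm_rpow_neg_dim_le {N : ℕ} (hN : 1 ≤ N) {r : ℝ} (hr : 0 ≤ r) :
    ∫ z in {z : RN N | ‖z‖ ≤ r}, (1 + ‖z‖) ^ (-(N : ℝ)) ≤ sphereArea N * Real.log (1 + r) := by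
  have := setIntegral_radial hN (measurableSet_Iic (a := r)) (fun t => (1 + t) ^ (-(N : ℝ)))
  simp only [mem_Iic] at this
  rw [this, ← sphereArea]
  refine mul_le_mul_of_nonneg_left ?_ (sphereArea_nonneg N)
  have e : Ioi 0 ∩ Iic r = Ioc 0 r := rfl
  rw [e]
  have hc : ContinuousOn (fun t : ℝ => (1 + t)⁻¹) (Icc 0 r) := by
    refine ContinuousOn.inv₀ (by fun_prop) fun t ht => ?_
    have := ht.1; positivity
  have hi : IntegrableOn (fun t : ℝ => (1 + t)⁻¹) (Ioc 0 r) :=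
    (hc.integrableOn_compact isCompact_Icc).mono_set Ioc_subset_Icc_self
  calc ∫ t in Ioc 0 r, t ^ (N - 1) * (1 + t) ^ (-(N : ℝ))
      ≤ ∫ t in Ioc 0 r, (1 + t)⁻¹ := by
        refine integral_mono_of_nonneg ?_ hi ?_
        · filter_upwards [ae_restrict_mem measurableSet_Ioc] with t ht
          have := ht.1.le; show (0 : ℝ) ≤ _; positivity
        · filter_upwards [ae_restrict_mem measurableSet_Ioc] with t ht
          have h1 : (0 : ℝ) < 1 + t := by linarith [ht.1]
          -- Enlarging the radial Jacobian to `(1 + t)^{N-1}` leaves the integrand `1 / (1 + t)`.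
          have h2 : t ^ (N - 1) ≤ (1 + t) ^ (N - 1) :=
            pow_le_pow_left₀ ht.1.le (by linarith) _
          calc t ^ (N - 1) * (1 + t) ^ (-(N : ℝ)) ≤ (1 + t) ^ (N - 1) * (1 + t) ^ (-(N : ℝ)) := by
                gcongr
            _ = (1 + t)⁻¹ := by
                rw [pow_pred_mul_rpow hN h1, ← Real.rpow_neg_one]; congr 1; ring
    _ = Real.log (1 + r) := by
        rw [← intervalIntegral.integral_of_le hr]
        have := intervalIntegral.integral_comp_add_left (a := 0) (b := r) (fun t : ℝ => t⁻¹) 1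

        rw [this, integral_inv_of_pos (by norm_num) (by linarith)]
        simp

/-- The mass of a thin shell around the sphere of radius `ε`. -/
theorem setIntegral_shell_le {N : ℕ} (hN : 1 ≤ N) (q : ℝ) {a b : ℝ} (ha : 0 < a) (hab : a ≤ b) :
    IntegrableOn (fun z : RN N => ‖z‖ ^ (-q)) {z | ‖z‖ ∈ Icc a b} ∧
    ∫ z in {z : RN N | ‖z‖ ∈ Icc a b}, ‖z‖ ^ (-q) =
      sphereArea N * ∫ t in a..b, t ^ ((N : ℝ) - 1 - q) := by
  have e : Ioi 0 ∩ Icc a b = Icc a b := by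
    ext t; simp only [mem_inter_iff, mem_Ioi, mem_Icc]
    exact ⟨fun h => h.2, fun h => ⟨ha.trans_le h.1, h⟩⟩
  have ec : EqOn (fun t : ℝ => t ^ ((N : ℝ) - 1 - q)) (fun t => t ^ (N - 1) * t ^ (-q))
      (Icc a b) := by
    intro t ht
    simp only [pow_pred_mul_rpow hN (ha.trans_le ht.1)]; congr 1; ring
  constructor
  · refine (integrableOn_radial_iff hN measurableSet_Icc (fun t => t ^ (-q))).2 ?_
    rw [e]
    refine IntegrableOn.congr_fun ?_ ec measurableSet_Icc
    refine ContinuousOn.integrableOn_compact isCompact_Icc ?_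
    exact ContinuousOn.rpow_const continuousOn_id fun t ht => Or.inl (ha.trans_le ht.1).ne'
  · have := setIntegral_radial hN (measurableSet_Icc (a := a) (b := b)) (fun t => t ^ (-q))
    rw [this, ← sphereArea, e, ← setIntegral_congr_fun measurableSet_Icc ec,
      intervalIntegral.integral_of_le hab, integral_Icc_eq_integral_Ioc]

/-! ### The truncated fractional Laplacian -/

/-- The kernel `|z|^{-(N+2s)}`. -/
noncomputable def fracKernel {N : ℕ} (s : ℝ) (z : RN N) : ℝ := ‖z‖ ^ (-((N : ℝ) + 2 * s))

/-- The fractional Laplacian without its constant, with the ball of radius `ε` removed. -/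
noncomputable def truncFracLap {N : ℕ} (s ε : ℝ) (f : RN N → ℝ) (x : RN N) : ℝ :=
  ∫ y in {y | ε < ‖x - y‖}, (f x - f y) * fracKernel s (x - y)

theorem fracKernel_nonneg {N : ℕ} (s : ℝ) (z : RN N) : 0 ≤ fracKernel s z :=
  Real.rpow_nonneg (norm_nonneg _) _

theorem fracKernel_sub_comm {N : ℕ} (s : ℝ) (x y : RN N) :
    fracKernel s (x - y) = fracKernel s (y - x) := by
  unfold fracKernel; rw [norm_sub_rev]

theorem measurable_fracKernel {N : ℕ} (s : ℝ) : Measurable (fracKernel s : RN N → ℝ) :=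
  measurable_norm.pow_const _

theorem measurableSet_lt_norm_sub {N : ℕ} (x : RN N) (r : ℝ) :
    MeasurableSet {y : RN N | r < ‖x - y‖} :=
  measurableSet_lt measurable_const (measurable_const.sub measurable_id).norm

theorem measurableSet_annulus {N : ℕ} (x : RN N) (ε r : ℝ) :
    MeasurableSet {y : RN N | ε < ‖x - y‖ ∧ ‖x - y‖ ≤ r} :=
  (measurableSet_lt_norm_sub x ε).inter (measurableSet_le
    (measurable_const.sub measurable_id).norm measurable_const)

theorem integrableOn_comp_sub_left_iff {N : ℕ} (x : RN N) (g : RN N → ℝ) (S : Set (RN N)) :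
    IntegrableOn (fun y => g (x - y)) {y | x - y ∈ S} ↔ IntegrableOn g S :=
  (Measure.measurePreserving_sub_left volume x).integrableOn_comp_preimage
    (MeasurableEquiv.subLeft x).measurableEmbedding

theorem setIntegral_comp_sub_left {N : ℕ} (x : RN N) (g : RN N → ℝ) (S : Set (RN N)) :
    ∫ y in {y | x - y ∈ S}, g (x - y) = ∫ z in S, g z :=
  (Measure.measurePreserving_sub_left volume x).setIntegral_preimage_emb
    (MeasurableEquiv.subLeft x).measurableEmbedding g S

theorem integrableOn_fracKernel {N : ℕ} (hN : 1 ≤ N) {s : ℝ} (hs : 0 < s) (x : RN N) {r : ℝ}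
    (hr : 0 < r) : IntegrableOn (fun y => fracKernel s (x - y)) {y | r < ‖x - y‖} :=
  (integrableOn_comp_sub_left_iff x (fracKernel s) {z | r < ‖z‖}).2
    (integrableOn_norm_rpow_gt hN (by linarith) hr)

theorem setIntegral_fracKernel {N : ℕ} (hN : 1 ≤ N) {s : ℝ} (hs : 0 < s) (x : RN N) {r : ℝ}
    (hr : 0 < r) : ∫ y in {y | r < ‖x - y‖}, fracKernel s (x - y) =
      sphereArea N * (r ^ (-(2 * s)) / (2 * s)) :=
  (setIntegral_comp_sub_left x (fracKernel s) {z | r < ‖z‖}).trans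
    (setIntegral_norm_rpow_gt hN (by linarith) hr)

theorem integrable_one_add_norm_rpow {N : ℕ} {s : ℝ} (hs : 0 < s) :
    Integrable (fun y : RN N => (1 + ‖y‖) ^ (-((N : ℝ) + 2 * s))) :=
  integrable_one_add_norm (by simp; linarith)

/-- Since `|x - y| > ε`, one has `1 + |y| ≤ (1 + ε⁻¹)(1 + |x|)|x - y|`. This exchanges the truncated
kernel for the weight of `𝓛^s`, at the price of growth in `x` only. -/
theorem fracKernel_le {N : ℕ} {s ε : ℝ} (hs : 0 < s) (hε : 0 < ε) {x y : RN N}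
    (h : ε < ‖x - y‖) :
    fracKernel s (x - y) ≤ ((1 + ε⁻¹) * (1 + ‖x‖)) ^ ((N : ℝ) + 2 * s) *
      (1 + ‖y‖) ^ (-((N : ℝ) + 2 * s)) := by
  have ha : 0 ≤ (N : ℝ) + 2 * s := by positivity
  have hz : 0 < ‖x - y‖ := hε.trans h
  have hy : 1 + ‖y‖ ≤ ((1 + ε⁻¹) * (1 + ‖x‖)) * ‖x - y‖ := by
    have h1 : ‖y‖ ≤ ‖x‖ + ‖x - y‖ := by
      have := norm_sub_le x (x - y); simpa using this
    have h2 : 1 ≤ ε⁻¹ * ‖x - y‖ := by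
      rw [inv_mul_eq_div, one_le_div hε]; exact h.le
    have h3 := mul_nonneg (norm_nonneg x) (norm_nonneg (x - y))
    have h4 : ‖x‖ ≤ ‖x‖ * (ε⁻¹ * ‖x - y‖) := le_mul_of_one_le_right (norm_nonneg x) h2
    nlinarith
  have h1 : (1 + ‖y‖) ^ ((N : ℝ) + 2 * s) ≤
      ((1 + ε⁻¹) * (1 + ‖x‖)) ^ ((N : ℝ) + 2 * s) * ‖x - y‖ ^ ((N : ℝ) + 2 * s) := by
    rw [← Real.mul_rpow (by positivity) hz.le]
    exact Real.rpow_le_rpow (by positivity) hy ha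
  unfold fracKernel
  rw [Real.rpow_neg hz.le, Real.rpow_neg (by positivity), inv_le_iff_one_le_mul₀ (by positivity),
    mul_assoc, ← div_eq_inv_mul, mul_div_assoc', le_div_iff₀ (by positivity), one_mul]
  exact h1

theorem integrableOn_mul_fracKernel {N : ℕ} {s ε : ℝ} (hs : 0 < s) (hε : 0 < ε) {f : RN N → ℝ}
    (hf : Measurable f) (hfi : Integrable fun y => f y * (1 + ‖y‖) ^ (-((N : ℝ) + 2 * s)))
    (x : RN N) : IntegrableOn (fun y => f y * fracKernel s (x - y)) {y | ε < ‖x - y‖} := by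
  refine Integrable.mono'
    (hfi.norm.const_mul (((1 + ε⁻¹) * (1 + ‖x‖)) ^ ((N : ℝ) + 2 * s))).integrableOn
    ((hf.mul ((measurable_fracKernel s).comp (by fun_prop))).aestronglyMeasurable) ?_
  filter_upwards [ae_restrict_mem (measurableSet_lt_norm_sub x ε)] with y hy
  rw [norm_mul, norm_mul, Real.norm_of_nonneg (fracKernel_nonneg s _),
    Real.norm_of_nonneg (by positivity : 0 ≤ (1 + ‖y‖) ^ (-((N : ℝ) + 2 * s)))]
  have := mul_le_mul_of_nonneg_left (fracKernel_le hs hε hy) (norm_nonneg (f y))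
  linarith

theorem integrableOn_sub_mul_fracKernel {N : ℕ} (hN : 1 ≤ N) {s ε : ℝ} (hs : 0 < s) (hε : 0 < ε)
    {f : RN N → ℝ} (hf : Measurable f)
    (hfi : Integrable fun y => f y * (1 + ‖y‖) ^ (-((N : ℝ) + 2 * s))) (x : RN N) :
    IntegrableOn (fun y => (f x - f y) * fracKernel s (x - y)) {y | ε < ‖x - y‖} := by
  simp only [sub_mul]
  exact Integrable.sub ((integrableOn_fracKernel hN hs x hε).const_mul (f x))
    (integrableOn_mul_fracKernel hs hε hf hfi x)

theorem integrable_weight_of_bounded {N : ℕ} {s M : ℝ} (hs : 0 < s) {f : RN N → ℝ}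
    (hf : Measurable f) (hM : ∀ y, |f y| ≤ M) :
    Integrable fun y => f y * (1 + ‖y‖) ^ (-((N : ℝ) + 2 * s)) :=
  (integrable_one_add_norm_rpow hs).bdd_mul (c := M) hf.aestronglyMeasurable
    (Eventually.of_forall hM)

/-- Splitting the truncated operator at radius `r`. -/
theorem truncFracLap_eq_add {N : ℕ} {s ε r : ℝ} (hεr : ε ≤ r) {f : RN N → ℝ} {x : RN N}
    (hi : IntegrableOn (fun y => (f x - f y) * fracKernel s (x - y)) {y | ε < ‖x - y‖}) :
    truncFracLap s ε f x =
      (∫ y in {y | ε < ‖x - y‖ ∧ ‖x - y‖ ≤ r}, (f x - f y) * fracKernel s (x - y)) +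
      ∫ y in {y | r < ‖x - y‖}, (f x - f y) * fracKernel s (x - y) := by
  have hU : {y : RN N | ε < ‖x - y‖} =
      {y | ε < ‖x - y‖ ∧ ‖x - y‖ ≤ r} ∪ {y | r < ‖x - y‖} := by
    ext y; simp only [mem_ofPred_eq, mem_union]
    constructor
    · intro h
      rcases le_or_gt ‖x - y‖ r with h' | h'
      · exact Or.inl ⟨h, h'⟩
      · exact Or.inr h'
    · rintro (h | h)
      · exact h.1
      · exact hεr.trans_lt h
  unfold truncFracLap
  rw [hU] at hi ⊢
  refine setIntegral_union ?_ (measurableSet_lt_norm_sub x r) (hi.mono_set subset_union_left)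
    (hi.mono_set subset_union_right)
  rw [disjoint_left]
  rintro y ⟨_, h⟩ h'
  exact absurd h' (not_lt.2 h)

/-- Odd parts do not contribute to the integral over an annulus. -/
theorem setIntegral_annulus_linear {N : ℕ} (s ε r : ℝ) (A : RN N →L[ℝ] ℝ) (x : RN N) :
    ∫ y in {y | ε < ‖x - y‖ ∧ ‖x - y‖ ≤ r}, A (x - y) * fracKernel s (x - y) = 0 := by
  have h1 := setIntegral_comp_sub_left x (fun z => A z * fracKernel s z)
    {z : RN N | ε < ‖z‖ ∧ ‖z‖ ≤ r}
  -- With centre `0` the substitution is `z ↦ -z`, which shows that the integral equals its own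
  -- negative.
  have h2 := setIntegral_comp_sub_left 0 (fun z => A z * fracKernel s z)
    {z : RN N | ε < ‖z‖ ∧ ‖z‖ ≤ r}
  simp only [mem_ofPred_eq, zero_sub, map_neg, norm_neg, neg_mul] at h1 h2
  have h3 : ∀ z : RN N, fracKernel s (-z) = fracKernel s z := fun z => by
    unfold fracKernel; rw [norm_neg]
  simp only [h3, integral_neg] at h2
  rw [h1]; linarith

theorem integrableOn_annulus_linear {N : ℕ} (hN : 1 ≤ N) {s ε : ℝ} (hs : 0 < s) (hε : 0 < ε)
    (r : ℝ) (A : RN N →L[ℝ] ℝ) (x : RN N) :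
    IntegrableOn (fun y => A (x - y) * fracKernel s (x - y))
      {y | ε < ‖x - y‖ ∧ ‖x - y‖ ≤ r} := by
  refine Integrable.mono' (((integrableOn_fracKernel hN hs x hε).mono_set
    (fun y hy => hy.1)).const_mul (‖A‖ * r)) (by
      refine (Measurable.mul (by fun_prop) ?_).aestronglyMeasurable
      exact (measurable_fracKernel s).comp (by fun_prop)) ?_
  filter_upwards [ae_restrict_mem (measurableSet_annulus x ε r)] with y hy
  rw [norm_mul, Real.norm_of_nonneg (fracKernel_nonneg s _)]
  refine mul_le_mul_of_nonneg_right ((A.le_opNorm _).trans ?_) (fracKernel_nonneg s _)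
  exact mul_le_mul_of_nonneg_left hy.2 (norm_nonneg A)

/-- The contribution of a neighbourhood of `x`, for functions that are approximated by affine
functions to an order higher than `2s`. -/
theorem abs_setIntegral_annulus_le {N : ℕ} (hN : 1 ≤ N) {s ε γ r C : ℝ} (hs : 0 < s) (hε : 0 < ε)
    (hγ : 0 < γ) (hr : 0 ≤ r) {f : RN N → ℝ} (A : RN N →L[ℝ] ℝ) (x : RN N)
    (hi : IntegrableOn (fun y => (f x - f y) * fracKernel s (x - y)) {y | ε < ‖x - y‖})
    (h : ∀ y, ‖x - y‖ ≤ r → |f x - f y - A (x - y)| ≤ C * ‖x - y‖ ^ (2 * s + γ)) :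
    |∫ y in {y | ε < ‖x - y‖ ∧ ‖x - y‖ ≤ r}, (f x - f y) * fracKernel s (x - y)| ≤
      C * (sphereArea N * (r ^ γ / γ)) := by
  have e : ∫ y in {y | ε < ‖x - y‖ ∧ ‖x - y‖ ≤ r}, (f x - f y) * fracKernel s (x - y) =
      ∫ y in {y | ε < ‖x - y‖ ∧ ‖x - y‖ ≤ r},
        (f x - f y - A (x - y)) * fracKernel s (x - y) := by
    have hi' := hi.mono_set (show {y | ε < ‖x - y‖ ∧ ‖x - y‖ ≤ r} ⊆ {y | ε < ‖x - y‖} from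
      fun y hy => hy.1)
    have := integral_sub hi'.integrable (integrableOn_annulus_linear hN hs hε r A x).integrable
    rw [setIntegral_annulus_linear, sub_zero] at this
    rw [← this]
    simp only [sub_mul]
  have hC : ∀ y, ‖x - y‖ ≤ r → 0 < ‖x - y‖ → 0 ≤ C := fun y hy h0 => by
    have := (abs_nonneg _).trans (h y hy)
    exact nonneg_of_mul_nonneg_left this (by positivity)
  have hI := integrableOn_norm_rpow_le hN hγ r
  rw [← integrableOn_comp_sub_left_iff x] at hI
  have hV := setIntegral_norm_rpow_le hN hγ hr
  rw [← setIntegral_comp_sub_left x] at hV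
  rw [e, ← Real.norm_eq_abs, ← hV, ← integral_const_mul]
  simp only [mem_ofPred_eq] at hI ⊢
  -- The sign of `C` is not assumed; the hypothesis forces `C ≥ 0` as soon as some point lies at a
  -- distance in `(0, r]`. If the annulus is empty, a point at distance exactly `r` serves, unless
  -- `r = 0`, when the bound itself is `0`.
  rcases (({y : RN N | ε < ‖x - y‖ ∧ ‖x - y‖ ≤ r}).eq_empty_or_nonempty) with h0 | ⟨y0, hy0⟩
  · rw [h0]; simp only [Measure.restrict_empty, integral_zero_measure, norm_zero]
    rw [integral_const_mul]
    by_cases hr0 : r = 0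
    · subst hr0
      simp only [mem_ofPred_eq] at hV
      rw [hV, Real.zero_rpow hγ.ne']; simp
    · have hr' : 0 < r := lt_of_le_of_ne hr (Ne.symm hr0)
      refine mul_nonneg ?_ (integral_nonneg fun y => by positivity)
      let e0 : RN N := EuclideanSpace.single ⟨0, hN⟩ r
      have he : ‖x - (x - e0)‖ = r := by
        simp [e0, abs_of_pos hr']
      exact hC _ he.le (he ▸ hr')
  have hC0 : 0 ≤ C := hC y0 hy0.2 (hε.trans hy0.1)
  refine (norm_integral_le_of_norm_le
    (g := fun y => C * ‖x - y‖ ^ (γ - N)) ?_ ?_).trans ?_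
  · exact (hI.mono_set fun y hy => hy.2).const_mul C
  · filter_upwards [ae_restrict_mem (measurableSet_annulus x ε r)] with y hy
    have hz : 0 < ‖x - y‖ := hε.trans hy.1
    rw [norm_mul, Real.norm_of_nonneg (fracKernel_nonneg s _)]
    refine (mul_le_mul_of_nonneg_right (h y hy.2) (fracKernel_nonneg s _)).trans_eq ?_
    unfold fracKernel
    rw [mul_assoc, ← Real.rpow_add hz]; congr 2; ring
  · refine setIntegral_mono_set (hI.const_mul C) ?_ ?_
    · exact Eventually.of_forall fun y => by show 0 ≤ C * ‖x - y‖ ^ (γ - N); positivity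
    · exact (show {y | ε < ‖x - y‖ ∧ ‖x - y‖ ≤ r} ⊆ {y | ‖x - y‖ ≤ r} from
        fun y hy => hy.2).eventuallyLE

/-- Either `1 + |y|` is at least `(1 + |x|) / 2`, and the weight at `y` is comparable to that at
`x`; or `|x - y|` exceeds both `(1 + |x|) / 2` and `1 + |y|`, and the kernel splits into the powers
`b` and `N + 2s - b`. The second exponent must be nonnegative, whence `b ≤ N + 2s`. -/
theorem one_add_norm_rpow_mul_fracKernel_le {N : ℕ} {s b : ℝ} (hb : 0 ≤ b)
    (hb' : b ≤ (N : ℝ) + 2 * s) (x y : RN N) :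
    (1 + ‖y‖) ^ (-b) * fracKernel s (x - y) ≤
      2 ^ b * (1 + ‖x‖) ^ (-b) *
        (fracKernel s (x - y) + (1 + ‖y‖) ^ (-((N : ℝ) + 2 * s))) := by
  have hx : 0 < 1 + ‖x‖ := by positivity
  have hy : 0 < 1 + ‖y‖ := by positivity
  have hK := fracKernel_nonneg s (x - y)
  have hw : 0 ≤ (1 + ‖y‖) ^ (-((N : ℝ) + 2 * s)) := by positivity
  have hhalf : ((1 + ‖x‖) / 2) ^ (-b) = 2 ^ b * (1 + ‖x‖) ^ (-b) := by
    rw [Real.div_rpow hx.le (by norm_num), Real.rpow_neg (by norm_num : (0 : ℝ) ≤ 2)]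
    field_simp
  rw [← hhalf]
  have hh : 0 ≤ ((1 + ‖x‖) / 2) ^ (-b) := by positivity
  rcases le_or_gt ((1 + ‖x‖) / 2) (1 + ‖y‖) with h | h
  · have h1 : (1 + ‖y‖) ^ (-b) ≤ ((1 + ‖x‖) / 2) ^ (-b) :=
      Real.rpow_le_rpow_of_nonpos (by positivity) h (by linarith)
    have := mul_le_mul_of_nonneg_right h1 hK
    nlinarith [mul_nonneg hh hw]
  · have h0 : ‖x‖ - ‖y‖ ≤ ‖x - y‖ := norm_sub_norm_le x y
    have h1 : (1 + ‖x‖) / 2 ≤ ‖x - y‖ := by linarith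
    have h2 : 1 + ‖y‖ ≤ ‖x - y‖ := by linarith
    have hz : 0 < ‖x - y‖ := hy.trans_le h2
    have h3 : fracKernel s (x - y) ≤
        ((1 + ‖x‖) / 2) ^ (-b) * (1 + ‖y‖) ^ (-((N : ℝ) + 2 * s - b)) := by
      have : fracKernel s (x - y) = ‖x - y‖ ^ (-b) * ‖x - y‖ ^ (-((N : ℝ) + 2 * s - b)) := by
        unfold fracKernel; rw [← Real.rpow_add hz]; congr 1; ring
      rw [this]
      exact mul_le_mul (Real.rpow_le_rpow_of_nonpos (by positivity) h1 (by linarith))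
        (Real.rpow_le_rpow_of_nonpos hy h2 (by linarith)) (by positivity) hh
    have h4 : (1 + ‖y‖) ^ (-b) * (1 + ‖y‖) ^ (-((N : ℝ) + 2 * s - b)) =
        (1 + ‖y‖) ^ (-((N : ℝ) + 2 * s)) := by
      rw [← Real.rpow_add hy]; congr 1; ring
    calc (1 + ‖y‖) ^ (-b) * fracKernel s (x - y)
        ≤ (1 + ‖y‖) ^ (-b) *
          (((1 + ‖x‖) / 2) ^ (-b) * (1 + ‖y‖) ^ (-((N : ℝ) + 2 * s - b))) :=
          mul_le_mul_of_nonneg_left h3 (by positivity)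
      _ = ((1 + ‖x‖) / 2) ^ (-b) * (1 + ‖y‖) ^ (-((N : ℝ) + 2 * s)) := by rw [← h4]; ring
      _ ≤ _ := by nlinarith [mul_nonneg hh hK]

/-- The truncated operator maps regular functions of decay `(1 + |x|)^{-b}`, `b ≤ N + 2s`, to
functions of the same decay. -/
theorem exists_abs_truncFracLap_le {N : ℕ} (hN : 1 ≤ N) {s b : ℝ} (hs0 : 0 < s) (hs1 : s < 1)
    (hb : 0 ≤ b) (hb' : b ≤ (N : ℝ) + 2 * s) (M : ℝ) :
    ∃ C, 0 ≤ C ∧ ∀ (f : RN N → ℝ) (A : RN N → (RN N →L[ℝ] ℝ)), Measurable f →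
      (∀ y, |f y| ≤ M * (1 + ‖y‖) ^ (-b)) →
      (∀ x y, ‖x - y‖ ≤ 1 / 2 →
        |f x - f y - A x (x - y)| ≤ M * (1 + ‖x‖) ^ (-b) * ‖x - y‖ ^ 2) →
      ∀ ε, 0 < ε → ε ≤ 1 / 2 → ∀ x, |truncFracLap s ε f x| ≤ C * (1 + ‖x‖) ^ (-b) := by
  set κ : ℝ := sphereArea N * ((1 / 2) ^ (-(2 * s)) / (2 * s)) with hκ
  set J : ℝ := ∫ y : RN N, (1 + ‖y‖) ^ (-((N : ℝ) + 2 * s)) with hJ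
  have hJ0 : 0 ≤ J := integral_nonneg fun y => by positivity
  have hκ0 : 0 ≤ κ := mul_nonneg (sphereArea_nonneg N) (by positivity)
  -- The surplus of a second order approximation over the order `2s` of the operator.
  have hγ : 0 < 2 - 2 * s := by linarith
  set η : ℝ := sphereArea N * ((1 / 2) ^ (2 - 2 * s) / (2 - 2 * s)) with hη
  have hη0 : 0 ≤ η := mul_nonneg (sphereArea_nonneg N) (by positivity)
  refine ⟨|M| * η + (|M| * κ + |M| * (2 ^ b * (κ + J))), by positivity, ?_⟩
  intro f A hf hfM hfA ε hε hε2 x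
  have hw0 : 0 ≤ (1 + ‖x‖) ^ (-b) := by positivity
  have hle1 : ∀ y : RN N, (1 + ‖y‖) ^ (-b) ≤ 1 := fun y =>
    Real.rpow_le_one_of_one_le_of_nonpos (by linarith [norm_nonneg y]) (by linarith)
  have hfM' : ∀ y, |f y| ≤ |M| * (1 + ‖y‖) ^ (-b) := fun y => (hfM y).trans
    (mul_le_mul_of_nonneg_right (le_abs_self M) (by positivity))
  have hfi := integrable_weight_of_bounded hs0 hf
    (fun y => (hfM' y).trans (mul_le_of_le_one_right (abs_nonneg M) (hle1 y)))
  have hi := integrableOn_sub_mul_fracKernel hN hs0 hε hf hfi x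
  rw [truncFracLap_eq_add hε2 hi]
  refine (abs_add_le _ _).trans ?_
  have hnear := abs_setIntegral_annulus_le hN (C := |M| * (1 + ‖x‖) ^ (-b)) hs0 hε hγ
    (by norm_num : (0 : ℝ) ≤ 1 / 2) (A x) x hi (fun y hy => by
      refine (hfA x y hy).trans ?_
      have e : 2 * s + (2 - 2 * s) = ((2 : ℕ) : ℝ) := by push_cast; ring
      rw [e, Real.rpow_natCast]
      gcongr; exact le_abs_self M)
  have hIK := integrableOn_fracKernel hN hs0 x (by norm_num : (0 : ℝ) < 1 / 2)
  have hIw : IntegrableOn (fun y : RN N => (1 + ‖y‖) ^ (-((N : ℝ) + 2 * s)))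
    {y | 1 / 2 < ‖x - y‖} := (integrable_one_add_norm_rpow hs0).integrableOn
  have hfar : |∫ y in {y | 1 / 2 < ‖x - y‖}, (f x - f y) * fracKernel s (x - y)| ≤
      (|M| * κ + |M| * (2 ^ b * (κ + J))) * (1 + ‖x‖) ^ (-b) := by
    rw [← Real.norm_eq_abs]
    refine (norm_integral_le_of_norm_le
      (g := fun y => (|M| * (1 + ‖x‖) ^ (-b)) * fracKernel s (x - y) +
        (|M| * (2 ^ b * (1 + ‖x‖) ^ (-b))) *
          (fracKernel s (x - y) + (1 + ‖y‖) ^ (-((N : ℝ) + 2 * s)))) ?_ ?_).trans ?_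
    · exact (hIK.const_mul _).add ((hIK.add hIw).const_mul _)
    · filter_upwards [ae_restrict_mem (measurableSet_lt_norm_sub x (1 / 2))] with y hy
      have hK := fracKernel_nonneg s (x - y)
      rw [norm_mul, Real.norm_of_nonneg hK, Real.norm_eq_abs]
      have h1 := one_add_norm_rpow_mul_fracKernel_le hb hb' x y
      have h2 : |f x - f y| ≤ |M| * (1 + ‖x‖) ^ (-b) + |M| * (1 + ‖y‖) ^ (-b) :=
        (abs_sub _ _).trans (add_le_add (hfM' x) (hfM' y))
      calc |f x - f y| * fracKernel s (x - y)
          ≤ (|M| * (1 + ‖x‖) ^ (-b) + |M| * (1 + ‖y‖) ^ (-b)) * fracKernel s (x - y) :=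
            mul_le_mul_of_nonneg_right h2 hK
        _ = |M| * (1 + ‖x‖) ^ (-b) * fracKernel s (x - y) +
            |M| * ((1 + ‖y‖) ^ (-b) * fracKernel s (x - y)) := by ring
        _ ≤ _ := by
            have := mul_le_mul_of_nonneg_left h1 (abs_nonneg M)
            linarith
    · have hadd : IntegrableOn (fun y => fracKernel s (x - y) +
          (1 + ‖y‖) ^ (-((N : ℝ) + 2 * s))) {y | 1 / 2 < ‖x - y‖} := hIK.add hIw
      rw [integral_add (hIK.const_mul _) (hadd.const_mul _), integral_const_mul,
        integral_const_mul, integral_add hIK hIw, setIntegral_fracKernel hN hs0 x (by norm_num),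
        ← hκ]
      have : ∫ y in {y : RN N | 1 / 2 < ‖x - y‖}, (1 + ‖y‖) ^ (-((N : ℝ) + 2 * s)) ≤ J :=
        setIntegral_le_integral (integrable_one_add_norm_rpow hs0)
          (Eventually.of_forall fun y => by show (0 : ℝ) ≤ _; positivity)
      have h3 := mul_le_mul_of_nonneg_left (add_le_add_right this κ)
        (by positivity : 0 ≤ |M| * (2 ^ b * (1 + ‖x‖) ^ (-b)))
      linarith
  linarith

/-! ### The test function -/

/-- Convexity of `t^{-c}`, from `q^{-c} = exp(-c log q) ≥ 1 - c log q ≥ 1 - c (q - 1)` at `q = t /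
a`. -/
theorem rpow_neg_tangent_le {a t c : ℝ} (ha : 0 < a) (ht : 0 < t) (hc : 0 ≤ c) :
    a ^ (-c) - c * a ^ (-c - 1) * (t - a) ≤ t ^ (-c) := by
  have hta : 0 < t / a := div_pos ht ha
  have h1 : 1 - c * (t / a - 1) ≤ (t / a) ^ (-c) := by
    rw [Real.rpow_def_of_pos hta]
    have h2 := Real.add_one_le_exp (Real.log (t / a) * -c)
    have h3 := mul_le_mul_of_nonneg_left (Real.log_le_sub_one_of_pos hta) hc
    linarith
  rw [Real.div_rpow ht.le ha.le, le_div_iff₀ (by positivity)] at h1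
  rw [Real.rpow_sub_one ha.ne']
  refine le_trans (le_of_eq ?_) h1
  field_simp

theorem abs_rpow_neg_sub_le {c d t t' : ℝ} (hc : 0 ≤ c) (hd : 0 < d) (ht : d ≤ t) (ht' : d ≤ t') :
    |t ^ (-c) - t' ^ (-c)| ≤ c * d ^ (-c - 1) * |t - t'| := by
  wlog h : t ≤ t' generalizing t t'
  · rw [abs_sub_comm, abs_sub_comm t t']
    exact this ht' ht (le_of_not_ge h)
  have ht0 : 0 < t := hd.trans_le ht
  have h1 := rpow_neg_tangent_le ht0 (hd.trans_le ht') hc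
  have h2 : t' ^ (-c) ≤ t ^ (-c) := Real.rpow_le_rpow_of_nonpos ht0 h (by linarith)
  have h3 : t ^ (-c - 1) ≤ d ^ (-c - 1) := Real.rpow_le_rpow_of_nonpos hd ht (by linarith)
  rw [abs_of_nonneg (by linarith), abs_of_nonpos (by linarith)]
  have h4 := mul_le_mul_of_nonneg_left (mul_le_mul_of_nonneg_left h3 hc) (by linarith : 0 ≤ t' - t)
  linarith

/-- The derivative of `decayProfile b`. -/
noncomputable def decaySlope (b r : ℝ) : ℝ := -((b / 2) * (max r 1) ^ (-(b / 2) - 1))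

/-- The convex function equal to `r^{-b/2}` for `r ≥ 1` and to its tangent at `1` for `r ≤ 1`. -/
noncomputable def decayProfile (b r : ℝ) : ℝ :=
  (max r 1) ^ (-(b / 2)) + decaySlope b r * (r - max r 1)

/-- Convexity of the profile. The tangent at `r` is that of `t^{-b/2}` at `max r 1`; for `r' < 1`
the profile continues with the slope at `1`, which is the smallest of all slopes, so going left it
rises at least as fast as the tangent. -/
theorem decayProfile_tangent_le {b : ℝ} (hb : 0 ≤ b) (r r' : ℝ) :
    decayProfile b r + decaySlope b r * (r' - r) ≤ decayProfile b r' := by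
  have hb2 : 0 ≤ b / 2 := by linarith
  have hM : 0 < max r 1 := lt_max_of_lt_right one_pos
  have hM' : 0 < max r' 1 := lt_max_of_lt_right one_pos
  have h1 := rpow_neg_tangent_le hM hM' hb2
  have e : decayProfile b r + decaySlope b r * (r' - r) =
      (max r 1) ^ (-(b / 2)) + decaySlope b r * (r' - max r 1) := by
    unfold decayProfile; ring
  rw [e]
  have h2 : decaySlope b r * (r' - max r' 1) ≤ decaySlope b r' * (r' - max r' 1) := by
    rcases le_total 1 r' with h | h
    · simp [max_eq_left h]
    · have : decaySlope b r' ≤ decaySlope b r := by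
        unfold decaySlope
        rw [max_eq_right h, Real.one_rpow, neg_le_neg_iff]
        exact mul_le_mul_of_nonneg_left
          (Real.rpow_le_one_of_one_le_of_nonpos (le_max_right _ _) (by linarith)) hb2
      rw [max_eq_right h]
      nlinarith
  unfold decayProfile
  unfold decaySlope at h2 ⊢
  linarith

/-- The profile is only `C^{1,1}`. The tangent inequalities at `r` and at `r'` trap the remainder
between `0` and the increment of the slope times `r' - r`, and the slope is Lipschitz where `max r 1
≥ d`. -/
theorem abs_decayProfile_sub_le {b d r r' : ℝ} (hb : 0 ≤ b) (hd : 0 < d) (hr : d ≤ max r 1)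
    (hr' : d ≤ max r' 1) :
    |decayProfile b r' - decayProfile b r - decaySlope b r * (r' - r)| ≤
      (b / 2) * (b / 2 + 1) * d ^ (-(b / 2) - 2) * (r' - r) ^ 2 := by
  have h1 := decayProfile_tangent_le hb r r'
  have h2 := decayProfile_tangent_le hb r' r
  rw [abs_of_nonneg (by linarith)]
  have h3 := abs_rpow_neg_sub_le (by linarith : 0 ≤ b / 2 + 1) hd hr hr'
  have h4 : |max r 1 - max r' 1| ≤ |r - r'| := abs_max_sub_max_le_abs r r' 1
  have e1 : -(b / 2 + 1) = -(b / 2) - 1 := by ring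
  have e2 : -(b / 2 + 1) - 1 = -(b / 2) - 2 := by ring
  rw [e2, e1] at h3
  have hD : 0 ≤ d ^ (-(b / 2) - 2) := by positivity
  have h5 : |decaySlope b r' - decaySlope b r| ≤
      (b / 2) * ((b / 2 + 1) * d ^ (-(b / 2) - 2) * |r - r'|) := by
    have : decaySlope b r' - decaySlope b r =
        (b / 2) * ((max r 1) ^ (-(b / 2) - 1) - (max r' 1) ^ (-(b / 2) - 1)) := by
      unfold decaySlope; ring
    rw [this, abs_mul, abs_of_nonneg (by linarith : 0 ≤ b / 2)]
    refine mul_le_mul_of_nonneg_left (h3.trans ?_) (by linarith)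
    exact mul_le_mul_of_nonneg_left h4 (mul_nonneg (by linarith) hD)
  calc decayProfile b r' - decayProfile b r - decaySlope b r * (r' - r)
      ≤ (decaySlope b r' - decaySlope b r) * (r' - r) := by linarith
    _ ≤ |decaySlope b r' - decaySlope b r| * |r' - r| := by
        rw [← abs_mul]; exact le_abs_self _
    _ ≤ (b / 2) * ((b / 2 + 1) * d ^ (-(b / 2) - 2) * |r - r'|) * |r' - r| :=
        mul_le_mul_of_nonneg_right h5 (abs_nonneg _)
    _ = (b / 2) * (b / 2 + 1) * d ^ (-(b / 2) - 2) * (|r' - r| * |r' - r|) := by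
        rw [abs_sub_comm r r']; ring
    _ = _ := by rw [abs_mul_abs_self]; ring

/-- A positive function of class `C^{1,1}` equal to `|x|^{-b}` for `|x| ≥ 1`. -/
noncomputable def decayFn {N : ℕ} (b : ℝ) (x : RN N) : ℝ := decayProfile b (‖x‖ ^ 2)

/-- The differential of `decayFn b`. -/
noncomputable def decayGrad {N : ℕ} (b : ℝ) (x : RN N) : RN N →L[ℝ] ℝ :=
  (2 * decaySlope b (‖x‖ ^ 2)) • innerSL ℝ x

theorem continuous_decayFn {N : ℕ} (b : ℝ) : Continuous (decayFn b : RN N → ℝ) := by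
  have hM : Continuous fun x : RN N => max (‖x‖ ^ 2) 1 := by fun_prop
  have hM0 : ∀ x : RN N, max (‖x‖ ^ 2) 1 ≠ 0 := fun x => (lt_max_of_lt_right one_pos).ne'
  unfold decayFn decayProfile decaySlope
  refine (hM.rpow_const fun x => Or.inl (hM0 x)).add (Continuous.mul ?_ (by fun_prop))
  exact ((hM.rpow_const fun x => Or.inl (hM0 x)).const_mul _).neg

theorem decayFn_of_one_le {N : ℕ} (b : ℝ) {x : RN N} (hx : 1 ≤ ‖x‖) :
    decayFn b x = ‖x‖ ^ (-b) := by
  have h1 : 1 ≤ ‖x‖ ^ 2 := one_le_pow₀ hx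
  unfold decayFn decayProfile
  rw [max_eq_left h1, sub_self, mul_zero, add_zero, ← Real.rpow_natCast,
    ← Real.rpow_mul (norm_nonneg x)]
  congr 1; push_cast; ring

/-- Inside the unit ball the profile is a tangent line, which lies below the convex power. This
ordering, with equality outside the unit ball, transfers harmonicity of the Riesz potential to a
supersolution property. -/
theorem decayFn_le_rpow {N : ℕ} {b : ℝ} (hb : 0 ≤ b) {x : RN N} (hx : x ≠ 0) :
    decayFn b x ≤ ‖x‖ ^ (-b) := by
  rcases le_total 1 ‖x‖ with h | h
  · exact (decayFn_of_one_le b h).le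
  · have h0 : 0 < ‖x‖ := norm_pos_iff.2 hx
    have h1 : ‖x‖ ^ 2 ≤ 1 := pow_le_one₀ h0.le h
    have h2 := rpow_neg_tangent_le one_pos (by positivity : 0 < ‖x‖ ^ 2)
      (by linarith : 0 ≤ b / 2)
    have e : (‖x‖ ^ 2) ^ (-(b / 2)) = ‖x‖ ^ (-b) := by
      rw [← Real.rpow_natCast, ← Real.rpow_mul h0.le]
      congr 1; push_cast; ring
    unfold decayFn decayProfile decaySlope
    rw [max_eq_right h1]
    rw [e] at h2
    linarith

theorem le_decayFn {N : ℕ} {b : ℝ} (hb : 0 ≤ b) (x : RN N) : (1 + ‖x‖) ^ (-b) ≤ decayFn b x := by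
  rcases le_total 1 ‖x‖ with h | h
  · rw [decayFn_of_one_le b h]
    exact Real.rpow_le_rpow_of_nonpos (by linarith) (by linarith) (by linarith)
  · have h1 : ‖x‖ ^ 2 ≤ 1 := pow_le_one₀ (norm_nonneg x) h
    have h2 : (1 + ‖x‖) ^ (-b) ≤ 1 :=
      Real.rpow_le_one_of_one_le_of_nonpos (by linarith [norm_nonneg x]) (by linarith)
    refine h2.trans ?_
    unfold decayFn decayProfile decaySlope
    rw [max_eq_right h1, Real.one_rpow, Real.one_rpow]
    nlinarith

theorem decayFn_pos {N : ℕ} {b : ℝ} (hb : 0 ≤ b) (x : RN N) : 0 < decayFn b x :=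
  lt_of_lt_of_le (by positivity) (le_decayFn hb x)

theorem norm_rpow_neg_le {N : ℕ} {b : ℝ} (hb : 0 ≤ b) {x : RN N} (hx : 1 ≤ ‖x‖) :
    ‖x‖ ^ (-b) ≤ 2 ^ b * (1 + ‖x‖) ^ (-b) := by
  have h1 : 0 < ‖x‖ := by linarith
  have h2 : (2 * ‖x‖) ^ (-b) ≤ (1 + ‖x‖) ^ (-b) :=
    Real.rpow_le_rpow_of_nonpos (by positivity) (by linarith) (by linarith)
  rw [Real.mul_rpow (by norm_num) h1.le, Real.rpow_neg (by norm_num)] at h2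
  rwa [inv_mul_eq_div, div_le_iff₀ (by positivity), mul_comm] at h2

theorem exists_decayFn_le {N : ℕ} {b : ℝ} (hb : 0 ≤ b) :
    ∃ C, 0 ≤ C ∧ ∀ x : RN N, decayFn b x ≤ C * (1 + ‖x‖) ^ (-b) := by
  refine ⟨(1 + b / 2) * 2 ^ b, by positivity, fun x => ?_⟩
  rcases le_total 1 ‖x‖ with h | h
  · rw [decayFn_of_one_le b h, mul_assoc]
    exact (norm_rpow_neg_le hb h).trans (le_mul_of_one_le_left (by positivity) (by linarith))
  · have h1 : ‖x‖ ^ 2 ≤ 1 := pow_le_one₀ (norm_nonneg x) h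
    have h2 : (2 : ℝ) ^ (-b) ≤ (1 + ‖x‖) ^ (-b) :=
      Real.rpow_le_rpow_of_nonpos (by positivity) (by linarith) (by linarith)
    have h3 : 1 ≤ 2 ^ b * (1 + ‖x‖) ^ (-b) := by
      rw [Real.rpow_neg (by norm_num), inv_le_iff_one_le_mul₀ (by positivity), mul_comm] at h2
      exact h2
    have h4 : decayFn b x ≤ 1 + b / 2 := by
      unfold decayFn decayProfile decaySlope
      rw [max_eq_right h1, Real.one_rpow, Real.one_rpow]
      nlinarith [sq_nonneg ‖x‖]
    rw [mul_assoc]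
    exact h4.trans (le_mul_of_one_le_right (by linarith) h3)

theorem one_add_norm_sq_le_max {N : ℕ} (x : RN N) : (1 + ‖x‖) ^ 2 / 4 ≤ max (‖x‖ ^ 2) 1 := by
  rcases le_total 1 ‖x‖ with h | h
  · exact le_max_of_le_left (by nlinarith)
  · exact le_max_of_le_right (by nlinarith [norm_nonneg x])

theorem sq_div_rpow_neg {m k c : ℝ} (hm : 0 < m) (hk : 0 < k) :
    (m ^ 2 / k) ^ (-c) = k ^ c * m ^ (-(2 * c)) := by
  rw [Real.div_rpow (by positivity) hk.le, Real.rpow_neg hk.le, div_inv_eq_mul, mul_comm,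
    ← Real.rpow_natCast, ← Real.rpow_mul hm.le]
  congr 2; push_cast; ring

theorem abs_decaySlope_le {N : ℕ} {b : ℝ} (hb : 0 ≤ b) (x : RN N) :
    |decaySlope b (‖x‖ ^ 2)| ≤ (b / 2) * 4 ^ (b / 2 + 1) * (1 + ‖x‖) ^ (-b - 2) := by
  have hm : 0 < 1 + ‖x‖ := by positivity
  unfold decaySlope
  rw [abs_neg, abs_of_nonneg (by positivity), mul_assoc]
  refine mul_le_mul_of_nonneg_left ?_ (by linarith)
  refine (Real.rpow_le_rpow_of_nonpos (by positivity) (one_add_norm_sq_le_max x)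
    (by linarith)).trans_eq ?_
  have e : -(b / 2) - 1 = -(b / 2 + 1) := by ring
  rw [e, sq_div_rpow_neg hm (by norm_num)]
  congr 2; ring

/-- First and second order estimates for `decayFn`. -/
theorem exists_decayFn_taylor {N : ℕ} {b : ℝ} (hb : 0 ≤ b) :
    ∃ C, 0 ≤ C ∧ (∀ x : RN N, ‖decayGrad b x‖ ≤ C * (1 + ‖x‖) ^ (-b - 1)) ∧
      ∀ x y : RN N, ‖x - y‖ ≤ (1 + ‖x‖) / 2 →
        |decayFn b x - decayFn b y - decayGrad b x (x - y)| ≤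
          C * (1 + ‖x‖) ^ (-b - 2) * ‖x - y‖ ^ 2 := by
  set S := (b / 2) * 4 ^ (b / 2 + 1) with hS
  set Q := (b / 2) * (b / 2 + 1) * 16 ^ (b / 2 + 2) with hQ
  have hS0 : 0 ≤ S := by positivity
  have hQ0 : 0 ≤ Q := by positivity
  refine ⟨2 * S + 9 * Q, by positivity, fun x => ?_, fun x y hxy => ?_⟩
  · have hm : 0 < 1 + ‖x‖ := by positivity
    have h1 := abs_decaySlope_le hb x
    rw [← hS] at h1
    have h2 : (1 + ‖x‖) ^ (-b - 2) * ‖x‖ ≤ (1 + ‖x‖) ^ (-b - 1) := by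
      have e : (1 + ‖x‖) ^ (-b - 1) = (1 + ‖x‖) ^ (-b - 2) * (1 + ‖x‖) := by
        rw [← Real.rpow_add_one hm.ne']; congr 1; ring
      rw [e]
      exact mul_le_mul_of_nonneg_left (by linarith) (by positivity)
    unfold decayGrad
    rw [norm_smul, innerSL_apply_norm, Real.norm_eq_abs, abs_mul, abs_two]
    calc 2 * |decaySlope b (‖x‖ ^ 2)| * ‖x‖ ≤ 2 * (S * (1 + ‖x‖) ^ (-b - 2)) * ‖x‖ := by gcongr
      _ = 2 * S * ((1 + ‖x‖) ^ (-b - 2) * ‖x‖) := by ring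
      _ ≤ 2 * S * (1 + ‖x‖) ^ (-b - 1) := by gcongr
      _ ≤ _ := by gcongr; linarith
  · have hm : 0 < 1 + ‖x‖ := by positivity
    have hy : ‖x‖ - ‖y‖ ≤ ‖x - y‖ := norm_sub_norm_le x y
    -- The restriction on `|x - y|` gives `1 + |y| ≥ (1 + |x|) / 2`, so both arguments of the
    -- profile stay above a common multiple of `(1 + |x|)²`.
    have hd1 : (1 + ‖x‖) ^ 2 / 16 ≤ max (‖x‖ ^ 2) 1 :=
      le_trans (by nlinarith) (one_add_norm_sq_le_max x)
    have hd2 : (1 + ‖x‖) ^ 2 / 16 ≤ max (‖y‖ ^ 2) 1 := by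
      refine le_trans ?_ (one_add_norm_sq_le_max y)
      have : (1 + ‖x‖) / 2 ≤ 1 + ‖y‖ := by linarith
      nlinarith
    have h1 := abs_decayProfile_sub_le hb (by positivity) hd1 hd2
    have e : -(b / 2) - 2 = -(b / 2 + 2) := by ring
    rw [e, sq_div_rpow_neg hm (by norm_num)] at h1
    have e2 : -(2 * (b / 2 + 2)) = -b - 4 := by ring
    rw [e2, ← mul_assoc, ← hQ] at h1
    have hns : ‖y‖ ^ 2 - ‖x‖ ^ 2 = -(2 * inner ℝ x (x - y)) + ‖x - y‖ ^ 2 := by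
      rw [inner_sub_right, real_inner_self_eq_norm_sq, norm_sub_sq_real]; ring
    have hsq : (‖y‖ ^ 2 - ‖x‖ ^ 2) ^ 2 ≤ 9 * (1 + ‖x‖) ^ 2 * ‖x - y‖ ^ 2 := by
      have h3 : |‖y‖ - ‖x‖| ≤ ‖x - y‖ := by
        rw [← norm_neg (x - y), neg_sub]; exact abs_norm_sub_norm_le y x
      have h4 : ‖y‖ ≤ ‖x‖ + ‖x - y‖ := by have := abs_le.1 h3; linarith
      have h5 : ‖y‖ + ‖x‖ ≤ 3 * (1 + ‖x‖) := by linarith [norm_nonneg x]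
      have h6 : (‖y‖ - ‖x‖) ^ 2 ≤ ‖x - y‖ ^ 2 := sq_le_sq' (by linarith [abs_le.1 h3]) (abs_le.1 h3).2
      have h7 : (‖y‖ + ‖x‖) ^ 2 ≤ (3 * (1 + ‖x‖)) ^ 2 := by gcongr
      calc (‖y‖ ^ 2 - ‖x‖ ^ 2) ^ 2 = (‖y‖ + ‖x‖) ^ 2 * (‖y‖ - ‖x‖) ^ 2 := by ring
        _ ≤ (3 * (1 + ‖x‖)) ^ 2 * ‖x - y‖ ^ 2 := by gcongr
        _ = _ := by ring
    -- The gradient accounts only for the linear part of `|y|² - |x|²`; besides the remainder of the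
    -- profile this leaves the slope times `|x - y|²`.
    have hg : decayFn b x - decayFn b y - decayGrad b x (x - y) =
        -(decayProfile b (‖y‖ ^ 2) - decayProfile b (‖x‖ ^ 2) -
          decaySlope b (‖x‖ ^ 2) * (‖y‖ ^ 2 - ‖x‖ ^ 2)) -
          decaySlope b (‖x‖ ^ 2) * ‖x - y‖ ^ 2 := by
      unfold decayFn decayGrad
      rw [hns]
      simp only [smul_apply, innerSL_apply_apply, smul_eq_mul]
      ring
    have e3 : (1 + ‖x‖) ^ (-b - 4) * (1 + ‖x‖) ^ 2 = (1 + ‖x‖) ^ (-b - 2) := by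
      rw [← Real.rpow_natCast, ← Real.rpow_add hm]; congr 1; push_cast; ring
    rw [hg]
    refine (abs_sub _ _).trans ?_
    rw [abs_neg, abs_mul, abs_of_nonneg (sq_nonneg ‖x - y‖)]
    have h8 := abs_decaySlope_le hb x
    rw [← hS] at h8
    have hw : 0 ≤ (1 + ‖x‖) ^ (-b - 2) := by positivity
    calc _ ≤ Q * (1 + ‖x‖) ^ (-b - 4) * (9 * (1 + ‖x‖) ^ 2 * ‖x - y‖ ^ 2) +
          S * (1 + ‖x‖) ^ (-b - 2) * ‖x - y‖ ^ 2 := by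
          refine add_le_add (h1.trans ?_) (by gcongr)
          gcongr
      _ = (9 * Q + S) * (1 + ‖x‖) ^ (-b - 2) * ‖x - y‖ ^ 2 := by rw [← e3]; ring
      _ ≤ _ := mul_le_mul_of_nonneg_right (mul_le_mul_of_nonneg_right (by linarith) hw)
          (sq_nonneg _)

/-! ### Cutoffs -/

/-- The family of cutoff functions `χ(x / R)`. -/
noncomputable def cutoff {N : ℕ} (R : ℝ) (x : RN N) : ℝ :=
  (⟨1, 2, one_pos, one_lt_two⟩ : ContDiffBump (0 : RN N)) (R⁻¹ • x)

theorem cutoff_nonneg {N : ℕ} (R : ℝ) (x : RN N) : 0 ≤ cutoff R x := ContDiffBump.nonneg _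

theorem cutoff_le_one {N : ℕ} (R : ℝ) (x : RN N) : cutoff R x ≤ 1 := ContDiffBump.le_one _

theorem continuous_cutoff {N : ℕ} (R : ℝ) : Continuous (cutoff R : RN N → ℝ) :=
  (ContDiffBump.continuous _).comp (continuous_const_smul _)

theorem cutoff_eq_one {N : ℕ} {R : ℝ} (hR : 0 < R) {x : RN N} (hx : ‖x‖ ≤ R) :
    cutoff R x = 1 := by
  refine ContDiffBump.one_of_mem_closedBall _ ?_
  rw [mem_closedBall_zero_iff, norm_smul, norm_inv, Real.norm_of_nonneg hR.le, inv_mul_eq_div]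
  exact (div_le_one hR).2 hx

theorem cutoff_eq_zero {N : ℕ} {R : ℝ} (hR : 0 < R) {x : RN N} (hx : 2 * R ≤ ‖x‖) :
    cutoff R x = 0 := by
  refine ContDiffBump.zero_of_le_dist _ ?_
  rw [dist_zero_right, norm_smul, norm_inv, Real.norm_of_nonneg hR.le, inv_mul_eq_div]
  exact (le_div_iff₀ hR).2 hx

/-- The constant is uniform in `R` because the scaling factor `R⁻¹ ≤ 1` can only shrink the first
and second order bounds of the fixed bump. Here `B R` is the differential of the scaled bump. -/
theorem exists_cutoff_taylor (N : ℕ) :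
    ∃ C, 0 ≤ C ∧ ∃ B : ℝ → RN N → (RN N →L[ℝ] ℝ), ∀ R, 1 ≤ R →
      (∀ x, ‖B R x‖ ≤ C) ∧
      ∀ x y, |cutoff R x - cutoff R y - B R x (x - y)| ≤ C * ‖x - y‖ ^ 2 := by
  let χ : ContDiffBump (0 : RN N) := ⟨1, 2, one_pos, one_lt_two⟩
  have hχ : ContDiff ℝ 2 χ := χ.contDiff
  obtain ⟨C1, hC1⟩ := ContDiff.lipschitzWith_of_hasCompactSupport χ.hasCompactSupport
    (hχ.of_le (by norm_num)) one_ne_zero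
  obtain ⟨C2, hC2⟩ := ContDiff.lipschitzWith_of_hasCompactSupport
    (f := fderiv ℝ χ) (χ.hasCompactSupport.fderiv ℝ)
    (hχ.fderiv_right (m := 1) (by norm_num)) one_ne_zero
  have key : ∀ x y : RN N, |χ x - χ y - fderiv ℝ χ x (x - y)| ≤ C2 * ‖x - y‖ ^ 2 := by
    intro x y
    have hseg := (convex_segment y x).norm_image_sub_le_of_norm_hasFDerivWithin_le'
      (f := χ) (f' := fderiv ℝ χ) (φ := fderiv ℝ χ x) (C := C2 * ‖x - y‖)
      (fun z _ => ((hχ.differentiable (by norm_num)) z).hasFDerivAt.hasFDerivWithinAt)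
      (fun z hz => by
        have := hC2.dist_le_mul z x
        rw [dist_eq_norm, dist_eq_norm] at this
        refine this.trans (mul_le_mul_of_nonneg_left ?_ C2.2)
        rw [segment_symm] at hz
        have := norm_sub_le_of_mem_segment hz
        simpa [norm_sub_rev] using this)
      (left_mem_segment ℝ y x) (right_mem_segment ℝ y x)
    rw [Real.norm_eq_abs] at hseg
    refine hseg.trans_eq (by ring)
  refine ⟨C1 + C2, by positivity, fun R x => R⁻¹ • fderiv ℝ χ (R⁻¹ • x), fun R hR => ⟨?_, ?_⟩⟩
  · intro x
    have hR1 : ‖R⁻¹‖ ≤ 1 := by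
      rw [norm_inv, Real.norm_of_nonneg (by linarith)]; exact inv_le_one_of_one_le₀ hR
    rw [norm_smul]
    have := norm_fderiv_le_of_lipschitz ℝ hC1 (x₀ := R⁻¹ • x)
    calc ‖R⁻¹‖ * ‖fderiv ℝ χ (R⁻¹ • x)‖ ≤ 1 * C1 := by gcongr
      _ ≤ _ := by rw [one_mul]; exact le_add_of_nonneg_right C2.2
  · intro x y
    have hR1 : ‖R⁻¹‖ ≤ 1 := by
      rw [norm_inv, Real.norm_of_nonneg (by linarith)]; exact inv_le_one_of_one_le₀ hR
    have h := key (R⁻¹ • x) (R⁻¹ • y)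
    rw [← smul_sub, map_smul, norm_smul] at h
    refine h.trans ?_
    have h3 : ‖R⁻¹‖ * ‖x - y‖ ≤ ‖x - y‖ := mul_le_of_le_one_left (norm_nonneg _) hR1
    calc (C2 : ℝ) * (‖R⁻¹‖ * ‖x - y‖) ^ 2 ≤ C2 * ‖x - y‖ ^ 2 := by gcongr
      _ ≤ _ := by
        have := C1.2
        exact mul_le_mul_of_nonneg_right (le_add_of_nonneg_left this) (by positivity)

/-- The compactly supported test functions. -/
noncomputable def testFn {N : ℕ} (b R : ℝ) (x : RN N) : ℝ := decayFn b x * cutoff R x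

theorem continuous_testFn {N : ℕ} (b R : ℝ) : Continuous (testFn b R : RN N → ℝ) :=
  (continuous_decayFn b).mul (continuous_cutoff R)

theorem testFn_nonneg {N : ℕ} {b : ℝ} (hb : 0 ≤ b) (R : ℝ) (x : RN N) : 0 ≤ testFn b R x :=
  mul_nonneg (decayFn_pos hb x).le (cutoff_nonneg R x)

theorem testFn_le {N : ℕ} {b : ℝ} (hb : 0 ≤ b) (R : ℝ) (x : RN N) :
    testFn b R x ≤ decayFn b x :=
  mul_le_of_le_one_right (decayFn_pos hb x).le (cutoff_le_one R x)

theorem testFn_eq {N : ℕ} (b : ℝ) {R : ℝ} (hR : 0 < R) {x : RN N} (hx : ‖x‖ ≤ R) :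
    testFn b R x = decayFn b x := by
  unfold testFn; rw [cutoff_eq_one hR hx, mul_one]

theorem testFn_eq_zero {N : ℕ} (b : ℝ) {R : ℝ} (hR : 0 < R) {x : RN N} (hx : 2 * R ≤ ‖x‖) :
    testFn b R x = 0 := by
  unfold testFn; rw [cutoff_eq_zero hR hx, mul_zero]

/-- Uniform bound for the truncated operator on the test functions and on `decayFn`. -/
theorem exists_abs_truncFracLap_testFn_le {N : ℕ} (hN : 1 ≤ N) {s b : ℝ} (hs0 : 0 < s)
    (hs1 : s < 1) (hb : 0 ≤ b) (hb' : b ≤ (N : ℝ) + 2 * s) :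
    ∃ C, 0 ≤ C ∧ ∀ ε, 0 < ε → ε ≤ 1 / 2 → ∀ x : RN N,
      |truncFracLap s ε (decayFn b) x| ≤ C * (1 + ‖x‖) ^ (-b) ∧
      ∀ R, 1 ≤ R → |truncFracLap s ε (testFn b R) x| ≤ C * (1 + ‖x‖) ^ (-b) := by
  obtain ⟨C1, hC1, h1⟩ := exists_decayFn_le (N := N) hb
  obtain ⟨C2, hC2, h2g, h2⟩ := exists_decayFn_taylor (N := N) hb
  obtain ⟨C3, hC3, B, hB⟩ := exists_cutoff_taylor N
  -- `C1` and `C2` serve `v` itself; the last two terms come from the product rule remainder for `v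
  -- χ(·/R)`.
  set M := C1 + C2 + C1 * C3 + 2 * C2 * (2 * C3) with hM
  have hM1 : C1 ≤ M := by
    have : 0 ≤ C1 * C3 + 2 * C2 * (2 * C3) := by positivity
    linarith
  have hM2 : C2 ≤ M := by
    have : 0 ≤ C1 * C3 + 2 * C2 * (2 * C3) := by positivity
    linarith
  obtain ⟨C, hC, h⟩ := exists_abs_truncFracLap_le hN hs0 hs1 hb hb' M
  have hmono : ∀ (x : RN N) (k : ℝ), 0 ≤ k → (1 + ‖x‖) ^ (-b - k) ≤ (1 + ‖x‖) ^ (-b) :=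
    fun x k hk => Real.rpow_le_rpow_of_exponent_le (by linarith [norm_nonneg x]) (by linarith)
  have hT : ∀ x y : RN N, ‖x - y‖ ≤ 1 / 2 →
      |decayFn b x - decayFn b y - decayGrad b x (x - y)| ≤
        C2 * (1 + ‖x‖) ^ (-b) * ‖x - y‖ ^ 2 := fun x y hxy =>
    (h2 x y (by linarith [norm_nonneg x])).trans (mul_le_mul_of_nonneg_right
      (mul_le_mul_of_nonneg_left (hmono x 2 (by norm_num)) hC2) (sq_nonneg _))
  refine ⟨C, hC, fun ε hε hε2 x => ⟨?_, fun R hR => ?_⟩⟩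
  · refine h (decayFn b) (decayGrad b) (continuous_decayFn b).measurable (fun y => ?_)
      (fun x y hxy => ?_) ε hε hε2 x
    · rw [abs_of_pos (decayFn_pos hb y)]
      exact (h1 y).trans (by gcongr)
    · exact (hT x y hxy).trans (by gcongr)
  · obtain ⟨hB1, hB2⟩ := hB R hR
    refine h (testFn b R) (fun x => decayFn b x • B R x + cutoff R x • decayGrad b x)
      (continuous_testFn b R).measurable (fun y => ?_) (fun x y hxy => ?_) ε hε hε2 x
    · rw [abs_of_nonneg (testFn_nonneg hb R y)]
      exact ((testFn_le hb R y).trans (h1 y)).trans (by gcongr)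
    · set z := x - y with hz
      set W := (1 + ‖x‖) ^ (-b) with hW
      have hW0 : 0 ≤ W := by positivity
      -- Second order product rule: each factor times the remainder of the other, minus the product
      -- of the increments, which is also of second order.
      have e : testFn b R x - testFn b R y -
          (decayFn b x • B R x + cutoff R x • decayGrad b x) z =
          decayFn b x * (cutoff R x - cutoff R y - B R x z) +
          cutoff R x * (decayFn b x - decayFn b y - decayGrad b x z) -
          (decayFn b x - decayFn b y) * (cutoff R x - cutoff R y) := by
        unfold testFn
        simp only [add_apply, smul_apply, smul_eq_mul]
        ring
      have hz1 : ‖z‖ ^ 2 ≤ ‖z‖ := by nlinarith [norm_nonneg z]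
      have a1 : |decayFn b x - decayFn b y| ≤ 2 * C2 * W * ‖z‖ := by
        have t1 := hT x y hxy
        have t2 : |decayGrad b x z| ≤ C2 * W * ‖z‖ := by
          refine ((decayGrad b x).le_opNorm z).trans ?_
          refine mul_le_mul_of_nonneg_right ((h2g x).trans ?_) (norm_nonneg z)
          exact mul_le_mul_of_nonneg_left (hmono x 1 (by norm_num)) hC2
        have t3 := abs_add_le (decayFn b x - decayFn b y - decayGrad b x z) (decayGrad b x z)
        rw [sub_add_cancel] at t3
        have t4 : C2 * W * ‖z‖ ^ 2 ≤ C2 * W * ‖z‖ := by gcongr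
        linarith
      have a2 : |cutoff R x - cutoff R y| ≤ 2 * C3 * ‖z‖ := by
        have t1 := hB2 x y
        have t2 : |B R x z| ≤ C3 * ‖z‖ :=
          ((B R x).le_opNorm z).trans (mul_le_mul_of_nonneg_right (hB1 x) (norm_nonneg z))
        have t3 := abs_add_le (cutoff R x - cutoff R y - B R x z) (B R x z)
        rw [sub_add_cancel] at t3
        have t4 : C3 * ‖z‖ ^ 2 ≤ C3 * ‖z‖ := by gcongr
        linarith
      rw [e]
      refine (abs_sub _ _).trans ((add_le_add_left (abs_add_le _ _) _).trans ?_)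
      rw [abs_mul, abs_mul, abs_mul, abs_of_pos (decayFn_pos hb x),
        abs_of_nonneg (cutoff_nonneg R x)]
      have b1 : decayFn b x * |cutoff R x - cutoff R y - B R x z| ≤
          (C1 * W) * (C3 * ‖z‖ ^ 2) :=
        mul_le_mul (h1 x) (hB2 x y) (abs_nonneg _) (by positivity)
      have b2 : cutoff R x * |decayFn b x - decayFn b y - decayGrad b x z| ≤
          1 * (C2 * W * ‖z‖ ^ 2) :=
        mul_le_mul (cutoff_le_one R x) (hT x y hxy) (abs_nonneg _) zero_le_one
      have b3 : |decayFn b x - decayFn b y| * |cutoff R x - cutoff R y| ≤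
          (2 * C2 * W * ‖z‖) * (2 * C3 * ‖z‖) :=
        mul_le_mul a1 a2 (abs_nonneg _) (by positivity)
      have b4 : 0 ≤ C1 * (W * ‖z‖ ^ 2) := by positivity
      rw [hM]
      linarith

/-! ### Supersolutions -/

/-- The function `decayFn b` satisfies `-(-Δ)^s v ≤ C ρ v`, in a truncated form that is uniform up
to an error `D ε^{2-2s}`. -/
def AdmissibleDecay {N : ℕ} (s b : ℝ) (ρ : RN N → ℝ) : Prop :=
  ∃ C, 0 ≤ C ∧ ∃ D, 0 ≤ D ∧ ∀ ε, 0 < ε → ε ≤ 1 / 4 → ∀ x,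
    -truncFracLap s ε (decayFn b) x ≤ C * (ρ x * decayFn b x) + D * ε ^ (2 - 2 * s)

/-- It suffices to check admissibility outside of the unit ball. -/
theorem AdmissibleDecay.of_outer {N : ℕ} (hN : 1 ≤ N) {s b : ℝ} (hs0 : 0 < s) (hs1 : s < 1)
    (hb : 0 ≤ b) (hb' : b ≤ (N : ℝ) + 2 * s) {ρ : RN N → ℝ} (hρ : Continuous ρ)
    (hρpos : ∀ x, 0 < ρ x) {C D : ℝ} (hC : 0 ≤ C) (hD : 0 ≤ D)
    (h : ∀ ε, 0 < ε → ε ≤ 1 / 4 → ∀ x : RN N, 1 ≤ ‖x‖ →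
      -truncFracLap s ε (decayFn b) x ≤ C * (ρ x * decayFn b x) + D * ε ^ (2 - 2 * s)) :
    AdmissibleDecay s b ρ := by
  obtain ⟨C1, hC1, h1⟩ := exists_abs_truncFracLap_testFn_le hN hs0 hs1 hb hb'
  have hcont : Continuous fun x : RN N => ρ x * decayFn b x := hρ.mul (continuous_decayFn b)
  -- On the unit ball `ρ v` has a positive minimum, so a multiple of it absorbs the bounded
  -- truncated operator.
  obtain ⟨x0, -, hx0⟩ := (isCompact_closedBall (0 : RN N) 1).exists_isMinOn
    ⟨0, Metric.mem_closedBall_self zero_le_one⟩ hcont.continuousOn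
  have hk : 0 < ρ x0 * decayFn b x0 := mul_pos (hρpos x0) (decayFn_pos hb x0)
  set k := ρ x0 * decayFn b x0 with hkdef
  refine ⟨C + C1 / k, by positivity, D, hD, fun ε hε hε4 x => ?_⟩
  have hρv : 0 ≤ ρ x * decayFn b x := (mul_pos (hρpos x) (decayFn_pos hb x)).le
  have hDε : 0 ≤ D * ε ^ (2 - 2 * s) := by positivity
  rcases le_total 1 ‖x‖ with hx | hx
  · refine (h ε hε hε4 x hx).trans ?_
    have : 0 ≤ C1 / k * (ρ x * decayFn b x) := by positivity
    linarith
  · have h2 := (h1 ε hε (by linarith) x).1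
    have h3 : (1 + ‖x‖) ^ (-b) ≤ 1 :=
      Real.rpow_le_one_of_one_le_of_nonpos (by linarith [norm_nonneg x]) (by linarith)
    have h4 : k ≤ ρ x * decayFn b x := hx0 (mem_closedBall_zero_iff.2 hx)
    have h5 : C1 ≤ C1 / k * (ρ x * decayFn b x) := by
      rw [div_mul_eq_mul_div, le_div_iff₀ hk]
      exact mul_le_mul_of_nonneg_left h4 hC1
    have h6 : 0 ≤ C * (ρ x * decayFn b x) := by positivity
    have h7 := neg_abs_le (truncFracLap s ε (decayFn b) x)
    have h8 := mul_le_mul_of_nonneg_left h3 hC1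
    linarith

/-- The refined decay of the truncated operator applied to `decayFn b`. -/
theorem exists_abs_truncFracLap_decayFn_le {N : ℕ} (hN : 1 ≤ N) {s b : ℝ} (hs0 : 0 < s)
    (hs1 : s < 1) (hb : 0 ≤ b) :
    ∃ C, 0 ≤ C ∧ ∀ ε, 0 < ε → ε ≤ 1 / 2 → ∀ x : RN N, 1 ≤ ‖x‖ →
      |truncFracLap s ε (decayFn b) x| ≤ C * (‖x‖ ^ (-b - 2 * s) +
        ‖x‖ ^ (-((N : ℝ) + 2 * s)) * ∫ y in {y : RN N | ‖y‖ ≤ ‖x‖}, (1 + ‖y‖) ^ (-b)) := by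
  obtain ⟨C1, hC1, h1⟩ := exists_decayFn_le (N := N) hb
  obtain ⟨C2, hC2, -, h2⟩ := exists_decayFn_taylor (N := N) hb
  have hγ : 0 < 2 - 2 * s := by linarith
  have hS := sphereArea_nonneg N
  have ha : 0 ≤ (N : ℝ) + 2 * s := by positivity
  set η := C2 * (sphereArea N * (1 / (2 - 2 * s))) with hη
  have hη0 : 0 ≤ η := by positivity
  set κ := sphereArea N / (2 * s) with hκ
  have hκ0 : 0 ≤ κ := by positivity
  set P := (2 : ℝ) ^ ((N : ℝ) + 2 * s) with hP
  set Q := (3 : ℝ) ^ ((N : ℝ) + 2 * s) with hQ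
  have hP0 : 0 ≤ P := by positivity
  have hQ0 : 0 ≤ Q := by positivity
  refine ⟨η + 2 ^ (2 * s) * κ + C1 * P + Q * κ, by positivity, ?_⟩
  intro ε hε hε2 x hx
  have hx0 : 0 < ‖x‖ := by linarith
  set r := ‖x‖ with hr
  have hr2 : 0 < r / 2 := by linarith
  have hv0 : ∀ y : RN N, 0 ≤ decayFn b y := fun y => (decayFn_pos hb y).le
  have hvC : ∀ y : RN N, |decayFn b y| ≤ C1 := fun y => by
    rw [abs_of_nonneg (hv0 y)]
    exact (h1 y).trans (mul_le_of_le_one_right hC1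
      (Real.rpow_le_one_of_one_le_of_nonpos (by linarith [norm_nonneg y]) (by linarith)))
  have hfi := integrable_weight_of_bounded hs0 (continuous_decayFn (N := N) b).measurable hvC
  have hi := integrableOn_sub_mul_fracKernel hN hs0 hε (continuous_decayFn b).measurable hfi x
  have hJI : IntegrableOn (fun y : RN N => (1 + ‖y‖) ^ (-b)) {y | ‖y‖ ≤ r} := by
    have : {y : RN N | ‖y‖ ≤ r} = Metric.closedBall 0 r := by ext; simp
    rw [this]
    refine (Continuous.continuousOn ?_).integrableOn_compact (isCompact_closedBall 0 r)
    exact Continuous.rpow_const (by fun_prop) fun y => Or.inl (by positivity)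
  set J := ∫ y in {y : RN N | ‖y‖ ≤ r}, (1 + ‖y‖) ^ (-b) with hJ
  have hJ0 : 0 ≤ J := integral_nonneg fun y => by positivity
  clear_value J
  rw [truncFracLap_eq_add (by linarith : ε ≤ r / 2) hi]
  refine (abs_add_le _ _).trans ?_
  -- The second order estimate holds up to distance `(1 + |x|) / 2`. Splitting at `r / 2` rather
  -- than at a fixed radius gains the factor `r^{-2} r^{2-2s} = r^{-2s}`.
  have hnear : |∫ y in {y | ε < ‖x - y‖ ∧ ‖x - y‖ ≤ r / 2},
      (decayFn b x - decayFn b y) * fracKernel s (x - y)| ≤ η * r ^ (-b - 2 * s) := by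
    refine (abs_setIntegral_annulus_le hN (C := C2 * r ^ (-b - 2)) hs0 hε hγ
      hr2.le (decayGrad b x) x hi (fun y hy => ?_)).trans ?_
    · refine (h2 x y (by linarith)).trans ?_
      have e : 2 * s + (2 - 2 * s) = ((2 : ℕ) : ℝ) := by push_cast; ring
      rw [e, Real.rpow_natCast]
      have : (1 + ‖x‖) ^ (-b - 2) ≤ r ^ (-b - 2) :=
        Real.rpow_le_rpow_of_nonpos hx0 (by linarith) (by linarith)
      gcongr
    · have e1 : r ^ (-b - 2) * r ^ (2 - 2 * s) = r ^ (-b - 2 * s) := by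
        rw [← Real.rpow_add hx0]; congr 1; ring
      have e2 : (r / 2) ^ (2 - 2 * s) ≤ r ^ (2 - 2 * s) :=
        Real.rpow_le_rpow hr2.le (by linarith) hγ.le
      calc C2 * r ^ (-b - 2) * (sphereArea N * ((r / 2) ^ (2 - 2 * s) / (2 - 2 * s)))
          ≤ C2 * r ^ (-b - 2) * (sphereArea N * (r ^ (2 - 2 * s) / (2 - 2 * s))) := by gcongr
        _ = η * (r ^ (-b - 2) * r ^ (2 - 2 * s)) := by rw [hη]; ring
        _ = _ := by rw [e1]
  have hIK := integrableOn_fracKernel hN hs0 x hr2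
  have hIG : IntegrableOn (fun z : RN N => ‖z‖ ^ (-((N : ℝ) + 2 * s))) {z | r < ‖z‖} :=
    integrableOn_norm_rpow_gt hN (by linarith) hx0
  have hVG : ∫ z in {z : RN N | r < ‖z‖}, ‖z‖ ^ (-((N : ℝ) + 2 * s)) = κ * r ^ (-(2 * s)) := by
    rw [setIntegral_norm_rpow_gt hN (by linarith) hx0, hκ]; ring
  have hm1 : MeasurableSet {y : RN N | ‖y‖ ≤ r} := measurableSet_le (by fun_prop) (by fun_prop)
  have hm2 : MeasurableSet {y : RN N | r < ‖y‖} := measurableSet_lt (by fun_prop) (by fun_prop)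
  have hI1 := (integrable_indicator_iff hm1).2 hJI
  have hI2 := (integrable_indicator_iff hm2).2 hIG
  have hrr : r ^ (-b) * r ^ (-(2 * s)) = r ^ (-b - 2 * s) := by
    rw [← Real.rpow_add hx0]; congr 1
  -- Three contributions: the value at `x`; the points `|y| ≤ r`, where the kernel is at most `P
  -- r^{-(N+2s)}`; and the points `|y| > r`, where `v(y) ≤ r^{-b}` and `|y| ≤ 3 |x - y|`.
  have hfar : |∫ y in {y | r / 2 < ‖x - y‖},
      (decayFn b x - decayFn b y) * fracKernel s (x - y)| ≤
      2 ^ (2 * s) * κ * r ^ (-b - 2 * s) + C1 * P * (r ^ (-((N : ℝ) + 2 * s)) * J) +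
        Q * κ * r ^ (-b - 2 * s) := by
    rw [← Real.norm_eq_abs]
    refine (norm_integral_le_of_norm_le
      (g := fun y => r ^ (-b) * fracKernel s (x - y) +
        (C1 * P * r ^ (-((N : ℝ) + 2 * s)) *
          {y : RN N | ‖y‖ ≤ r}.indicator (fun y => (1 + ‖y‖) ^ (-b)) y +
        Q * r ^ (-b) *
          {y : RN N | r < ‖y‖}.indicator (fun y => ‖y‖ ^ (-((N : ℝ) + 2 * s))) y)) ?_ ?_).trans ?_
    · exact (hIK.const_mul _).add
        ((hI1.const_mul _).integrableOn.add (hI2.const_mul _).integrableOn)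
    · filter_upwards [ae_restrict_mem (measurableSet_lt_norm_sub x (r / 2))] with y hy
      have hy' : r / 2 < ‖x - y‖ := hy
      have hz : 0 < ‖x - y‖ := hr2.trans hy'
      have hK := fracKernel_nonneg s (x - y)
      rw [norm_mul, Real.norm_of_nonneg hK, Real.norm_eq_abs]
      have h3 : |decayFn b x - decayFn b y| ≤ r ^ (-b) + decayFn b y := by
        rw [← decayFn_of_one_le b hx]
        refine (abs_sub _ _).trans ?_
        rw [abs_of_nonneg (hv0 x), abs_of_nonneg (hv0 y)]
      have h4 := mul_le_mul_of_nonneg_right h3 hK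
      rw [add_mul] at h4
      refine h4.trans (add_le_add_right ?_ _)
      rcases le_or_gt ‖y‖ r with h5 | h5
      · rw [indicator_of_mem (show y ∈ {y : RN N | ‖y‖ ≤ r} from h5),
          indicator_of_notMem (show y ∉ {y : RN N | r < ‖y‖} from not_lt.2 h5), mul_zero, add_zero]
        have h6 : fracKernel s (x - y) ≤ P * r ^ (-((N : ℝ) + 2 * s)) := by
          have : (r / 2) ^ (-((N : ℝ) + 2 * s)) = P * r ^ (-((N : ℝ) + 2 * s)) := by
            rw [Real.div_rpow hx0.le (by norm_num), Real.rpow_neg (by norm_num : (0 : ℝ) ≤ 2), hP]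
            field_simp
          rw [← this]
          exact Real.rpow_le_rpow_of_nonpos hr2 hy'.le (by linarith)
        calc decayFn b y * fracKernel s (x - y)
            ≤ (C1 * (1 + ‖y‖) ^ (-b)) * (P * r ^ (-((N : ℝ) + 2 * s))) :=
              mul_le_mul (h1 y) h6 hK (by positivity)
          _ = _ := by ring
      · rw [indicator_of_notMem (show y ∉ {y : RN N | ‖y‖ ≤ r} from not_le.2 h5),
          indicator_of_mem (show y ∈ {y : RN N | r < ‖y‖} from h5), mul_zero, zero_add]
        have hy0 : 0 < ‖y‖ := hx0.trans h5
        have h7 : ‖y‖ / 3 ≤ ‖x - y‖ := by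
          have : ‖y‖ ≤ ‖x‖ + ‖x - y‖ := by
            have := norm_sub_le x (x - y); simpa using this
          linarith
        have h6 : fracKernel s (x - y) ≤ Q * ‖y‖ ^ (-((N : ℝ) + 2 * s)) := by
          have : (‖y‖ / 3) ^ (-((N : ℝ) + 2 * s)) = Q * ‖y‖ ^ (-((N : ℝ) + 2 * s)) := by
            rw [Real.div_rpow hy0.le (by norm_num), Real.rpow_neg (by norm_num : (0 : ℝ) ≤ 3), hQ]
            field_simp
          rw [← this]
          exact Real.rpow_le_rpow_of_nonpos (by positivity) h7 (by linarith)
        have h8 : decayFn b y ≤ r ^ (-b) := by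
          rw [decayFn_of_one_le b (by linarith)]
          exact Real.rpow_le_rpow_of_nonpos hx0 h5.le (by linarith)
        calc decayFn b y * fracKernel s (x - y)
            ≤ r ^ (-b) * (Q * ‖y‖ ^ (-((N : ℝ) + 2 * s))) :=
              mul_le_mul h8 h6 hK (by positivity)
          _ = _ := by ring
    · have hsum : Integrable (fun y : RN N => C1 * P * r ^ (-((N : ℝ) + 2 * s)) *
          {y : RN N | ‖y‖ ≤ r}.indicator (fun y => (1 + ‖y‖) ^ (-b)) y +
        Q * r ^ (-b) *
          {y : RN N | r < ‖y‖}.indicator (fun y => ‖y‖ ^ (-((N : ℝ) + 2 * s))) y) :=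
        (hI1.const_mul _).add (hI2.const_mul _)
      rw [integral_add (hIK.const_mul _) hsum.integrableOn, integral_const_mul,
        setIntegral_fracKernel hN hs0 x hr2]
      have hle := setIntegral_le_integral (s := {y : RN N | r / 2 < ‖x - y‖}) hsum
        (Eventually.of_forall fun y => by
          refine add_nonneg (mul_nonneg (by positivity) ?_) (mul_nonneg (by positivity) ?_)
          · exact indicator_nonneg (fun y _ => by positivity) y
          · exact indicator_nonneg (fun y _ => by positivity) y)
      rw [integral_add (hI1.const_mul _) (hI2.const_mul _), integral_const_mul,
        integral_const_mul, integral_indicator hm1, integral_indicator hm2, hVG, ← hJ] at hle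
      have e3 : (r / 2) ^ (-(2 * s)) = 2 ^ (2 * s) * r ^ (-(2 * s)) := by
        rw [Real.div_rpow hx0.le (by norm_num), Real.rpow_neg (by norm_num : (0 : ℝ) ≤ 2)]
        field_simp
      have e4 : r ^ (-b) * (sphereArea N * ((r / 2) ^ (-(2 * s)) / (2 * s))) =
          2 ^ (2 * s) * κ * r ^ (-b - 2 * s) := by
        rw [e3, ← hrr, hκ]; ring
      have e5 : Q * r ^ (-b) * (κ * r ^ (-(2 * s))) = Q * κ * r ^ (-b - 2 * s) := by
        rw [← hrr]; ring
      rw [e4]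
      rw [e5] at hle
      linarith
  have hA : 0 ≤ r ^ (-b - 2 * s) := by positivity
  have hB : 0 ≤ r ^ (-((N : ℝ) + 2 * s)) * J := by positivity
  have hw : 0 ≤ 2 ^ (2 * s) * κ := by positivity
  nlinarith [mul_nonneg hη0 hB, mul_nonneg hw hB, mul_nonneg (mul_nonneg hC1 hP0) hA,
    mul_nonneg (mul_nonneg hQ0 hκ0) hB]

theorem PowerLowerBound.exists_le {N : ℕ} {ρ : RN N → ℝ} {α α' : ℝ} (h : PowerLowerBound ρ α)
    (hα : α ≤ α') (hα' : 0 ≤ α') :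
    ∃ k, 0 < k ∧ ∀ x : RN N, 1 ≤ ‖x‖ → k * ‖x‖ ^ (-α') ≤ ρ x := by
  obtain ⟨K, hK, h⟩ := h
  -- The factor comes from `1 + |x|² ≤ 2 |x|²`, which may be raised to the power `-α'/2` because `α'
  -- ≥ 0`; hence the passage from `α` to a larger exponent.
  refine ⟨K * 2 ^ (-(α' / 2)), by positivity, fun x hx => le_trans ?_ (h x)⟩
  have hx0 : 0 < ‖x‖ := by linarith
  have h1 : (1 + ‖x‖ ^ 2) ^ (-(α' / 2)) ≤ (1 + ‖x‖ ^ 2) ^ (-(α / 2)) :=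
    Real.rpow_le_rpow_of_exponent_le (by nlinarith) (by linarith)
  have h2 : (2 * ‖x‖ ^ 2) ^ (-(α' / 2)) ≤ (1 + ‖x‖ ^ 2) ^ (-(α' / 2)) :=
    Real.rpow_le_rpow_of_nonpos (by positivity) (by nlinarith) (by linarith)
  have e : (2 * ‖x‖ ^ 2) ^ (-(α' / 2)) = 2 ^ (-(α' / 2)) * ‖x‖ ^ (-α') := by
    rw [Real.mul_rpow (by norm_num) (by positivity), ← Real.rpow_natCast, ← Real.rpow_mul hx0.le]
    congr 2; push_cast; ring
  rw [mul_assoc, ← e]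
  exact mul_le_mul_of_nonneg_left (h2.trans h1) hK.le

/-- A logarithm is dominated by any positive power, here `s - α/2`. The first alternative at the
critical exponent thus follows from the second. -/
theorem PowerLowerBound.logLowerBound {N : ℕ} {ρ : RN N → ℝ} {α s : ℝ} (h : PowerLowerBound ρ α)
    (hα : α < 2 * s) : LogLowerBound ρ s := by
  obtain ⟨K, hK, h⟩ := h
  have he : 0 < s - α / 2 := by linarith
  refine ⟨K * (s - α / 2), by positivity, fun x => le_trans ?_ (h x)⟩
  have hB : 0 < 1 + ‖x‖ ^ 2 := by positivity
  have h1 := Real.log_le_rpow_div hB.le he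
  rw [le_div_iff₀ he] at h1
  have e : (1 + ‖x‖ ^ 2) ^ (-(α / 2)) = (1 + ‖x‖ ^ 2) ^ (-s) * (1 + ‖x‖ ^ 2) ^ (s - α / 2) := by
    rw [← Real.rpow_add hB]; congr 1; ring
  rw [e]
  have := mul_le_mul_of_nonneg_left h1 (by positivity : 0 ≤ K * (1 + ‖x‖ ^ 2) ^ (-s))
  linarith

/-- For exponents other than the Riesz one, size alone decides and no sign of the operator is used.
The bound is already uniform in `ε`, so the error constant `D` is `0`. -/
theorem AdmissibleDecay.of_bound {N : ℕ} (hN : 1 ≤ N) {s b : ℝ} (hs0 : 0 < s) (hs1 : s < 1)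
    (hb : 0 ≤ b) (hb' : b ≤ (N : ℝ) + 2 * s) {ρ : RN N → ℝ} (hρ : Continuous ρ)
    (hρpos : ∀ x, 0 < ρ x) {C : ℝ} (hC : 0 ≤ C)
    (h : ∀ x : RN N, 1 ≤ ‖x‖ → ‖x‖ ^ (-b - 2 * s) +
        ‖x‖ ^ (-((N : ℝ) + 2 * s)) * ∫ y in {y : RN N | ‖y‖ ≤ ‖x‖}, (1 + ‖y‖) ^ (-b) ≤
        C * (ρ x * ‖x‖ ^ (-b))) :
    AdmissibleDecay s b ρ := by
  obtain ⟨C1, hC1, h1⟩ := exists_abs_truncFracLap_decayFn_le hN hs0 hs1 hb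
  refine AdmissibleDecay.of_outer hN hs0 hs1 hb hb' hρ hρpos (C := C1 * C) (D := 0)
    (by positivity) le_rfl fun ε hε hε4 x hx => ?_
  rw [zero_mul, add_zero, decayFn_of_one_le b hx]
  have h2 := (neg_le_abs _).trans (h1 ε hε (by linarith) x hx)
  have h3 := mul_le_mul_of_nonneg_left (h x hx) hC1
  linarith

/-- The mass of `(1 + |y|)^{-b}` in the ball of radius `|x|` is `O(|x|^{N-b})`, so both terms are of
order `|x|^{-b-2s}`, which is what `ρ ≥ k |x|^{-2s}` dominates. -/
theorem admissibleDecay_of_lt_dim {N : ℕ} (hN : 1 ≤ N) {s b α : ℝ} (hs0 : 0 < s) (hs1 : s < 1)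
    (hb : 0 ≤ b) (hbN : b < N) {ρ : RN N → ℝ} (hρ : Continuous ρ) (hρpos : ∀ x, 0 < ρ x)
    (hα : α ≤ 2 * s) (h : PowerLowerBound ρ α) : AdmissibleDecay s b ρ := by
  obtain ⟨k, hk, h⟩ := h.exists_le hα (by linarith)
  have hNb : 0 < (N : ℝ) - b := by linarith
  have hS := sphereArea_nonneg N
  refine AdmissibleDecay.of_bound hN hs0 hs1 hb (by linarith) hρ hρpos
    (C := (1 + sphereArea N / (N - b)) / k) (by positivity) fun x hx => ?_
  have hx0 : 0 < ‖x‖ := by linarith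
  have hJ : ∫ y in {y : RN N | ‖y‖ ≤ ‖x‖}, (1 + ‖y‖) ^ (-b) ≤
      sphereArea N * (‖x‖ ^ ((N : ℝ) - b) / (N - b)) := by
    rw [← setIntegral_norm_rpow_le hN hNb hx0.le]
    refine integral_mono_of_nonneg (Eventually.of_forall fun y => by show (0 : ℝ) ≤ _; positivity)
      (integrableOn_norm_rpow_le hN hNb _) ?_
    have : Nonempty (Fin N) := ⟨⟨0, hN⟩⟩
    have hne : ∀ᵐ y : RN N ∂volume.restrict {y | ‖y‖ ≤ ‖x‖}, y ≠ 0 :=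
      ae_restrict_of_ae (Measure.ae_ne volume 0)
    filter_upwards [hne] with y hy
    have e : (N : ℝ) - b - N = -b := by ring
    rw [e]
    exact Real.rpow_le_rpow_of_nonpos (norm_pos_iff.2 hy) (by linarith) (by linarith)
  have e1 : ‖x‖ ^ (-((N : ℝ) + 2 * s)) * ‖x‖ ^ ((N : ℝ) - b) = ‖x‖ ^ (-b - 2 * s) := by
    rw [← Real.rpow_add hx0]; congr 1; ring
  have e2 : ‖x‖ ^ (-(2 * s)) * ‖x‖ ^ (-b) = ‖x‖ ^ (-b - 2 * s) := by
    rw [← Real.rpow_add hx0]; congr 1; ring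
  have h1 := mul_le_mul_of_nonneg_left hJ (by positivity : 0 ≤ ‖x‖ ^ (-((N : ℝ) + 2 * s)))
  have h2 : k * ‖x‖ ^ (-b - 2 * s) ≤ ρ x * ‖x‖ ^ (-b) := by
    rw [← e2, ← mul_assoc]
    exact mul_le_mul_of_nonneg_right (h x hx) (by positivity)
  have e3 : ‖x‖ ^ (-((N : ℝ) + 2 * s)) * (sphereArea N * (‖x‖ ^ ((N : ℝ) - b) / (N - b))) =
      sphereArea N / (N - b) * ‖x‖ ^ (-b - 2 * s) := by rw [← e1]; ring
  have e4 : (1 + sphereArea N / (N - b)) / k * (k * ‖x‖ ^ (-b - 2 * s)) =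
      (1 + sphereArea N / (N - b)) * ‖x‖ ^ (-b - 2 * s) := by field_simp
  have h3 := mul_le_mul_of_nonneg_left h2
    (by positivity : 0 ≤ (1 + sphereArea N / (N - b)) / k)
  linarith

/-- At `b = N` the mass in the ball grows at most logarithmically, and the logarithm in the bound on
`ρ` compensates for it. -/
theorem admissibleDecay_dim {N : ℕ} (hN : 1 ≤ N) {s : ℝ} (hs0 : 0 < s) (hs1 : s < 1)
    {ρ : RN N → ℝ} (hρ : Continuous ρ) (hρpos : ∀ x, 0 < ρ x) (h : LogLowerBound ρ s) :
    AdmissibleDecay s N ρ := by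
  obtain ⟨K, hK, h⟩ := h
  have hS := sphereArea_nonneg N
  refine AdmissibleDecay.of_bound hN hs0 hs1 (Nat.cast_nonneg N) (by linarith) hρ hρpos
    (C := (2 + sphereArea N) * 2 ^ s / K) (by positivity) fun x hx => ?_
  have hx0 : 0 < ‖x‖ := by linarith
  have hx2 : 1 ≤ ‖x‖ ^ 2 := one_le_pow₀ hx
  have h1 := mul_le_mul_of_nonneg_left (setIntegral_one_add_norm_rpow_neg_dim_le hN hx0.le)
    (by positivity : 0 ≤ ‖x‖ ^ (-((N : ℝ) + 2 * s)))
  have hl1 : Real.log (1 + ‖x‖) ≤ Real.log (1 + ‖x‖ ^ 2) :=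
    Real.log_le_log (by positivity) (by nlinarith)
  -- Since `2 log 2 ≥ 1`, the term without a logarithm is absorbed as well.
  have hl2 : 1 ≤ 2 * Real.log (1 + ‖x‖ ^ 2) := by
    have : Real.log 2 ≤ Real.log (1 + ‖x‖ ^ 2) := Real.log_le_log (by norm_num) (by linarith)
    have := Real.log_two_gt_d9
    linarith
  set ℓ := Real.log (1 + ‖x‖ ^ 2) with hℓ
  have hℓ0 : 0 ≤ ℓ := by linarith
  have e0 : -(N : ℝ) - 2 * s = -((N : ℝ) + 2 * s) := by ring
  have e2 : ‖x‖ ^ (-(2 * s)) * ‖x‖ ^ (-(N : ℝ)) = ‖x‖ ^ (-((N : ℝ) + 2 * s)) := by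
    rw [← Real.rpow_add hx0]; congr 1; ring
  rw [e0]
  set X := ‖x‖ ^ (-((N : ℝ) + 2 * s)) with hX
  have hX0 : 0 ≤ X := by positivity
  have h3 : 2 ^ (-s) * ‖x‖ ^ (-(2 * s)) ≤ (1 + ‖x‖ ^ 2) ^ (-s) := by
    have e : (2 * ‖x‖ ^ 2) ^ (-s) = 2 ^ (-s) * ‖x‖ ^ (-(2 * s)) := by
      rw [Real.mul_rpow (by norm_num) (by positivity), ← Real.rpow_natCast,
        ← Real.rpow_mul hx0.le]
      congr 2; push_cast; ring
    rw [← e]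
    exact Real.rpow_le_rpow_of_nonpos (by positivity) (by linarith) (by linarith)
  have h4 : K * 2 ^ (-s) * X * ℓ ≤ ρ x * ‖x‖ ^ (-(N : ℝ)) := by
    rw [← e2]
    refine le_trans (le_of_eq ?_) (mul_le_mul_of_nonneg_right
      ((mul_le_mul_of_nonneg_right (mul_le_mul_of_nonneg_left h3 hK.le) hℓ0).trans (h x))
      (by positivity : 0 ≤ ‖x‖ ^ (-(N : ℝ))))
    ring
  have h5 := mul_le_mul_of_nonneg_left h4
    (by positivity : 0 ≤ (2 + sphereArea N) * 2 ^ s / K)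
  have e5 : (2 + sphereArea N) * 2 ^ s / K * (K * 2 ^ (-s) * X * ℓ) =
      (2 + sphereArea N) * (X * ℓ) := by
    rw [Real.rpow_neg (by norm_num)]; field_simp
  rw [e5] at h5
  refine le_trans ?_ h5
  have h6 := mul_le_mul_of_nonneg_left hl1 (mul_nonneg hX0 hS)
  have h7 := mul_le_mul_of_nonneg_left hl2 hX0
  linarith

/-- For `b > N` the function `(1 + |y|)^{-b}` has finite mass, so the operator decays like the
kernel, as `|x|^{-(N+2s)}`, however large `b` is. Matching this with `ρ |x|^{-b}` gives the
condition on `α + b`. -/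
theorem admissibleDecay_of_dim_lt {N : ℕ} (hN : 1 ≤ N) {s b α : ℝ} (hs0 : 0 < s) (hs1 : s < 1)
    (hbN : (N : ℝ) < b) (hb' : b ≤ (N : ℝ) + 2 * s) {ρ : RN N → ℝ} (hρ : Continuous ρ)
    (hρpos : ∀ x, 0 < ρ x) (hα : α + b ≤ N + 2 * s) (h : PowerLowerBound ρ α) :
    AdmissibleDecay s b ρ := by
  obtain ⟨k, hk, h⟩ := h.exists_le (α' := N + 2 * s - b) (by linarith) (by linarith)
  have hb : 0 ≤ b := (Nat.cast_nonneg N).trans hbN.le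
  have hint : Integrable (fun y : RN N => (1 + ‖y‖) ^ (-b)) :=
    integrable_one_add_norm (by simpa using hbN)
  set J := ∫ y : RN N, (1 + ‖y‖) ^ (-b) with hJ
  have hJ0 : 0 ≤ J := integral_nonneg fun y => by positivity
  clear_value J
  refine AdmissibleDecay.of_bound hN hs0 hs1 hb hb' hρ hρpos
    (C := (1 + J) / k) (by positivity) fun x hx => ?_
  have hx0 : 0 < ‖x‖ := by linarith
  have h1 : ∫ y in {y : RN N | ‖y‖ ≤ ‖x‖}, (1 + ‖y‖) ^ (-b) ≤ J :=
    hJ ▸ setIntegral_le_integral hint (Eventually.of_forall fun y => by show (0 : ℝ) ≤ _; positivity)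
  have h2 : ‖x‖ ^ (-b - 2 * s) ≤ ‖x‖ ^ (-((N : ℝ) + 2 * s)) :=
    Real.rpow_le_rpow_of_exponent_le hx (by linarith)
  have e2 : ‖x‖ ^ (-((N : ℝ) + 2 * s - b)) * ‖x‖ ^ (-b) = ‖x‖ ^ (-((N : ℝ) + 2 * s)) := by
    rw [← Real.rpow_add hx0]; congr 1; ring
  set X := ‖x‖ ^ (-((N : ℝ) + 2 * s)) with hX
  have hX0 : 0 ≤ X := by positivity
  have h3 : k * X ≤ ρ x * ‖x‖ ^ (-b) := by
    rw [← e2, ← mul_assoc]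
    exact mul_le_mul_of_nonneg_right (h x hx) (by positivity)
  have h4 := mul_le_mul_of_nonneg_left h3 (by positivity : 0 ≤ (1 + J) / k)
  have e4 : (1 + J) / k * (k * X) = (1 + J) * X := by field_simp
  have h5 := mul_le_mul_of_nonneg_left h1 hX0
  linarith

/-! ### The Riesz potential `|x|^{-(N-2s)}` -/

/-- The inversion is conformal: its differential is a dilation by `(R / |z|)²` composed with a
reflection. -/
theorem abs_det_fderiv_inversion {N : ℕ} (R : ℝ) (z : RN N) :
    |(((R / dist z 0) ^ 2 • ((ℝ ∙ (z - 0))ᗮ.reflection : RN N →L[ℝ] RN N)) :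
      RN N →L[ℝ] RN N).det| = (R / ‖z‖) ^ (2 * N) := by
  have h : (((R / dist z 0) ^ 2 • ((ℝ ∙ (z - 0))ᗮ.reflection : RN N →L[ℝ] RN N)) :
      RN N →L[ℝ] RN N).det =
      LinearMap.det ((R / dist z 0) ^ 2 • ((ℝ ∙ (z - 0))ᗮ.reflection.toLinearMap :
        RN N →ₗ[ℝ] RN N)) := rfl
  rw [h, LinearMap.det_smul, Submodule.det_reflection, abs_mul, abs_pow, abs_pow, abs_pow,
    abs_neg, abs_one, one_pow, mul_one, dist_zero_right, finrank_euclideanSpace_fin, sq_abs,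
    ← pow_mul]

/-- The exterior of a ball around `x`, without the origin. -/
def puncturedExterior {N : ℕ} (ε : ℝ) (x : RN N) : Set (RN N) := {y | y ≠ 0 ∧ ε < ‖x - y‖}

/-- The image of `puncturedExterior ε x` under the inversion in the sphere through `x`. -/
def invertedExterior {N : ℕ} (ε : ℝ) (x : RN N) : Set (RN N) :=
  {z | z ≠ 0 ∧ ε * ‖z‖ < ‖x‖ * ‖x - z‖}

theorem measurableSet_puncturedExterior {N : ℕ} (ε : ℝ) (x : RN N) :
    MeasurableSet (puncturedExterior ε x) :=
  (measurableSet_singleton 0).compl.inter (measurableSet_lt_norm_sub x ε)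

theorem measurableSet_invertedExterior {N : ℕ} (ε : ℝ) (x : RN N) :
    MeasurableSet (invertedExterior ε x) :=
  (measurableSet_singleton 0).compl.inter (measurableSet_lt (measurable_norm.const_mul ε)
    ((measurable_const.sub measurable_id).norm.const_mul _))

theorem norm_inversion {N : ℕ} (R : ℝ) (z : RN N) :
    ‖EuclideanGeometry.inversion 0 R z‖ = R ^ 2 / ‖z‖ := by
  have := EuclideanGeometry.dist_inversion_center (0 : RN N) z R
  simpa [dist_zero_right] using this

theorem norm_sub_inversion {N : ℕ} {x z : RN N} (hx : x ≠ 0) (hz : z ≠ 0) :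
    ‖x - EuclideanGeometry.inversion 0 ‖x‖ z‖ = ‖x‖ / ‖z‖ * ‖x - z‖ := by
  have h := EuclideanGeometry.dist_inversion_inversion hx hz ‖x‖
  rw [EuclideanGeometry.inversion_of_mem_sphere (by simp), dist_zero_right, dist_zero_right,
    dist_eq_norm, dist_eq_norm] at h
  rw [h]
  have := norm_pos_iff.2 hx
  field_simp

theorem image_inversion_invertedExterior {N : ℕ} {ε : ℝ} {x : RN N} (hx : x ≠ 0) :
    EuclideanGeometry.inversion 0 ‖x‖ '' invertedExterior ε x = puncturedExterior ε x := by
  have hxn : 0 < ‖x‖ := norm_pos_iff.2 hx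
  have hne : ∀ z : RN N, z ≠ 0 → EuclideanGeometry.inversion 0 ‖x‖ z ≠ 0 := fun z hz => by
    rw [← norm_pos_iff, norm_inversion]
    have := norm_pos_iff.2 hz
    positivity
  ext y
  constructor
  · rintro ⟨z, ⟨hz, h⟩, rfl⟩
    have hzn := norm_pos_iff.2 hz
    refine ⟨hne z hz, ?_⟩
    rw [norm_sub_inversion hx hz, div_mul_eq_mul_div, lt_div_iff₀ hzn]
    exact h
  · rintro ⟨hy, h⟩
    have hyn := norm_pos_iff.2 hy
    refine ⟨EuclideanGeometry.inversion 0 ‖x‖ y, ⟨hne y hy, ?_⟩,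
      EuclideanGeometry.inversion_inversion 0 hxn.ne' y⟩
    rw [norm_sub_inversion hx hy, norm_inversion]
    have : 0 < ‖x‖ ^ 2 / ‖y‖ := by positivity
    calc ε * (‖x‖ ^ 2 / ‖y‖) < ‖x - y‖ * (‖x‖ ^ 2 / ‖y‖) := by gcongr
      _ = _ := by ring

/-- The inversion changes the sign of the integrals that define `(-Δ)^s |x|^{-(N-2s)}`. -/
theorem setIntegral_riesz_eq_neg {N : ℕ} {s ε : ℝ} {x : RN N} (hx : x ≠ 0) :
    ∫ y in puncturedExterior ε x, (‖x‖ ^ (-((N : ℝ) - 2 * s)) - ‖y‖ ^ (-((N : ℝ) - 2 * s))) *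
        fracKernel s (x - y) =
    -∫ y in invertedExterior ε x, (‖x‖ ^ (-((N : ℝ) - 2 * s)) - ‖y‖ ^ (-((N : ℝ) - 2 * s))) *
        fracKernel s (x - y) := by
  have hxn : 0 < ‖x‖ := norm_pos_iff.2 hx
  rw [← image_inversion_invertedExterior hx,
    integral_image_eq_integral_abs_det_fderiv_smul volume (measurableSet_invertedExterior ε x)
      (fun z hz => (EuclideanGeometry.hasFDerivAt_inversion
        (c := (0 : RN N)) (R := ‖x‖) hz.1).hasFDerivWithinAt)
      ((EuclideanGeometry.inversion_injective 0 hxn.ne').injOn), ← integral_neg]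
  refine setIntegral_congr_fun (measurableSet_invertedExterior ε x) fun z hz => ?_
  have hzn : 0 < ‖z‖ := norm_pos_iff.2 hz.1
  rw [abs_det_fderiv_inversion, smul_eq_mul, norm_inversion]
  unfold fracKernel
  rw [norm_sub_inversion hx hz.1]
  -- Under the inversion `|y| = |x| q` and `|x - y| = q |x - z|`, with Jacobian `q^{2N}`. Jacobian
  -- and kernel leave `q^{N-2s}`, and multiplying `|x|^{-(N-2s)} - |y|^{-(N-2s)}` by this power
  -- gives `|z|^{-(N-2s)} - |x|^{-(N-2s)}`: the sign changes.
  set q := ‖x‖ / ‖z‖ with hq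
  have hq0 : 0 < q := by positivity
  have e1 : ‖x‖ ^ 2 / ‖z‖ = ‖x‖ * q := by rw [hq]; ring
  have e2 : ‖z‖ = ‖x‖ * q⁻¹ := by rw [hq]; field_simp
  rw [e1, Real.mul_rpow hq0.le (norm_nonneg _), Real.mul_rpow hxn.le hq0.le, ← Real.rpow_natCast q,
    e2, Real.mul_rpow hxn.le (by positivity), Real.inv_rpow hq0.le, ← Real.rpow_neg hq0.le, neg_neg]
  have e3 : q ^ (((2 * N : ℕ) : ℝ)) * q ^ (-((N : ℝ) + 2 * s)) = q ^ ((N : ℝ) - 2 * s) := by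
    rw [← Real.rpow_add hq0]; congr 1; push_cast; ring
  have e4 : q ^ ((N : ℝ) - 2 * s) * q ^ (-((N : ℝ) - 2 * s)) = 1 := by
    rw [← Real.rpow_add hq0]; simp
  linear_combination (‖x‖ ^ (-((N : ℝ) - 2 * s)) *
    (1 - q ^ (-((N : ℝ) - 2 * s))) * ‖x - z‖ ^ (-((N : ℝ) + 2 * s))) * e3 -
    ‖x‖ ^ (-((N : ℝ) - 2 * s)) * ‖x - z‖ ^ (-((N : ℝ) + 2 * s)) * e4

theorem integrable_riesz_weight {N : ℕ} (hN : 1 ≤ N) {s : ℝ} (hs0 : 0 < s)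
    (hb : 0 ≤ (N : ℝ) - 2 * s) :
    Integrable fun y : RN N => ‖y‖ ^ (-((N : ℝ) - 2 * s)) *
      (1 + ‖y‖) ^ (-((N : ℝ) + 2 * s)) := by
  have hI := integrableOn_norm_rpow_le hN (by linarith : 0 < 2 * s) 1
  have hm : MeasurableSet {z : RN N | ‖z‖ ≤ 1} := measurableSet_le (by fun_prop) (by fun_prop)
  refine Integrable.mono' (((integrable_indicator_iff hm).2 hI).add
    (integrable_one_add_norm_rpow hs0)) ((measurable_norm.pow_const _).mul
      ((measurable_const.add measurable_norm).pow_const _)).aestronglyMeasurable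
    (Eventually.of_forall fun y => ?_)
  have h1 : (1 + ‖y‖) ^ (-((N : ℝ) + 2 * s)) ≤ 1 :=
    Real.rpow_le_one_of_one_le_of_nonpos (by linarith [norm_nonneg y])
      (by have : (0 : ℝ) ≤ N := Nat.cast_nonneg N
          linarith)
  have h0 : 0 ≤ (1 + ‖y‖) ^ (-((N : ℝ) + 2 * s)) := by positivity
  have e : -((N : ℝ) - 2 * s) = 2 * s - N := by ring
  rw [Real.norm_of_nonneg (by positivity), Pi.add_apply, e]
  rcases le_or_gt ‖y‖ 1 with h | h
  · rw [indicator_of_mem (show y ∈ {z : RN N | ‖z‖ ≤ 1} from h)]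
    have : ‖y‖ ^ (2 * s - N) * (1 + ‖y‖) ^ (-((N : ℝ) + 2 * s)) ≤ ‖y‖ ^ (2 * s - N) :=
      mul_le_of_le_one_right (by positivity) h1
    linarith
  · rw [indicator_of_notMem (show y ∉ {z : RN N | ‖z‖ ≤ 1} from not_le.2 h), zero_add]
    exact mul_le_of_le_one_left h0 (Real.rpow_le_one_of_one_le_of_nonpos h.le (by linarith))

theorem abs_setIntegral_diff_le {N : ℕ} {E E' Z : Set (RN N)} (hE' : MeasurableSet E')
    (hE : MeasurableSet E) (hZ : MeasurableSet Z) {F g : RN N → ℝ} (hg : IntegrableOn g Z)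
    (h0 : ∀ y ∈ Z, 0 ≤ g y)
    (hsub : E \ E' ⊆ Z) (h : ∀ y ∈ Z, |F y| ≤ g y) :
    |∫ y in E \ E', F y| ≤ ∫ y in Z, g y := by
  rw [← Real.norm_eq_abs]
  refine (norm_integral_le_of_norm_le (hg.mono_set hsub) ?_).trans
    (setIntegral_mono_set hg ?_ hsub.eventuallyLE)
  · filter_upwards [ae_restrict_mem (hE.diff hE')] with y hy
    exact h y (hsub hy)
  · filter_upwards [ae_restrict_mem hZ] with y hy
    exact h0 y hy

/-- `|x|^{-(N-2s)}` is `s`-harmonic outside of the origin, with a rate. -/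
theorem exists_abs_truncFracLap_riesz_le {N : ℕ} (hN : 1 ≤ N) {s : ℝ} (hs0 : 0 < s)
    (hb : 0 ≤ (N : ℝ) - 2 * s) :
    ∃ D, 0 ≤ D ∧ ∀ ε, 0 < ε → ε ≤ 1 / 4 → ∀ x : RN N, 1 ≤ ‖x‖ →
      |truncFracLap s ε (fun y => ‖y‖ ^ (-((N : ℝ) - 2 * s))) x| ≤ D * ε ^ (2 - 2 * s) := by
  have : Nonempty (Fin N) := ⟨⟨0, hN⟩⟩
  set b := (N : ℝ) - 2 * s with hbdef
  set B := b * (1 / 2) ^ (-b - 1) with hB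
  have hB0 : 0 ≤ B := by positivity
  have hS := sphereArea_nonneg N
  refine ⟨B * (sphereArea N * (4 * 2 ^ (2 * s))), by positivity, fun ε hε hε4 x hx => ?_⟩
  have hx0 : x ≠ 0 := by rintro rfl; norm_num at hx
  have hxn : 0 < ‖x‖ := by linarith
  set F : RN N → ℝ := fun y => (‖x‖ ^ (-b) - ‖y‖ ^ (-b)) * fracKernel s (x - y) with hF
  -- As `|x| ≥ 1` and `||x| - |y|| ≤ |x - y|`, the exterior of the ball and its inverted image
  -- differ only inside the shell `lo ≤ |x - y| ≤ hi`, of thickness `4 ε²`.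
  set lo := ε * (1 - 2 * ε) with hlo
  set hi := ε * (1 + 2 * ε) with hhi
  have hlo2 : ε / 2 ≤ lo := by rw [hlo]; nlinarith
  have hlo0 : 0 < lo := by linarith
  have hlohi : lo ≤ hi := by rw [hlo, hhi]; nlinarith
  have hhi2 : hi ≤ 1 / 2 := by rw [hhi]; nlinarith
  set Z : Set (RN N) := {y | x - y ∈ {z : RN N | ‖z‖ ∈ Icc lo hi}} with hZ
  have hZm : MeasurableSet Z := (measurable_const.sub measurable_id).norm measurableSet_Icc
  have hA := measurableSet_puncturedExterior ε x
  have hA' := measurableSet_invertedExterior ε x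
  have htri : ∀ y : RN N, ‖y‖ ≤ ‖x‖ + ‖x - y‖ := fun y => by
    have := norm_sub_le x (x - y); simpa using this
  have htri' : ∀ y : RN N, ‖x‖ - ‖x - y‖ ≤ ‖y‖ := fun y => by
    have := norm_sub_norm_le x (x - y); simpa using this
  have hsub1 : puncturedExterior ε x \ invertedExterior ε x ⊆ Z := by
    rintro y ⟨⟨hy, h1⟩, h2⟩
    have h3 : ‖x‖ * ‖x - y‖ ≤ ε * ‖y‖ := by
      by_contra h; exact h2 ⟨hy, not_le.1 h⟩
    have h4 : ‖x‖ * ‖x - y‖ ≤ ‖x‖ * (ε * (1 + ‖x - y‖)) := by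
      have := mul_le_mul_of_nonneg_left (htri y) hε.le
      have := mul_le_mul_of_nonneg_right hx (by positivity : 0 ≤ ε * ‖x - y‖)
      nlinarith
    have h5 := le_of_mul_le_mul_left h4 hxn
    refine ⟨?_, ?_⟩
    · rw [hlo]; nlinarith
    · have h6 : ‖x - y‖ ≤ 2 * ε := by nlinarith
      rw [hhi]; nlinarith
  have hsub2 : invertedExterior ε x \ puncturedExterior ε x ⊆ Z := by
    rintro y ⟨⟨hy, h1⟩, h2⟩
    have h3 : ‖x - y‖ ≤ ε := by
      by_contra h; exact h2 ⟨hy, not_le.1 h⟩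
    have h4 : ‖x‖ * (ε * (1 - ‖x - y‖)) < ‖x‖ * ‖x - y‖ := by
      have := mul_le_mul_of_nonneg_left (htri' y) hε.le
      have := mul_le_mul_of_nonneg_right hx (by positivity : 0 ≤ ε * ‖x - y‖)
      nlinarith
    have h5 := lt_of_mul_lt_mul_left h4 hxn.le
    refine ⟨?_, ?_⟩
    · rw [hlo]; nlinarith
    · rw [hhi]; nlinarith
  have hmeas : Measurable fun y : RN N => ‖y‖ ^ (-b) := measurable_norm.pow_const _
  have hint : IntegrableOn F {y | lo / 2 < ‖x - y‖} :=
    integrableOn_sub_mul_fracKernel hN hs0 (by linarith) hmeas (integrable_riesz_weight hN hs0 hb) x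
  have hloε : lo ≤ ε := by rw [hlo]; nlinarith
  have hsA : puncturedExterior ε x ⊆ {y | lo / 2 < ‖x - y‖} := fun y hy => by
    have := hy.2; show lo / 2 < ‖x - y‖; linarith
  have hsA' : invertedExterior ε x ⊆ {y | lo / 2 < ‖x - y‖} := fun y hy => by
    by_cases h : y ∈ puncturedExterior ε x
    · exact hsA h
    · have := (hsub2 ⟨hy, h⟩).1; show lo / 2 < ‖x - y‖; linarith
  have hL : truncFracLap s ε (fun y => ‖y‖ ^ (-b)) x = ∫ y in puncturedExterior ε x, F y := by
    unfold truncFracLap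
    refine setIntegral_congr_set ?_
    filter_upwards [Measure.ae_ne volume (0 : RN N)] with y hy
    exact propext ⟨fun h => ⟨hy, h⟩, fun h => h.2⟩
  have hneg := setIntegral_riesz_eq_neg (s := s) (ε := ε) hx0
  rw [← hbdef] at hneg
  have hd1 := integral_inter_add_sdiff hA' (hint.mono_set hsA)
  have hd2 := integral_inter_add_sdiff hA (hint.mono_set hsA')
  rw [inter_comm] at hd2
  obtain ⟨hgI, hgV⟩ := setIntegral_shell_le (N := N) hN ((N : ℝ) + 2 * s - 1) hlo0 hlohi
  rw [← integrableOn_comp_sub_left_iff x] at hgI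
  rw [← setIntegral_comp_sub_left x] at hgV
  -- A Lipschitz bound suffices on so thin a shell: the radial integrand `t^{-2s}` over a length of
  -- `4 ε²` is `O(ε^{2-2s})`.
  have hFg : ∀ y ∈ Z, |F y| ≤ B * ‖x - y‖ ^ (-((N : ℝ) + 2 * s - 1)) := by
    intro y hy
    have hz : 0 < ‖x - y‖ := hlo0.trans_le hy.1
    have hzh : ‖x - y‖ ≤ 1 / 2 := le_trans hy.2 hhi2
    have hy2 : 1 / 2 ≤ ‖y‖ := by linarith [htri' y]
    have h1 := abs_rpow_neg_sub_le hb (by norm_num : (0 : ℝ) < 1 / 2)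
      (by linarith : 1 / 2 ≤ ‖x‖) hy2
    have h2 : |‖x‖ - ‖y‖| ≤ ‖x - y‖ := abs_norm_sub_norm_le x y
    rw [hF]
    simp only
    rw [abs_mul, abs_of_nonneg (fracKernel_nonneg s _)]
    refine (mul_le_mul_of_nonneg_right (h1.trans (mul_le_mul_of_nonneg_left h2 hB0))
      (fracKernel_nonneg s _)).trans_eq ?_
    rw [← hB]
    unfold fracKernel
    have : ‖x - y‖ ^ (-((N : ℝ) + 2 * s - 1)) = ‖x - y‖ * ‖x - y‖ ^ (-((N : ℝ) + 2 * s)) := by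
      rw [mul_comm ‖x - y‖, ← Real.rpow_add_one hz.ne']; congr 1; ring
    rw [this]; ring
  have hb1 := abs_setIntegral_diff_le hA' hA hZm (hgI.const_mul B)
    (fun y _ => by positivity) hsub1 hFg
  have hb2 := abs_setIntegral_diff_le hA hA' hZm (hgI.const_mul B)
    (fun y _ => by positivity) hsub2 hFg
  have hV : ∫ y in Z, B * ‖x - y‖ ^ (-((N : ℝ) + 2 * s - 1)) ≤
      B * (sphereArea N * (4 * 2 ^ (2 * s))) * ε ^ (2 - 2 * s) := by
    rw [integral_const_mul, hgV]
    have e0 : (N : ℝ) - 1 - ((N : ℝ) + 2 * s - 1) = -(2 * s) := by ring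
    rw [e0]
    have h1 : ∫ t in lo..hi, t ^ (-(2 * s)) ≤ (ε / 2) ^ (-(2 * s)) * |hi - lo| := by
      refine (le_abs_self _).trans ?_
      rw [← Real.norm_eq_abs]
      refine intervalIntegral.norm_integral_le_of_norm_le_const fun t ht => ?_
      rw [uIoc_of_le hlohi] at ht
      have ht0 : 0 < t := hlo0.trans ht.1
      rw [Real.norm_of_nonneg (by positivity)]
      exact Real.rpow_le_rpow_of_nonpos (by linarith) (by linarith [ht.1]) (by linarith)
    have h2 : |hi - lo| = 4 * ε ^ 2 := by
      rw [abs_of_nonneg (by linarith), hlo, hhi]; ring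
    have h3 : (ε / 2) ^ (-(2 * s)) * (4 * ε ^ 2) = 4 * 2 ^ (2 * s) * ε ^ (2 - 2 * s) := by
      have : ε ^ (2 - 2 * s) = ε ^ (-(2 * s)) * ε ^ 2 := by
        rw [← Real.rpow_natCast, ← Real.rpow_add hε]; congr 1; push_cast; ring
      rw [Real.div_rpow hε.le (by norm_num), Real.rpow_neg (by norm_num : (0 : ℝ) ≤ 2), this]
      field_simp
    rw [h2, h3] at h1
    calc B * (sphereArea N * ∫ t in lo..hi, t ^ (-(2 * s)))
        ≤ B * (sphereArea N * (4 * 2 ^ (2 * s) * ε ^ (2 - 2 * s))) := by gcongr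
      _ = _ := by ring
  rw [hL]
  -- The integral over one domain is minus that over the other. Subtracting the two cancels their
  -- common part and leaves only the shell.
  have hkey : 2 * ∫ y in puncturedExterior ε x, F y =
      (∫ y in puncturedExterior ε x \ invertedExterior ε x, F y) -
        ∫ y in invertedExterior ε x \ puncturedExterior ε x, F y := by linarith
  have h5 : |2 * ∫ y in puncturedExterior ε x, F y| ≤
      2 * (B * (sphereArea N * (4 * 2 ^ (2 * s))) * ε ^ (2 - 2 * s)) := by
    rw [hkey]
    refine (abs_sub _ _).trans ?_
    linarith
  rw [abs_mul, abs_two] at h5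
  linarith

/-- At `|x| ≥ 1` replacing the Riesz potential by the smaller `v`, equal to it at `x`, only
increases the operator. So `-(-Δ)^s v ≤ 0` up to the truncation error, with `C = 0` outside the unit
ball, and no decay bound on `ρ` is required. -/
theorem admissibleDecay_riesz {N : ℕ} (hN : 1 ≤ N) {s : ℝ} (hs0 : 0 < s) (hs1 : s < 1)
    (hb : 0 ≤ (N : ℝ) - 2 * s) {ρ : RN N → ℝ} (hρ : Continuous ρ) (hρpos : ∀ x, 0 < ρ x) :
    AdmissibleDecay s ((N : ℝ) - 2 * s) ρ := by
  have : Nonempty (Fin N) := ⟨⟨0, hN⟩⟩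
  obtain ⟨D, hD, h⟩ := exists_abs_truncFracLap_riesz_le hN hs0 hb
  obtain ⟨C1, hC1, h1⟩ := exists_decayFn_le (N := N) hb
  refine AdmissibleDecay.of_outer hN hs0 hs1 hb (by linarith) hρ hρpos le_rfl hD
    fun ε hε hε4 x hx => ?_
  rw [zero_mul, zero_add]
  refine le_trans (neg_le_neg ?_) ((neg_le_abs _).trans (h ε hε hε4 x hx))
  have hvC : ∀ y : RN N, |decayFn ((N : ℝ) - 2 * s) y| ≤ C1 := fun y => by
    rw [abs_of_pos (decayFn_pos hb y)]
    exact (h1 y).trans (mul_le_of_le_one_right hC1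
      (Real.rpow_le_one_of_one_le_of_nonpos (by linarith [norm_nonneg y]) (by linarith)))
  have hmeas : Measurable fun y : RN N => ‖y‖ ^ (-((N : ℝ) - 2 * s)) :=
    measurable_norm.pow_const _
  have hi1 := integrableOn_sub_mul_fracKernel hN hs0 hε (continuous_decayFn _).measurable
    (integrable_weight_of_bounded hs0 (continuous_decayFn (N := N) _).measurable hvC) x
  have hi2 := integrableOn_sub_mul_fracKernel hN hs0 hε hmeas (integrable_riesz_weight hN hs0 hb) x
  unfold truncFracLap
  refine integral_mono_ae hi2 hi1 ?_
  filter_upwards [ae_restrict_of_ae (Measure.ae_ne volume (0 : RN N))] with y hy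
  refine mul_le_mul_of_nonneg_right ?_ (fracKernel_nonneg s _)
  rw [decayFn_of_one_le _ hx]
  linarith [decayFn_le_rpow hb hy]

/-! ### Symmetry of the truncated operator -/

/-- The kernel of the truncated operator. -/
noncomputable def truncKernel {N : ℕ} (s ε : ℝ) (p : RN N × RN N) : ℝ :=
  {q : RN N × RN N | ε < ‖q.1 - q.2‖}.indicator (fun q => fracKernel s (q.1 - q.2)) p

theorem measurable_truncKernel {N : ℕ} (s ε : ℝ) :
    Measurable (truncKernel s ε : RN N × RN N → ℝ) :=
  ((measurable_fracKernel s).comp (measurable_fst.sub measurable_snd)).indicator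
    (measurableSet_lt measurable_const (measurable_fst.sub measurable_snd).norm)

theorem truncKernel_swap {N : ℕ} (s ε : ℝ) (x y : RN N) :
    truncKernel s ε (y, x) = truncKernel s ε (x, y) := by
  unfold truncKernel
  simp only [indicator, mem_ofPred_eq, norm_sub_rev x y, fracKernel_sub_comm s x y]

theorem truncFracLap_eq_integral {N : ℕ} (s ε : ℝ) (f : RN N → ℝ) (x : RN N) :
    truncFracLap s ε f x = ∫ y, (f x - f y) * truncKernel s ε (x, y) := by
  unfold truncFracLap
  rw [← integral_indicator (measurableSet_lt_norm_sub x ε)]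
  refine integral_congr_ae (Eventually.of_forall fun y => ?_)
  by_cases h : ε < ‖x - y‖ <;> simp [truncKernel, h]

theorem truncKernel_nonneg {N : ℕ} (s ε : ℝ) (p : RN N × RN N) : 0 ≤ truncKernel s ε p :=
  indicator_nonneg (fun _ _ => fracKernel_nonneg s _) p

theorem truncKernel_le {N : ℕ} {s ε : ℝ} (hs : 0 < s) (hε : 0 < ε) (x y : RN N) :
    truncKernel s ε (x, y) ≤ ((1 + ε⁻¹) * (1 + ‖x‖)) ^ ((N : ℝ) + 2 * s) *
      (1 + ‖y‖) ^ (-((N : ℝ) + 2 * s)) := by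
  by_cases h : ε < ‖x - y‖
  · simp only [truncKernel, indicator, mem_ofPred_eq, h, if_true]
    exact fracKernel_le hs hε h
  · simp only [truncKernel, indicator, mem_ofPred_eq, h, if_false]
    positivity

theorem measurable_truncFracLap {N : ℕ} (s ε : ℝ) {f : RN N → ℝ} (hf : Measurable f) :
    Measurable (truncFracLap s ε f) := by
  have h : Measurable fun p : RN N × RN N => (f p.1 - f p.2) * truncKernel s ε p :=
    ((hf.comp measurable_fst).sub (hf.comp measurable_snd)).mul (measurable_truncKernel s ε)
  have := h.stronglyMeasurable.integral_prod_right' (ν := volume)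
  have e : truncFracLap s ε f = fun x => ∫ y, (f x - f y) * truncKernel s ε (x, y) :=
    funext (truncFracLap_eq_integral s ε f)
  rw [e]
  exact this.measurable

/-- The compact support of `g` absorbs the growth in `x` of the kernel bound, which justifies Fubini
in the integration by parts. -/
theorem integrable_prod_truncKernel {N : ℕ} {s ε : ℝ} (hs : 0 < s) (hε : 0 < ε)
    {g h : RN N → ℝ} (hg : Continuous g) (hgc : HasCompactSupport g) (hh : Measurable h)
    (hhi : Integrable fun y => h y * (1 + ‖y‖) ^ (-((N : ℝ) + 2 * s))) :
    Integrable (fun p : RN N × RN N => g p.1 * h p.2 * truncKernel s ε p)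
      (volume.prod volume) := by
  have h1 : Integrable fun x : RN N =>
      g x * ((1 + ε⁻¹) * (1 + ‖x‖)) ^ ((N : ℝ) + 2 * s) := by
    refine Continuous.integrable_of_hasCompactSupport (hg.mul ?_) hgc.mul_right
    exact Continuous.rpow_const (by fun_prop) fun x => Or.inl (by positivity)
  refine (h1.norm.mul_prod hhi.norm).mono'
    (((hg.measurable.comp measurable_fst).mul (hh.comp measurable_snd)).mul
      (measurable_truncKernel s ε)).aestronglyMeasurable (Eventually.of_forall fun p => ?_)
  have h2 := truncKernel_le hs hε p.1 p.2
  rw [norm_mul, norm_mul, norm_mul, norm_mul, Real.norm_of_nonneg (truncKernel_nonneg s ε p),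
    Real.norm_of_nonneg (by positivity : 0 ≤ ((1 + ε⁻¹) * (1 + ‖p.1‖)) ^ ((N : ℝ) + 2 * s)),
    Real.norm_of_nonneg (by positivity : 0 ≤ (1 + ‖p.2‖) ^ (-((N : ℝ) + 2 * s)))]
  calc ‖g p.1‖ * ‖h p.2‖ * truncKernel s ε p
      ≤ ‖g p.1‖ * ‖h p.2‖ * (((1 + ε⁻¹) * (1 + ‖p.1‖)) ^ ((N : ℝ) + 2 * s) *
        (1 + ‖p.2‖) ^ (-((N : ℝ) + 2 * s))) := mul_le_mul_of_nonneg_left h2 (by positivity)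
    _ = _ := by ring

theorem integrable_prod_truncKernel_diag {N : ℕ} {s ε : ℝ} (hs : 0 < s) (hε : 0 < ε)
    {g : RN N → ℝ} (hg : Continuous g) (hgc : HasCompactSupport g) :
    Integrable (fun p : RN N × RN N => g p.1 * truncKernel s ε p) (volume.prod volume) := by
  have := integrable_prod_truncKernel hs hε hg hgc (h := fun _ => 1) measurable_const
    (by simpa using integrable_one_add_norm_rpow hs)
  simpa using this

/-- Integration by parts for the truncated operator. -/
theorem integral_mul_truncFracLap_comm {N : ℕ} {s ε : ℝ} (hs : 0 < s) (hε : 0 < ε)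
    {φ f : RN N → ℝ} (hφ : Continuous φ) (hφc : HasCompactSupport φ) (hf : Continuous f)
    (hfi : Integrable fun y => f y * (1 + ‖y‖) ^ (-((N : ℝ) + 2 * s))) :
    ∫ x, φ x * truncFracLap s ε f x = ∫ x, f x * truncFracLap s ε φ x := by
  have i1 := integrable_prod_truncKernel_diag hs hε (hφ.mul hf) (hφc.mul_right (f' := f))
  have i2 := integrable_prod_truncKernel hs hε hφ hφc hf.measurable hfi
  have i3 : Integrable (fun p : RN N × RN N => φ p.2 * f p.1 * truncKernel s ε p)
      (volume.prod volume) := by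
    refine i2.swap.congr (Eventually.of_forall fun p => ?_)
    show φ p.2 * f p.1 * truncKernel s ε (p.2, p.1) = _
    rw [truncKernel_swap]
  have e1 : ∀ x, φ x * truncFracLap s ε f x =
      ∫ y, ((φ x * f x) * truncKernel s ε (x, y) - φ x * f y * truncKernel s ε (x, y)) := by
    intro x
    rw [truncFracLap_eq_integral, ← integral_const_mul]
    congr 1; ext y; ring
  have e2 : ∀ x, f x * truncFracLap s ε φ x =
      ∫ y, ((φ x * f x) * truncKernel s ε (x, y) - φ y * f x * truncKernel s ε (x, y)) := by
    intro x
    rw [truncFracLap_eq_integral, ← integral_const_mul]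
    congr 1; ext y; ring
  simp only [e1, e2]
  rw [integral_integral (f := fun x y =>
      (φ x * f x) * truncKernel s ε (x, y) - φ x * f y * truncKernel s ε (x, y)) (i1.sub i2),
    integral_integral (f := fun x y =>
      (φ x * f x) * truncKernel s ε (x, y) - φ y * f x * truncKernel s ε (x, y)) (i1.sub i3)]
  refine (integral_sub i1 i2).trans (Eq.trans ?_ (integral_sub i1 i3).symm)
  congr 1
  rw [← integral_prod_swap]
  refine integral_congr_ae (Eventually.of_forall fun p => ?_)
  show φ p.2 * f p.1 * truncKernel s ε (p.2, p.1) = _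
  rw [truncKernel_swap]

/-! ### Convexity -/

/-- The tangent inequality of a convex `G`, integrated against a positive kernel. It holds for each
`ε`, so no regularity of `G ∘ f` is involved. -/
theorem truncFracLap_comp_le {N : ℕ} (hN : 1 ≤ N) {s ε : ℝ} (hs : 0 < s) (hε : 0 < ε)
    {G G' : ℝ → ℝ} (hG : ∀ a c, G a - G c ≤ G' a * (a - c)) {f : RN N → ℝ} (hf : Measurable f)
    (hfi : Integrable fun y => f y * (1 + ‖y‖) ^ (-((N : ℝ) + 2 * s)))
    (hGf : Measurable fun y => G (f y))
    (hGfi : Integrable fun y => G (f y) * (1 + ‖y‖) ^ (-((N : ℝ) + 2 * s))) (x : RN N) :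
    truncFracLap s ε (fun y => G (f y)) x ≤ G' (f x) * truncFracLap s ε f x := by
  unfold truncFracLap
  rw [← integral_const_mul]
  refine integral_mono (integrableOn_sub_mul_fracKernel hN hs hε hGf hGfi x)
    ((integrableOn_sub_mul_fracKernel hN hs hε hf hfi x).const_mul _) fun y => ?_
  show _ ≤ G' (f x) * ((f x - f y) * fracKernel s (x - y))
  rw [← mul_assoc]
  exact mul_le_mul_of_nonneg_right (hG _ _) (fracKernel_nonneg s _)

/-! ### Regularity of solutions -/

/-- Both `1` and `t^a` are at most `(1 + t)^a`. This passes from the weight in the definition of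
`𝓛^s` to `(1 + |x|)^{-(N+2s)}`. -/
theorem one_add_rpow_neg_le {a t : ℝ} (ha : 0 ≤ a) (ht : 0 ≤ t) :
    (1 + t) ^ (-a) ≤ 2 / (1 + t ^ a) := by
  have h1 : 1 ≤ (1 + t) ^ a := Real.one_le_rpow (by linarith) ha
  have h2 : t ^ a ≤ (1 + t) ^ a := Real.rpow_le_rpow ht (by linarith) ha
  have h3 : 0 ≤ t ^ a := by positivity
  rw [Real.rpow_neg (by linarith), inv_le_iff_one_le_mul₀ (by linarith), div_mul_eq_mul_div,
    le_div_iff₀ (by linarith)]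
  linarith

theorem MemLs.integrable_weight {N : ℕ} {s : ℝ} (hs : 0 < s) {f : RN N → ℝ} (h : MemLs s f) :
    Integrable fun y => f y * (1 + ‖y‖) ^ (-((N : ℝ) + 2 * s)) := by
  refine Integrable.mono' (h.2.norm.const_mul 2) (h.1.mul
    ((measurable_const.add measurable_norm).pow_const _)).aestronglyMeasurable
    (Eventually.of_forall fun y => ?_)
  have h1 := one_add_rpow_neg_le (by positivity : 0 ≤ (N : ℝ) + 2 * s) (norm_nonneg y)
  rw [norm_mul, norm_div, Real.norm_of_nonneg (by positivity : 0 ≤ (1 + ‖y‖) ^ (-((N : ℝ) + 2 * s))),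
    Real.norm_of_nonneg (by positivity : 0 ≤ 1 + ‖y‖ ^ ((N : ℝ) + 2 * s))]
  calc ‖f y‖ * (1 + ‖y‖) ^ (-((N : ℝ) + 2 * s))
      ≤ ‖f y‖ * (2 / (1 + ‖y‖ ^ ((N : ℝ) + 2 * s))) := by gcongr
    _ = _ := by ring

/-- Functions in the regularity class are locally uniformly approximated by affine functions to an
order higher than `2s`. -/
theorem FracRegular.exists_affine {N : ℕ} {s : ℝ} {f : RN N → ℝ}
    (h : FracRegular s f) (r : ℝ) :
    ∃ γ > 0, ∃ C, ∃ A : RN N → (RN N →L[ℝ] ℝ), ∀ x y, ‖x‖ ≤ r → ‖x - y‖ ≤ 1 →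
      |f x - f y - A x (x - y)| ≤ C * ‖x - y‖ ^ (2 * s + γ) := by
  have hmem : ∀ x y : RN N, ‖x‖ ≤ r → ‖x - y‖ ≤ 1 → y ∈ Metric.closedBall (0 : RN N) (r + 1) := by
    intro x y hx hxy
    rw [mem_closedBall_zero_iff]
    have := norm_sub_le x (x - y)
    rw [sub_sub_cancel] at this
    linarith
  rcases lt_or_ge s (1 / 2) with hs2 | hs2
  · obtain ⟨γ, hγ, -, hH⟩ := h.1 hs2
    obtain ⟨C, hC⟩ := hH _ (isCompact_closedBall (0 : RN N) (r + 1))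
    -- For `s < 1/2` the Hölder exponent exceeds `2s`, so constants approximate well enough and the
    -- linear part is `0`.
    refine ⟨γ, hγ, C, fun _ => 0, fun x y hx hxy => ?_⟩
    have := hC x (hmem x x hx (by simp)) y (hmem x y hx hxy)
    simpa using this
  · obtain ⟨γ, hγ, -, hd, hH⟩ := h.2 hs2
    obtain ⟨C, hC⟩ := hH _ (isCompact_closedBall (0 : RN N) (r + 1))
    refine ⟨γ, hγ, |C|, fderiv ℝ f, fun x y hx hxy => ?_⟩
    have hθ : 0 < 2 * s + γ - 1 := by linarith
    -- The mean value inequality for `f` minus its linear part at `x`: on the segment the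
    -- differential varies by `O(|x - y|^{2s+γ-1})`.
    have hseg := (convex_segment y x).norm_image_sub_le_of_norm_hasFDerivWithin_le'
      (f := f) (f' := fderiv ℝ f) (φ := fderiv ℝ f x) (C := |C| * ‖x - y‖ ^ (2 * s + γ - 1))
      (fun z _ => ((hd.differentiable one_ne_zero) z).hasFDerivAt.hasFDerivWithinAt)
      (fun z hz => by
        rw [segment_symm] at hz
        have hzx : ‖x - z‖ ≤ ‖x - y‖ := by
          have := norm_sub_le_of_mem_segment hz
          simpa [norm_sub_rev] using this
        have h1 := hC z (hmem x z hx (hzx.trans hxy)) x (hmem x x hx (by simp))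
        have h2 : ‖z - x‖ ^ (2 * s + γ - 1) ≤ ‖x - y‖ ^ (2 * s + γ - 1) := by
          rw [norm_sub_rev z x]
          exact Real.rpow_le_rpow (norm_nonneg _) hzx hθ.le
        calc ‖fderiv ℝ f z - fderiv ℝ f x‖ ≤ C * ‖z - x‖ ^ (2 * s + γ - 1) := h1
          _ ≤ |C| * ‖z - x‖ ^ (2 * s + γ - 1) := by gcongr; exact le_abs_self C
          _ ≤ _ := by gcongr)
      (left_mem_segment ℝ y x) (right_mem_segment ℝ y x)
    rw [Real.norm_eq_abs] at hseg
    refine hseg.trans (le_of_eq ?_)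
    rw [mul_assoc]
    congr 1
    have e : 2 * s + γ = (2 * s + γ - 1) + 1 := by ring
    conv_rhs => rw [e]
    rw [Real.rpow_add_of_nonneg (norm_nonneg _) hθ.le zero_le_one, Real.rpow_one]

/-- The truncated operator of a regular function is locally bounded, uniformly in `ε`. -/
theorem FracRegular.exists_abs_truncFracLap_le {N : ℕ} (hN : 1 ≤ N) {s : ℝ} {f : RN N → ℝ}
    (hs : 0 < s) (h : FracRegular s f) (hf : Continuous f)
    (hfi : Integrable fun y => f y * (1 + ‖y‖) ^ (-((N : ℝ) + 2 * s))) (r : ℝ) :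
    ∃ C, ∀ ε, 0 < ε → ε ≤ 1 → ∀ x, ‖x‖ ≤ r → |truncFracLap s ε f x| ≤ C := by
  obtain ⟨γ, hγ, C1, A, hA⟩ := h.exists_affine r
  obtain ⟨M, hM⟩ := (isCompact_closedBall (0 : RN N) r).exists_bound_of_continuousOn
    hf.continuousOn
  set κ := sphereArea N * (1 ^ (-(2 * s)) / (2 * s)) with hκ
  have hκ0 : 0 ≤ κ := mul_nonneg (sphereArea_nonneg N) (by positivity)
  set J := ∫ y, ‖f y * (1 + ‖y‖) ^ (-((N : ℝ) + 2 * s))‖ with hJ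
  have hJ0 : 0 ≤ J := integral_nonneg fun y => norm_nonneg _
  refine ⟨C1 * (sphereArea N * (1 ^ γ / γ)) + (M * κ +
    ((1 + 1⁻¹) * (1 + r)) ^ ((N : ℝ) + 2 * s) * J), fun ε hε hε1 x hx => ?_⟩
  have hi := integrableOn_sub_mul_fracKernel hN hs hε hf.measurable hfi x
  rw [truncFracLap_eq_add hε1 hi]
  refine (abs_add_le _ _).trans (add_le_add
    (abs_setIntegral_annulus_le hN hs hε hγ zero_le_one (A x) x hi (hA x · hx)) ?_)
  have hIK := integrableOn_fracKernel hN hs x one_pos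
  rw [← Real.norm_eq_abs]
  refine (norm_integral_le_of_norm_le (g := fun y => M * fracKernel s (x - y) +
    ((1 + 1⁻¹) * (1 + r)) ^ ((N : ℝ) + 2 * s) *
      ‖f y * (1 + ‖y‖) ^ (-((N : ℝ) + 2 * s))‖) ?_ ?_).trans ?_
  · exact (hIK.const_mul M).add (hfi.norm.const_mul _).integrableOn
  · filter_upwards [ae_restrict_mem (measurableSet_lt_norm_sub x 1)] with y hy
    have hK := fracKernel_nonneg s (x - y)
    rw [norm_mul, Real.norm_of_nonneg hK]
    have h1 : ‖f x - f y‖ ≤ M + ‖f y‖ :=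
      (norm_sub_le _ _).trans (add_le_add_left (hM x (mem_closedBall_zero_iff.2 hx)) _)
    have h2 := fracKernel_le hs one_pos hy
    have h3 : ((1 + 1⁻¹) * (1 + ‖x‖)) ^ ((N : ℝ) + 2 * s) ≤
        ((1 + 1⁻¹) * (1 + r)) ^ ((N : ℝ) + 2 * s) :=
      Real.rpow_le_rpow (by positivity) (by gcongr) (by positivity)
    have h4 : 0 ≤ (1 + ‖y‖) ^ (-((N : ℝ) + 2 * s)) := by positivity
    rw [norm_mul, Real.norm_of_nonneg h4]
    have h5 := h2.trans (mul_le_mul_of_nonneg_right h3 h4)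
    have h6 := mul_le_mul_of_nonneg_left h5 (norm_nonneg (f y))
    have h7 := mul_le_mul_of_nonneg_right h1 hK
    linarith
  · rw [integral_add (hIK.const_mul M) (hfi.norm.const_mul _).integrableOn, integral_const_mul,
      integral_const_mul, setIntegral_fracKernel hN hs x one_pos, ← hκ]
    have h1 : ∫ y in {y : RN N | 1 < ‖x - y‖}, ‖f y * (1 + ‖y‖) ^ (-((N : ℝ) + 2 * s))‖ ≤ J :=
      setIntegral_le_integral hfi.norm (Eventually.of_forall fun y => norm_nonneg _)
    gcongr
    have : 0 ≤ r := (norm_nonneg x).trans hx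
    positivity

theorem fracConst_pos (N : ℕ) {s : ℝ} (hs0 : 0 < s) (hs1 : s < 1) : 0 < fracConst N s := by
  have h1 : 0 < Real.Gamma (((N : ℝ) + 2 * s) / 2) := Real.Gamma_pos_of_pos (by positivity)
  have h2 : 0 < Real.Gamma (1 - s) := Real.Gamma_pos_of_pos (by linarith)
  have := Real.pi_pos
  unfold fracConst
  positivity

theorem HasFracLaplacianAt.tendsto_truncFracLap {N : ℕ} {s : ℝ} (hs0 : 0 < s) (hs1 : s < 1)
    {f : RN N → ℝ} {x : RN N} {L : ℝ} (h : HasFracLaplacianAt s f x L) :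
    Tendsto (fun ε => truncFracLap s ε f x) (𝓝[>] 0) (𝓝 (L / fracConst N s)) := by
  have hc := fracConst_pos N hs0 hs1
  have h2 := h.2.div_const (fracConst N s)
  refine h2.congr fun ε => ?_
  rw [mul_div_cancel_left₀ _ hc.ne']
  unfold truncFracLap fracKernel
  simp only [Real.rpow_neg (norm_nonneg _), div_eq_mul_inv]

/-! ### The differential inequality at fixed time -/

theorem hasCompactSupport_testFn {N : ℕ} (b : ℝ) {R : ℝ} (hR : 0 < R) :
    HasCompactSupport (testFn b R : RN N → ℝ) := by
  refine HasCompactSupport.intro (isCompact_closedBall (0 : RN N) (2 * R)) fun x hx => ?_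
  rw [mem_closedBall_zero_iff, not_le] at hx
  exact testFn_eq_zero b hR hx.le

/-- The truncated operator on the test functions. -/
theorem AdmissibleDecay.exists_neg_truncFracLap_testFn_le {N : ℕ} (hN : 1 ≤ N) {s b : ℝ}
    (hs0 : 0 < s) (hs1 : s < 1) (hb : 0 ≤ b) (hb' : b ≤ (N : ℝ) + 2 * s) {ρ : RN N → ℝ}
    (hρpos : ∀ x, 0 < ρ x) (h : AdmissibleDecay s b ρ) :
    ∃ C, 0 ≤ C ∧ ∃ D, 0 ≤ D ∧ ∀ R, 1 ≤ R → ∀ ε, 0 < ε → ε ≤ 1 / 4 → ∀ x,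
      -truncFracLap s ε (testFn b R) x ≤ C * (ρ x * testFn b R x) +
        D * ε ^ (2 - 2 * s) * (Metric.closedBall (0 : RN N) R).indicator (fun _ => 1) x +
        C * (Metric.closedBall (0 : RN N) R)ᶜ.indicator (fun x => (1 + ‖x‖) ^ (-b)) x := by
  obtain ⟨C1, hC1, D, hD, h1⟩ := h
  obtain ⟨C2, hC2, h2⟩ := exists_abs_truncFracLap_testFn_le hN hs0 hs1 hb hb'
  obtain ⟨C3, hC3, h3⟩ := exists_decayFn_le (N := N) hb
  refine ⟨C1 + C2, by positivity, D, hD, fun R hR ε hε hε4 x => ?_⟩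
  have hR0 : 0 < R := by linarith
  have hle1 : ∀ y : RN N, (1 + ‖y‖) ^ (-b) ≤ 1 := fun y =>
    Real.rpow_le_one_of_one_le_of_nonpos (by linarith [norm_nonneg y]) (by linarith)
  have hvC : ∀ y : RN N, |decayFn b y| ≤ C3 := fun y => by
    rw [abs_of_pos (decayFn_pos hb y)]
    exact (h3 y).trans (mul_le_of_le_one_right hC3 (hle1 y))
  have hφC : ∀ y : RN N, |testFn b R y| ≤ C3 := fun y => by
    rw [abs_of_nonneg (testFn_nonneg hb R y)]
    exact ((testFn_le hb R y).trans (le_abs_self _)).trans (hvC y)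
  have hρφ : 0 ≤ ρ x * testFn b R x := mul_nonneg (hρpos x).le (testFn_nonneg hb R x)
  by_cases hx : x ∈ Metric.closedBall (0 : RN N) R
  · rw [indicator_of_mem hx, indicator_of_notMem (by simpa using hx), mul_one, mul_zero, add_zero]
    rw [mem_closedBall_zero_iff] at hx
    -- The two functions agree at `x` and `testFn` is the smaller one elsewhere, so cutting off only
    -- improves the inequality.
    have h4 : truncFracLap s ε (decayFn b) x ≤ truncFracLap s ε (testFn b R) x := by
      refine integral_mono
        (integrableOn_sub_mul_fracKernel hN hs0 hε (continuous_decayFn b).measurable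
          (integrable_weight_of_bounded hs0 (continuous_decayFn b).measurable hvC) x)
        (integrableOn_sub_mul_fracKernel hN hs0 hε (continuous_testFn b R).measurable
          (integrable_weight_of_bounded hs0 (continuous_testFn b R).measurable hφC) x)
        fun y => mul_le_mul_of_nonneg_right ?_ (fracKernel_nonneg s _)
      rw [testFn_eq b hR0 hx]
      linarith [testFn_le hb R y]
    have h5 := h1 ε hε hε4 x
    rw [← testFn_eq b hR0 hx] at h5
    have := mul_nonneg hC2 hρφ
    linarith
  -- Outside the ball only the size bound, uniform in `R`, is used. The error in `ε` thus lives on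
  -- the ball, where `G(f)` is integrable without weight.
  · rw [indicator_of_notMem hx, indicator_of_mem (show x ∈ (Metric.closedBall (0 : RN N) R)ᶜ from hx),
      mul_zero, add_zero]
    have h4 := (neg_le_abs _).trans ((h2 ε hε (by linarith) x).2 R hR)
    have h5 : 0 ≤ C1 * (1 + ‖x‖) ^ (-b) := by positivity
    have h6 : 0 ≤ (C1 + C2) * (ρ x * testFn b R x) := by positivity
    linarith

/-- The energy inequality at a fixed time. -/
theorem integral_testFn_mul_le {N : ℕ} (hN : 1 ≤ N) {s b : ℝ}
    (hs0 : 0 < s) (hs1 : s < 1) (hb : 0 ≤ b) (hb' : b ≤ (N : ℝ) + 2 * s) {ρ : RN N → ℝ}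
    (hρ : Continuous ρ) {C D : ℝ} {R : ℝ} (hR : 1 ≤ R)
    (hφ : ∀ ε, 0 < ε → ε ≤ 1 / 4 → ∀ x : RN N,
      -truncFracLap s ε (testFn b R) x ≤ C * (ρ x * testFn b R x) +
        D * ε ^ (2 - 2 * s) * (Metric.closedBall (0 : RN N) R).indicator (fun _ => 1) x +
        C * (Metric.closedBall (0 : RN N) R)ᶜ.indicator (fun x => (1 + ‖x‖) ^ (-b)) x)
    {G G' : ℝ → ℝ} (hG : ∀ a c, G a - G c ≤ G' a * (a - c)) (hGc : Continuous G)
    (hG'c : Continuous G') (hG0 : ∀ a, 0 ≤ G a) {f : RN N → ℝ} (hf : Continuous f)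
    (hfL : MemLs s f) (hfr : FracRegular s f) {L : RN N → ℝ}
    (hL : ∀ x, HasFracLaplacianAt s f x (L x))
    (hw : Integrable fun x => G (f x) * (1 + ‖x‖) ^ (-b)) :
    ∫ x, testFn b R x * (G' (f x) * -L x) ≤ fracConst N s * (C *
      (∫ x, ρ x * testFn b R x * G (f x)) +
      C * ∫ x in (Metric.closedBall (0 : RN N) R)ᶜ, G (f x) * (1 + ‖x‖) ^ (-b)) := by
  have hR0 : 0 < R := by linarith
  have hc := fracConst_pos N hs0 hs1
  have hfi := hfL.integrable_weight hs0
  have hwm : Continuous fun x => G (f x) := hGc.comp hf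
  have hwi : Integrable fun x => G (f x) * (1 + ‖x‖) ^ (-((N : ℝ) + 2 * s)) := by
    refine hw.mono' (hwm.measurable.mul
      ((measurable_const.add measurable_norm).pow_const _)).aestronglyMeasurable
      (Eventually.of_forall fun x => ?_)
    rw [Real.norm_of_nonneg (mul_nonneg (hG0 _) (by positivity))]
    exact mul_le_mul_of_nonneg_left (Real.rpow_le_rpow_of_exponent_le
      (by linarith [norm_nonneg x]) (by linarith)) (hG0 _)
  have hφc := hasCompactSupport_testFn (N := N) b hR0
  have hφcont := continuous_testFn (N := N) b R
  -- A bound uniform in `ε` on the support of the test function dominates the passage to the limit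
  -- `ε → 0`.
  obtain ⟨M, hM⟩ := hfr.exists_abs_truncFracLap_le hN hs0 hf hfi (2 * R)
  have hcG : Continuous fun x => testFn b R x * G' (f x) := hφcont.mul (hG'c.comp hf)
  have hcGi : Integrable fun x => testFn b R x * G' (f x) :=
    hcG.integrable_of_hasCompactSupport hφc.mul_right
  have hmL : ∀ ε, Measurable (truncFracLap s ε f) := fun ε =>
    measurable_truncFracLap s ε hf.measurable
  have hbd : ∀ ε, 0 < ε → ε ≤ 1 → ∀ x, ‖testFn b R x * (G' (f x) * -truncFracLap s ε f x)‖ ≤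
      ‖testFn b R x * G' (f x)‖ * M := by
    intro ε hε hε1 x
    rw [← mul_assoc, norm_mul]
    rcases le_or_gt ‖x‖ (2 * R) with h | h
    · rw [norm_neg, Real.norm_eq_abs (truncFracLap s ε f x)]
      exact mul_le_mul_of_nonneg_left (hM ε hε hε1 x h) (norm_nonneg _)
    · rw [testFn_eq_zero b hR0 h.le]; simp
  have hmeas : ∀ ε, AEStronglyMeasurable
      (fun x => testFn b R x * (G' (f x) * -truncFracLap s ε f x)) volume := fun ε =>
    (hφcont.measurable.mul ((hG'c.comp hf).measurable.mul (hmL ε).neg)).aestronglyMeasurable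
  have hlim : Tendsto (fun ε => ∫ x, testFn b R x * (G' (f x) * -truncFracLap s ε f x)) (𝓝[>] 0)
      (𝓝 (∫ x, testFn b R x * (G' (f x) * -(L x / fracConst N s)))) := by
    refine tendsto_integral_filter_of_dominated_convergence
      (fun x => ‖testFn b R x * G' (f x)‖ * M) (Eventually.of_forall hmeas) ?_
      (hcGi.norm.mul_const M) (Eventually.of_forall fun x => ?_)
    · filter_upwards [Ioc_mem_nhdsGT (zero_lt_one (α := ℝ))] with ε hε
      exact Eventually.of_forall (hbd ε hε.1 hε.2)
    · exact (((hL x).tendsto_truncFracLap hs0 hs1).neg.const_mul _).const_mul _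
  have hball := measurableSet_closedBall (x := (0 : RN N)) (ε := R)
  have hwball : IntegrableOn (fun x => G (f x)) (Metric.closedBall (0 : RN N) R) :=
    hwm.continuousOn.integrableOn_compact (isCompact_closedBall 0 R)
  set I1 := ∫ x, ρ x * testFn b R x * G (f x) with hI1
  set I2 := ∫ x in Metric.closedBall (0 : RN N) R, G (f x) with hI2
  set I3 := ∫ x in (Metric.closedBall (0 : RN N) R)ᶜ, G (f x) * (1 + ‖x‖) ^ (-b) with hI3
  have hle : ∀ ε, 0 < ε → ε ≤ 1 / 4 →
      ∫ x, testFn b R x * (G' (f x) * -truncFracLap s ε f x) ≤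
        C * I1 + D * ε ^ (2 - 2 * s) * I2 + C * I3 := by
    intro ε hε hε4
    have hGe : Integrable fun x => testFn b R x * truncFracLap s ε (fun y => G (f y)) x := by
      have h1 := (integrable_prod_truncKernel_diag hs0 hε (hφcont.mul hwm)
        (hφc.mul_right (f' := fun x => G (f x)))).sub
        (integrable_prod_truncKernel hs0 hε hφcont hφc hwm.measurable hwi)
      refine h1.integral_prod_left.congr (Eventually.of_forall fun x => ?_)
      simp only
      rw [truncFracLap_eq_integral, ← integral_const_mul]
      refine integral_congr_ae (Eventually.of_forall fun y => ?_)
      simp only [Pi.sub_apply, Pi.mul_apply]; ring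
    have h1 : ∫ x, testFn b R x * (G' (f x) * -truncFracLap s ε f x) ≤
        -∫ x, testFn b R x * truncFracLap s ε (fun y => G (f y)) x := by
      rw [← integral_neg]
      refine integral_mono ((hcGi.norm.mul_const M).mono' (hmeas ε)
        (Eventually.of_forall (hbd ε hε (by linarith)))) hGe.neg fun x => ?_
      have := mul_le_mul_of_nonneg_left
        (truncFracLap_comp_le hN hs0 hε hG hf.measurable hfi hwm.measurable hwi x)
        (testFn_nonneg hb R x)
      show _ ≤ -(testFn b R x * truncFracLap s ε (fun y => G (f y)) x)
      linarith
    -- After convexity has replaced `f` by `G(f)`, the operator moves onto the test function, where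
    -- the supersolution bound applies against `G(f) ≥ 0`.
    rw [integral_mul_truncFracLap_comm hs0 hε hφcont hφc hwm hwi] at h1
    refine h1.trans ?_
    rw [← integral_neg]
    have j1 : Integrable fun x => ρ x * testFn b R x * G (f x) :=
      ((hρ.mul hφcont).mul hwm).integrable_of_hasCompactSupport hφc.mul_left.mul_right
    have j2 := (integrable_indicator_iff hball).2 hwball
    have j3 := (integrable_indicator_iff hball.compl).2 hw.integrableOn
    have j12 : Integrable fun x => C * (ρ x * testFn b R x * G (f x)) + D * ε ^ (2 - 2 * s) *
        (Metric.closedBall (0 : RN N) R).indicator (fun x => G (f x)) x :=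
      (j1.const_mul _).add (j2.const_mul _)
    have e : C * I1 + D * ε ^ (2 - 2 * s) * I2 + C * I3 =
        ∫ x, (C * (ρ x * testFn b R x * G (f x)) + D * ε ^ (2 - 2 * s) *
          (Metric.closedBall (0 : RN N) R).indicator (fun x => G (f x)) x +
          C * (Metric.closedBall (0 : RN N) R)ᶜ.indicator
            (fun x => G (f x) * (1 + ‖x‖) ^ (-b)) x) := by
      rw [integral_add j12 (j3.const_mul _),
        integral_add (j1.const_mul _) (j2.const_mul _), integral_const_mul, integral_const_mul,
        integral_const_mul, integral_indicator hball, integral_indicator hball.compl]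
    rw [e]
    have hint : Integrable fun x => G (f x) * truncFracLap s ε (testFn b R) x := by
      have h1 := (integrable_prod_truncKernel_diag hs0 hε (hφcont.mul hwm)
        (hφc.mul_right (f' := fun x => G (f x)))).sub
        (integrable_prod_truncKernel hs0 hε hφcont hφc hwm.measurable hwi).swap
      refine h1.integral_prod_left.congr (Eventually.of_forall fun x => ?_)
      simp only
      rw [truncFracLap_eq_integral, ← integral_const_mul]
      refine integral_congr_ae (Eventually.of_forall fun y => ?_)
      simp only [Pi.sub_apply, Pi.mul_apply, Function.comp_apply, Prod.swap_prod_mk,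
        truncKernel_swap s ε x y]
      ring
    refine integral_mono hint.neg (j12.add (j3.const_mul _))
      fun x => ?_
    have h2 := mul_le_mul_of_nonneg_left (hφ ε hε hε4 x) (hG0 (f x))
    simp only [indicator] at h2 ⊢
    show -(G (f x) * truncFracLap s ε (testFn b R) x) ≤ _
    refine le_trans (le_of_eq (by ring)) (h2.trans (le_of_eq ?_))
    split_ifs <;> ring
  have hlim2 : Tendsto (fun ε : ℝ => C * I1 + D * ε ^ (2 - 2 * s) * I2 + C * I3) (𝓝[>] 0)
      (𝓝 (C * I1 + D * 0 * I2 + C * I3)) := by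
    have h0 : Tendsto (fun ε : ℝ => ε ^ (2 - 2 * s)) (𝓝[>] 0) (𝓝 0) := by
      have := (Real.continuousAt_rpow_const 0 (2 - 2 * s) (Or.inr (by linarith))).tendsto
      rw [Real.zero_rpow (by linarith)] at this
      exact this.mono_left nhdsWithin_le_nhds
    exact (((h0.const_mul D).mul_const I2).const_add _).add_const _
  have hfin := le_of_tendsto_of_tendsto hlim hlim2 (by
    filter_upwards [Ioc_mem_nhdsGT (by norm_num : (0 : ℝ) < 1 / 4)] with ε hε
    exact hle ε hε.1 hε.2)
  have e : ∫ x, testFn b R x * (G' (f x) * -(L x / fracConst N s)) =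
      (∫ x, testFn b R x * (G' (f x) * -L x)) / fracConst N s := by
    rw [← integral_div]
    congr 1; ext x; ring
  rw [e, div_le_iff₀ hc] at hfin
  linarith

/-! ### Integration in time -/

section TimeIntegration

variable {N : ℕ} {s T : ℝ} {ρ : RN N → ℝ} {u : RN N → ℝ → ℝ}

theorem IsCauchySolution.continuous_slice (hu : IsCauchySolution s T ρ u) {t : ℝ}
    (ht : t ∈ Ioc 0 T) : Continuous fun x => u x t :=
  hu.isEquationSolution.continuousOn.comp_continuous (by fun_prop : Continuous fun x => (x, t))
    fun _ => ⟨mem_univ _, ht⟩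

theorem IsCauchySolution.continuousOn_path (hu : IsCauchySolution s T ρ u) (x : RN N) :
    ContinuousOn (u x) (Icc 0 T) :=
  hu.continuousOn_closed.comp (f := fun t : ℝ => (x, t)) (by fun_prop)
    fun _ ht => ⟨mem_univ _, ht⟩

theorem IsCauchySolution.hasDerivAt (hu : IsCauchySolution s T ρ u) (x : RN N) {t : ℝ}
    (ht : t ∈ Ioo 0 T) : HasDerivAt (u x) (timeDeriv T u x t) t :=
  ((hu.isEquationSolution.differentiableOn x t (Ioo_subset_Ioc_self ht)).hasDerivWithinAt).hasDerivAt
    (Ioc_mem_nhds ht.1 ht.2)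

/-- The time derivative of `e^{-Λt} G(u)`. -/
noncomputable def dampedDeriv (T Λ : ℝ) (G G' : ℝ → ℝ) (u : RN N → ℝ → ℝ) (x : RN N) (t : ℝ) : ℝ :=
  Real.exp (-(Λ * t)) * (G' (u x t) * timeDeriv T u x t - Λ * G (u x t))

theorem IsCauchySolution.continuousOn_dampedDeriv (hu : IsCauchySolution s T ρ u) (Λ : ℝ)
    {G G' : ℝ → ℝ} (hGc : Continuous G) (hG'c : Continuous G') :
    ContinuousOn (fun z : RN N × ℝ => dampedDeriv T Λ G G' u z.1 z.2) (slab N T) := by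
  have h1 := hu.isEquationSolution.continuousOn
  have h2 := hu.isEquationSolution.continuousOn_timeDeriv
  unfold dampedDeriv
  refine ContinuousOn.mul (by fun_prop) (((hG'c.comp_continuousOn h1).mul h2).sub
    ((hGc.comp_continuousOn h1).const_mul Λ))

/-- The lower endpoint stays positive because the time derivative is continuous only on `(0, T]`;
the initial time is reached afterwards by a limit. -/
theorem IsCauchySolution.integral_dampedDeriv (hu : IsCauchySolution s T ρ u) (Λ : ℝ)
    {G G' : ℝ → ℝ} (hGc : Continuous G) (hG'c : Continuous G')
    (hGd : ∀ a, HasDerivAt G (G' a) a) (x : RN N) {τ t : ℝ} (hτ : 0 < τ) (hτt : τ ≤ t)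
    (ht : t ≤ T) :
    ∫ r in Ioc τ t, dampedDeriv T Λ G G' u x r =
      Real.exp (-(Λ * t)) * G (u x t) - Real.exp (-(Λ * τ)) * G (u x τ) := by
  have hsub : Icc τ t ⊆ Ioc 0 T := fun r hr => ⟨hτ.trans_le hr.1, hr.2.trans ht⟩
  have hc : ContinuousOn (dampedDeriv T Λ G G' u x) (Icc τ t) :=
    (hu.continuousOn_dampedDeriv Λ hGc hG'c).comp (f := fun r : ℝ => (x, r)) (by fun_prop)
      fun r hr => ⟨mem_univ _, hsub hr⟩
  rw [← intervalIntegral.integral_of_le hτt]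
  refine intervalIntegral.integral_eq_sub_of_hasDerivAt_of_le
    (f := fun r => Real.exp (-(Λ * r)) * G (u x r)) hτt ?_ (fun r hr => ?_) ?_
  · refine ContinuousOn.mul (by fun_prop) (hGc.comp_continuousOn ?_)
    exact (hu.continuousOn_path x).mono fun r hr => Ioc_subset_Icc_self (hsub hr)
  · have h1 := hu.hasDerivAt x (t := r) ⟨hτ.trans hr.1, hr.2.trans_le ht⟩
    have h2 : HasDerivAt (fun r => Real.exp (-(Λ * r))) (Real.exp (-(Λ * r)) * -(Λ * 1)) r :=
      ((hasDerivAt_id r).const_mul Λ).neg.exp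
    refine (h2.mul ((hGd (u x r)).comp r h1)).congr_deriv ?_
    unfold dampedDeriv
    simp only [Function.comp_apply]
    ring
  · exact (hc.mono (by rw [uIcc_of_le hτt])).intervalIntegrable

end TimeIntegration

/-- The inequality satisfied by the weighted integral of `G(u)` on a time interval `[τ, t]`. -/
theorem IsCauchySolution.integral_testFn_sub_le {N : ℕ} {s T b : ℝ} {ρ : RN N → ℝ}
    {u : RN N → ℝ → ℝ} (hN : 1 ≤ N) (hs0 : 0 < s) (hs1 : s < 1) (hb : 0 ≤ b)
    (hb' : b ≤ (N : ℝ) + 2 * s) (hρ : Continuous ρ) (hu : IsCauchySolution s T ρ u)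
    {C D R : ℝ} (hC : 0 ≤ C) (hR : 1 ≤ R)
    (hφ : ∀ ε, 0 < ε → ε ≤ 1 / 4 → ∀ x : RN N,
      -truncFracLap s ε (testFn b R) x ≤ C * (ρ x * testFn b R x) +
        D * ε ^ (2 - 2 * s) * (Metric.closedBall (0 : RN N) R).indicator (fun _ => 1) x +
        C * (Metric.closedBall (0 : RN N) R)ᶜ.indicator (fun x => (1 + ‖x‖) ^ (-b)) x)
    {G G' : ℝ → ℝ} (hG : ∀ a c, G a - G c ≤ G' a * (a - c)) (hGc : Continuous G)
    (hG'c : Continuous G') (hGd : ∀ a, HasDerivAt G (G' a) a) (hG0 : ∀ a, 0 ≤ G a)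
    (hw : IntegrableOn (fun z : RN N × ℝ => G (u z.1 z.2) * (1 + ‖z.1‖) ^ (-b)) (slab N T))
    {τ t : ℝ} (hτ : 0 < τ) (hτt : τ ≤ t) (ht : t ≤ T) :
    ∫ x, ρ x * testFn b R x * (Real.exp (-(fracConst N s * C * t)) * G (u x t) -
        Real.exp (-(fracConst N s * C * τ)) * G (u x τ)) ≤
      fracConst N s * C * ∫ z in (Metric.closedBall (0 : RN N) R)ᶜ ×ˢ Ioc 0 T,
        G (u z.1 z.2) * (1 + ‖z.1‖) ^ (-b) := by
  have hR0 : 0 < R := by linarith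
  have hc := fracConst_pos N hs0 hs1
  -- The damping rate is chosen so that the term `C ∫ ρ φ G(u)` of the energy inequality cancels;
  -- this replaces Gronwall's lemma.
  set Λ := fracConst N s * C with hΛ
  have hΛ0 : 0 ≤ Λ := by positivity
  set K := Metric.closedBall (0 : RN N) (2 * R) with hK
  have hsupp : ∀ x, x ∉ K → testFn b R x = 0 := fun x hx => by
    rw [hK, mem_closedBall_zero_iff, not_le] at hx
    exact testFn_eq_zero b hR0 hx.le
  have hφcont := continuous_testFn (N := N) b R
  have hφc := hasCompactSupport_testFn (N := N) b hR0
  have hsub : Icc τ t ⊆ Ioc 0 T := fun r hr => ⟨hτ.trans_le hr.1, hr.2.trans ht⟩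
  have hsub' : Ioc τ t ⊆ Ioc 0 T := Ioc_subset_Icc_self.trans hsub
  have hVc : ContinuousOn (fun z : RN N × ℝ => ρ z.1 * testFn b R z.1 *
      dampedDeriv T Λ G G' u z.1 z.2) (K ×ˢ Icc τ t) := by
    refine ContinuousOn.mul (by fun_prop) ((hu.continuousOn_dampedDeriv Λ hGc hG'c).mono ?_)
    exact prod_mono (subset_univ _) hsub
  have hVi : Integrable (fun z : RN N × ℝ => ρ z.1 * testFn b R z.1 *
      dampedDeriv T Λ G G' u z.1 z.2) ((volume.restrict K).prod (volume.restrict (Ioc τ t))) := by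
    rw [Measure.prod_restrict]
    exact (hVc.integrableOn_compact ((isCompact_closedBall 0 _).prod isCompact_Icc)).mono_set
      (prod_mono subset_rfl Ioc_subset_Icc_self)
  -- the left-hand side as a space-time integral
  have hleft : ∫ x, ρ x * testFn b R x * (Real.exp (-(Λ * t)) * G (u x t) -
      Real.exp (-(Λ * τ)) * G (u x τ)) =
      ∫ r in Ioc τ t, ∫ x in K, ρ x * testFn b R x * dampedDeriv T Λ G G' u x r := by
    rw [← integral_integral_swap hVi, ← setIntegral_eq_integral_of_forall_compl_eq_zero (s := K)
      (fun x hx => by rw [hsupp x hx]; ring)]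
    congr 1; ext x
    rw [integral_const_mul, hu.integral_dampedDeriv Λ hGc hG'c hGd x hτ hτt ht]
  -- slices of the weighted function
  set B := (Metric.closedBall (0 : RN N) R)ᶜ with hB
  have hBm : MeasurableSet B := measurableSet_closedBall.compl
  have hw1 : Integrable (fun z : RN N × ℝ => G (u z.1 z.2) * (1 + ‖z.1‖) ^ (-b))
      (volume.prod (volume.restrict (Ioc 0 T))) := by
    have : (volume : Measure (RN N)).prod (volume.restrict (Ioc (0 : ℝ) T)) =
        (volume : Measure (RN N × ℝ)).restrict (slab N T) := by
      rw [slab, Measure.volume_eq_prod, ← Measure.prod_restrict, Measure.restrict_univ]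
    rw [this]; exact hw
  have hw2 : Integrable (fun z : RN N × ℝ => G (u z.1 z.2) * (1 + ‖z.1‖) ^ (-b))
      ((volume.restrict B).prod (volume.restrict (Ioc 0 T))) := by
    rw [Measure.prod_restrict]
    exact hw.mono_set (prod_mono (subset_univ _) subset_rfl)
  have hE : IntegrableOn (fun r => ∫ x in B, G (u x r) * (1 + ‖x‖) ^ (-b)) (Ioc 0 T) :=
    hw2.integral_prod_right
  have hEint : ∫ r in Ioc 0 T, ∫ x in B, G (u x r) * (1 + ‖x‖) ^ (-b) =
      ∫ z in B ×ˢ Ioc 0 T, G (u z.1 z.2) * (1 + ‖z.1‖) ^ (-b) := by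
    rw [Measure.volume_eq_prod, ← Measure.prod_restrict, integral_prod_symm _ hw2]
  have hE0 : ∀ r, 0 ≤ ∫ x in B, G (u x r) * (1 + ‖x‖) ^ (-b) := fun r =>
    integral_nonneg fun x => mul_nonneg (hG0 _) (by positivity)
  rw [hleft, ← hEint, ← integral_const_mul]
  refine le_trans (integral_mono_ae hVi.integral_prod_right
    ((hE.mono_set hsub').const_mul Λ) ?_)
    (setIntegral_mono_set (hE.const_mul Λ) (Eventually.of_forall fun r =>
      mul_nonneg hΛ0 (hE0 r)) hsub'.eventuallyLE)
  -- The weighted integrability is assumed only in space-time, so the fixed-time inequality is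
  -- applied at almost every time.
  have hslice : ∀ᵐ r ∂volume.restrict (Ioc τ t),
      Integrable fun x => G (u x r) * (1 + ‖x‖) ^ (-b) :=
    ae_restrict_of_ae_restrict_of_subset hsub' hw1.prod_left_ae
  filter_upwards [hslice, ae_restrict_mem measurableSet_Ioc] with r hr hrmem
  have hr0 : r ∈ Ioc 0 T := hsub' hrmem
  choose L hL hLeq using fun x => hu.isEquationSolution.equation x r hr0
  have hmain := integral_testFn_mul_le hN hs0 hs1 hb hb' hρ hR hφ hG hGc hG'c hG0
    (hu.continuous_slice hr0) (hu.isEquationSolution.memLs r hr0)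
    (hu.isEquationSolution.regular r hr0) hL hr
  have hcs : Continuous fun x => timeDeriv T u x r :=
    hu.isEquationSolution.continuousOn_timeDeriv.comp_continuous
      (by fun_prop : Continuous fun x => (x, r)) fun _ => ⟨mem_univ _, hr0⟩
  have hus := hu.continuous_slice hr0
  have i1 : Integrable fun x => testFn b R x * (G' (u x r) * -L x) := by
    have e : ∀ x, -L x = ρ x * timeDeriv T u x r := fun x => by linarith [hLeq x]
    simp only [e]
    exact (hφcont.mul ((hG'c.comp hus).mul (hρ.mul hcs))).integrable_of_hasCompactSupport
      hφc.mul_right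
  have i2 : Integrable fun x => ρ x * testFn b R x * G (u x r) :=
    ((hρ.mul hφcont).mul (hGc.comp hus)).integrable_of_hasCompactSupport hφc.mul_left.mul_right
  have e : ∫ x in K, ρ x * testFn b R x * dampedDeriv T Λ G G' u x r =
      Real.exp (-(Λ * r)) * ((∫ x, testFn b R x * (G' (u x r) * -L x)) -
        Λ * ∫ x, ρ x * testFn b R x * G (u x r)) := by
    rw [setIntegral_eq_integral_of_forall_compl_eq_zero (fun x hx => by rw [hsupp x hx]; ring),
      ← integral_const_mul, ← integral_sub i1 (i2.const_mul Λ), ← integral_const_mul]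
    congr 1; ext x
    have : -L x = ρ x * timeDeriv T u x r := by linarith [hLeq x]
    rw [this]; unfold dampedDeriv; ring
  show ∫ x in K, ρ x * testFn b R x * dampedDeriv T Λ G G' u x r ≤ _
  rw [e]
  have hexp : Real.exp (-(Λ * r)) ≤ 1 := by
    rw [Real.exp_le_one_iff]
    have := mul_nonneg hΛ0 hr0.1.le
    linarith
  have h1 : (∫ x, testFn b R x * (G' (u x r) * -L x)) -
      Λ * ∫ x, ρ x * testFn b R x * G (u x r) ≤
      Λ * ∫ x in B, G (u x r) * (1 + ‖x‖) ^ (-b) := by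
    rw [hΛ]; linarith
  refine (mul_le_mul_of_nonneg_left h1 (Real.exp_pos _).le).trans ?_
  exact mul_le_of_le_one_left (mul_nonneg hΛ0 (hE0 r)) hexp

/-- The inequality of `IsCauchySolution.integral_testFn_sub_le`, from the initial time on. -/
theorem IsCauchySolution.integral_testFn_le {N : ℕ} {s T b : ℝ} {ρ : RN N → ℝ}
    {u : RN N → ℝ → ℝ} (hN : 1 ≤ N) (hs0 : 0 < s) (hs1 : s < 1) (hb : 0 ≤ b)
    (hb' : b ≤ (N : ℝ) + 2 * s) (hρ : Continuous ρ) (hu : IsCauchySolution s T ρ u)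
    {C D R : ℝ} (hC : 0 ≤ C) (hR : 1 ≤ R)
    (hφ : ∀ ε, 0 < ε → ε ≤ 1 / 4 → ∀ x : RN N,
      -truncFracLap s ε (testFn b R) x ≤ C * (ρ x * testFn b R x) +
        D * ε ^ (2 - 2 * s) * (Metric.closedBall (0 : RN N) R).indicator (fun _ => 1) x +
        C * (Metric.closedBall (0 : RN N) R)ᶜ.indicator (fun x => (1 + ‖x‖) ^ (-b)) x)
    {G G' : ℝ → ℝ} (hG : ∀ a c, G a - G c ≤ G' a * (a - c)) (hGc : Continuous G)
    (hG'c : Continuous G') (hGd : ∀ a, HasDerivAt G (G' a) a) (hG0 : ∀ a, 0 ≤ G a) (hG00 : G 0 = 0)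
    (hw : IntegrableOn (fun z : RN N × ℝ => G (u z.1 z.2) * (1 + ‖z.1‖) ^ (-b)) (slab N T))
    {t : ℝ} (ht : t ∈ Ioc 0 T) :
    ∫ x, ρ x * testFn b R x * (Real.exp (-(fracConst N s * C * t)) * G (u x t)) ≤
      fracConst N s * C * ∫ z in (Metric.closedBall (0 : RN N) R)ᶜ ×ˢ Ioc 0 T,
        G (u z.1 z.2) * (1 + ‖z.1‖) ^ (-b) := by
  have hR0 : 0 < R := by linarith
  have hc := fracConst_pos N hs0 hs1
  set Λ := fracConst N s * C with hΛ
  have hΛ0 : 0 ≤ Λ := by positivity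
  set K := Metric.closedBall (0 : RN N) (2 * R) with hK
  have hsupp : ∀ x, x ∉ K → testFn b R x = 0 := fun x hx => by
    rw [hK, mem_closedBall_zero_iff, not_le] at hx
    exact testFn_eq_zero b hR0 hx.le
  have hφcont := continuous_testFn (N := N) b R
  have hφc := hasCompactSupport_testFn (N := N) b hR0
  have hρφi : Integrable fun x => ρ x * testFn b R x :=
    (hρ.mul hφcont).integrable_of_hasCompactSupport hφc.mul_left
  have hsl : ∀ r ∈ Ioc 0 T, Continuous fun x => Real.exp (-(Λ * r)) * G (u x r) := fun r hr =>
    (hGc.comp (hu.continuous_slice hr)).const_mul _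
  have hint : ∀ r ∈ Ioc 0 T, Integrable fun x =>
      ρ x * testFn b R x * (Real.exp (-(Λ * r)) * G (u x r)) := fun r hr =>
    ((hρ.mul hφcont).mul (hsl r hr)).integrable_of_hasCompactSupport hφc.mul_left.mul_right
  obtain ⟨M, hM⟩ := ((isCompact_closedBall (0 : RN N) (2 * R)).prod
    (isCompact_Icc (a := (0 : ℝ)) (b := T))).exists_bound_of_continuousOn
    (f := fun z : RN N × ℝ => G (u z.1 z.2))
    (hGc.comp_continuousOn (hu.continuousOn_closed.mono (prod_mono (subset_univ _) subset_rfl)))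
  have hIoc : Ioc (0 : ℝ) t ∈ 𝓝[>] 0 := Ioc_mem_nhdsGT ht.1
  -- On the compact support, `G(u)` is bounded up to `t = 0` by continuity, so the initial integral
  -- tends to the one with `u(·, 0) = 0`.
  have hlim : Tendsto (fun τ => ∫ x, ρ x * testFn b R x * (Real.exp (-(Λ * τ)) * G (u x τ)))
      (𝓝[>] 0) (𝓝 (∫ x, ρ x * testFn b R x * (Real.exp (-(Λ * 0)) * G (u x 0)))) := by
    refine tendsto_integral_filter_of_dominated_convergence (fun x => ‖ρ x * testFn b R x‖ * M)
      ?_ ?_ (hρφi.norm.mul_const M) (Eventually.of_forall fun x => ?_)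
    · filter_upwards [hIoc] with τ hτ
      exact (hint τ ⟨hτ.1, hτ.2.trans ht.2⟩).aestronglyMeasurable
    · filter_upwards [hIoc] with τ hτ
      refine Eventually.of_forall fun x => ?_
      rw [norm_mul]
      by_cases hx : x ∈ K
      · refine mul_le_mul_of_nonneg_left ?_ (norm_nonneg _)
        have h1 := hM (x, τ) ⟨hx, hτ.1.le, hτ.2.trans ht.2⟩
        rw [norm_mul, Real.norm_of_nonneg (Real.exp_pos _).le]
        refine (mul_le_of_le_one_left (norm_nonneg _) ?_).trans h1
        rw [Real.exp_le_one_iff]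
        have := mul_nonneg hΛ0 hτ.1.le
        linarith
      · rw [hsupp x hx]; simp
    · refine Tendsto.const_mul _ ?_
      have hcw : ContinuousWithinAt (fun τ => Real.exp (-(Λ * τ)) * G (u x τ)) (Icc 0 T) 0 := by
        refine ContinuousWithinAt.mul (by fun_prop) ?_
        exact (hGc.comp_continuousOn (hu.continuousOn_path x)) 0 ⟨le_rfl, ht.1.le.trans ht.2⟩
      refine hcw.tendsto.mono_left ?_
      rw [← nhdsWithin_Ioc_eq_nhdsGT (ht.1.trans_le ht.2)]
      exact nhdsWithin_mono _ Ioc_subset_Icc_self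
  simp only [hu.initial, hG00, mul_zero, integral_zero] at hlim
  refine le_of_tendsto (f := fun τ => (∫ x, ρ x * testFn b R x *
    (Real.exp (-(Λ * t)) * G (u x t))) -
      ∫ x, ρ x * testFn b R x * (Real.exp (-(Λ * τ)) * G (u x τ))) (x := 𝓝[>] 0) ?_ ?_
  · simpa using hlim.const_sub
      (∫ x, ρ x * testFn b R x * (Real.exp (-(Λ * t)) * G (u x t)))
  · filter_upwards [hIoc] with τ hτ
    have := hu.integral_testFn_sub_le hN hs0 hs1 hb hb' hρ hC hR hφ hG hGc hG'c hGd hG0 hw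
      hτ.1 hτ.2 ht.2
    rw [← integral_sub (hint t ht) (hint τ ⟨hτ.1, hτ.2.trans ht.2⟩)]
    simp only [← mul_sub]
    exact this

/-- Uniqueness for convex functions of the solution that are integrable against an admissible
weight. -/
theorem IsCauchySolution.comp_eq_zero {N : ℕ} {s T b : ℝ} {ρ : RN N → ℝ}
    {u : RN N → ℝ → ℝ} (hN : 1 ≤ N) (hs0 : 0 < s) (hs1 : s < 1) (hb : 0 ≤ b)
    (hb' : b ≤ (N : ℝ) + 2 * s) (hρ : Continuous ρ) (hρpos : ∀ x, 0 < ρ x)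
    (hu : IsCauchySolution s T ρ u) (hadm : AdmissibleDecay s b ρ)
    {G G' : ℝ → ℝ} (hG : ∀ a c, G a - G c ≤ G' a * (a - c)) (hGc : Continuous G)
    (hG'c : Continuous G') (hGd : ∀ a, HasDerivAt G (G' a) a) (hG0 : ∀ a, 0 ≤ G a) (hG00 : G 0 = 0)
    (hw : IntegrableOn (fun z : RN N × ℝ => G (u z.1 z.2) * (1 + ‖z.1‖) ^ (-b)) (slab N T))
    (x₀ : RN N) {t : ℝ} (ht : t ∈ Ioc 0 T) : G (u x₀ t) = 0 := by
  obtain ⟨C, hC, D, -, hφ⟩ :=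
    hadm.exists_neg_truncFracLap_testFn_le hN hs0 hs1 hb hb' hρpos
  set Λ := fracConst N s * C with hΛ
  set tail : ℕ → ℝ := fun n => ∫ z in (Metric.closedBall (0 : RN N) n)ᶜ ×ˢ Ioc 0 T,
    G (u z.1 z.2) * (1 + ‖z.1‖) ^ (-b) with htail
  have htail0 : Tendsto tail atTop (𝓝 0) := by
    have h := tendsto_setIntegral_of_antitone (μ := volume)
      (s := fun n : ℕ => (Metric.closedBall (0 : RN N) n)ᶜ ×ˢ Ioc 0 T)
      (f := fun z : RN N × ℝ => G (u z.1 z.2) * (1 + ‖z.1‖) ^ (-b))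
      (fun n => measurableSet_closedBall.compl.prod measurableSet_Ioc)
      (fun m n hmn => prod_mono (compl_subset_compl.2
        (Metric.closedBall_subset_closedBall (by exact_mod_cast hmn))) subset_rfl)
      ⟨0, hw.mono_set (prod_mono (subset_univ _) subset_rfl)⟩
    have he : ⋂ n : ℕ, (Metric.closedBall (0 : RN N) n)ᶜ ×ˢ Ioc (0 : ℝ) T = ∅ := by
      rw [eq_empty_iff_forall_notMem]
      intro z hz
      obtain ⟨n, hn⟩ := exists_nat_ge ‖z.1‖
      have := (mem_iInter.1 hz n).1
      exact this (mem_closedBall_zero_iff.2 hn)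
    rw [he, setIntegral_empty] at h
    exact h
  set W : RN N → ℝ := fun x => Real.exp (-(Λ * t)) * G (u x t) with hW
  have hW0 : ∀ x, 0 ≤ W x := fun x => mul_nonneg (Real.exp_pos _).le (hG0 _)
  have hWc : Continuous W := (hGc.comp (hu.continuous_slice ht)).const_mul _
  set R₀ := ‖x₀‖ + 1 with hR₀
  have hR₀1 : 1 ≤ R₀ := by rw [hR₀]; linarith [norm_nonneg x₀]
  have hcont : ∀ R, Continuous fun x => ρ x * testFn b R x * W x := fun R =>
    (hρ.mul (continuous_testFn b R)).mul hWc
  have hcs : ∀ R, 0 < R → HasCompactSupport fun x => ρ x * testFn b R x * W x := fun R hR =>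
    (hasCompactSupport_testFn b hR).mul_left.mul_right
  have hnn : ∀ R x, 0 ≤ ρ x * testFn b R x * W x := fun R x =>
    mul_nonneg (mul_nonneg (hρpos x).le (testFn_nonneg hb R x)) (hW0 x)
  -- For `n ≥ 2 R₀` the test function of radius `n` equals `v` on the support of the one of radius
  -- `R₀`, hence dominates it, and the bound by the tail tends to `0`.
  have hle : ∫ x, ρ x * testFn b R₀ x * W x ≤ 0 := by
    have hlim := htail0.const_mul Λ
    rw [mul_zero] at hlim
    refine ge_of_tendsto hlim ?_
    obtain ⟨n₀, hn₀⟩ := exists_nat_ge (2 * R₀)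
    filter_upwards [eventually_ge_atTop n₀] with n hn
    have hn1 : 2 * R₀ ≤ (n : ℝ) := hn₀.trans (by exact_mod_cast hn)
    have hn2 : (1 : ℝ) ≤ n := by linarith
    refine le_trans (integral_mono ((hcont R₀).integrable_of_hasCompactSupport
      (hcs R₀ (by linarith))) ((hcont n).integrable_of_hasCompactSupport
      (hcs n (by linarith))) fun x => ?_)
      (hu.integral_testFn_le hN hs0 hs1 hb hb' hρ hC hn2 (hφ n hn2) hG hGc hG'c hGd hG0 hG00 hw ht)
    refine mul_le_mul_of_nonneg_right (mul_le_mul_of_nonneg_left ?_ (hρpos x).le) (hW0 x)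
    rcases le_total ‖x‖ n with h | h
    · rw [testFn_eq b (by linarith : (0 : ℝ) < n) h]
      exact testFn_le hb R₀ x
    · rw [testFn_eq_zero b (by linarith : 0 < R₀) (hn1.trans h)]
      exact testFn_nonneg hb _ x
  by_contra hne
  have hWx : ρ x₀ * testFn b R₀ x₀ * W x₀ ≠ 0 := by
    rw [testFn_eq b (by linarith) (by rw [hR₀]; linarith)]
    exact mul_ne_zero (mul_ne_zero (hρpos x₀).ne' (decayFn_pos hb x₀).ne')
      (mul_ne_zero (Real.exp_pos _).ne' hne)
  have := (hcont R₀).integral_pos_of_hasCompactSupport_nonneg_nonzero (μ := volume)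
    (hcs R₀ (by linarith)) (hnn R₀) hWx
  linarith

/-! ### A convex minorant of `|a|^p` -/

/-- `(√(1 + a²) - 1)^p`, a convex `C¹` function below `|a|^p`. -/
noncomputable def smoothPow (p a : ℝ) : ℝ := (√(1 + a ^ 2) - 1) ^ p

/-- The derivative of `smoothPow p`. -/
noncomputable def smoothPowDeriv (p a : ℝ) : ℝ :=
  p * (√(1 + a ^ 2) - 1) ^ (p - 1) * (a / √(1 + a ^ 2))

theorem one_le_sqrt_one_add_sq (a : ℝ) : 1 ≤ √(1 + a ^ 2) :=
  Real.one_le_sqrt.2 (by nlinarith [sq_nonneg a])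

theorem smoothPow_nonneg (p a : ℝ) : 0 ≤ smoothPow p a :=
  Real.rpow_nonneg (by linarith [one_le_sqrt_one_add_sq a]) _

theorem smoothPow_zero {p : ℝ} (hp : 1 ≤ p) : smoothPow p 0 = 0 := by
  unfold smoothPow
  simp [Real.zero_rpow (by linarith : p ≠ 0)]

theorem eq_zero_of_smoothPow_eq_zero {p a : ℝ} (h : smoothPow p a = 0) : a = 0 := by
  unfold smoothPow at h
  rw [Real.rpow_eq_zero_iff_of_nonneg (by linarith [one_le_sqrt_one_add_sq a])] at h
  have h1 : √(1 + a ^ 2) = 1 := by linarith [h.1]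
  rw [Real.sqrt_eq_one] at h1
  exact pow_eq_zero_iff two_ne_zero |>.1 (by linarith)

theorem smoothPow_le {p : ℝ} (hp : 1 ≤ p) (a : ℝ) : smoothPow p a ≤ |a| ^ p := by
  refine Real.rpow_le_rpow (by linarith [one_le_sqrt_one_add_sq a]) ?_ (by linarith)
  have : √(1 + a ^ 2) ≤ 1 + |a| := by
    rw [Real.sqrt_le_left (by positivity)]
    nlinarith [abs_nonneg a, sq_abs a]
  linarith

theorem continuous_smoothPow {p : ℝ} (hp : 1 ≤ p) : Continuous (smoothPow p) := by
  unfold smoothPow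
  exact Continuous.rpow_const (by fun_prop) fun a => Or.inr (by linarith)

theorem continuous_smoothPowDeriv {p : ℝ} (hp : 1 ≤ p) : Continuous (smoothPowDeriv p) := by
  unfold smoothPowDeriv
  refine (continuous_const.mul (Continuous.rpow_const (by fun_prop) fun a => Or.inr
    (by linarith))).mul (continuous_id.div (by fun_prop) fun a => ?_)
  have := one_le_sqrt_one_add_sq a
  exact (by linarith : (0 : ℝ) < √(1 + a ^ 2)).ne'

theorem hasDerivAt_smoothPow {p : ℝ} (hp : 1 ≤ p) (a : ℝ) :
    HasDerivAt (smoothPow p) (smoothPowDeriv p a) a := by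
  have h1 : HasDerivAt (fun a : ℝ => 1 + a ^ 2) (2 * a) a := by
    simpa using (hasDerivAt_pow 2 a).const_add 1
  have h2 := (h1.sqrt (by positivity)).sub_const 1
  refine (h2.rpow_const (p := p) (Or.inr hp)).congr_deriv ?_
  unfold smoothPowDeriv
  have := one_le_sqrt_one_add_sq a
  have : 0 < √(1 + a ^ 2) := by linarith
  field_simp

/-- Bernoulli's inequality for `r' / r`. At `r = 0` with `p = 1` the convention `0^0 = 1` gives the
right slope. -/
theorem rpow_tangent_le {p r r' : ℝ} (hp : 1 ≤ p) (hr : 0 ≤ r) (hr' : 0 ≤ r') :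
    r ^ p - r' ^ p ≤ p * r ^ (p - 1) * (r - r') := by
  rcases hr.eq_or_lt with rfl | hr0
  · rw [Real.zero_rpow (by linarith)]
    rcases hp.eq_or_lt with rfl | hp1
    · simp
    · rw [Real.zero_rpow (by linarith)]
      have := Real.rpow_nonneg hr' p
      linarith
  · have h := one_add_mul_self_le_rpow_one_add (s := r' / r - 1)
      (by have := div_nonneg hr' hr; linarith) hp
    rw [add_sub_cancel, Real.div_rpow hr' hr, le_div_iff₀ (by positivity)] at h
    have e : r ^ (p - 1) = r ^ p / r := Real.rpow_sub_one hr0.ne' p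
    rw [e]
    have e2 : (1 + p * (r' / r - 1)) * r ^ p = r ^ p - p * (r ^ p / r) * (r - r') := by
      field_simp; ring
    linarith

/-- A nondecreasing convex power of a convex function. Convexity of `√(1 + a²)` is the
Cauchy–Schwarz inequality for `(1, a)` and `(1, c)`. -/
theorem smoothPow_tangent_le {p : ℝ} (hp : 1 ≤ p) (a c : ℝ) :
    smoothPow p a - smoothPow p c ≤ smoothPowDeriv p a * (a - c) := by
  have ha := one_le_sqrt_one_add_sq a
  have hc := one_le_sqrt_one_add_sq c
  have h1 := rpow_tangent_le hp (by linarith : 0 ≤ √(1 + a ^ 2) - 1)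
    (by linarith : 0 ≤ √(1 + c ^ 2) - 1)
  have hprod : 1 + a * c ≤ √(1 + a ^ 2) * √(1 + c ^ 2) := by
    rw [← Real.sqrt_mul (by positivity)]
    exact Real.le_sqrt_of_sq_le (by nlinarith [sq_nonneg (a - c)])
  have h2 : √(1 + a ^ 2) - √(1 + c ^ 2) ≤ a / √(1 + a ^ 2) * (a - c) := by
    rw [div_mul_eq_mul_div, le_div_iff₀ (by linarith)]
    have := Real.mul_self_sqrt (by positivity : 0 ≤ 1 + a ^ 2)
    nlinarith
  have h3 : 0 ≤ p * (√(1 + a ^ 2) - 1) ^ (p - 1) :=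
    mul_nonneg (by linarith) (Real.rpow_nonneg (by linarith) _)
  unfold smoothPow smoothPowDeriv
  refine h1.trans ?_
  rw [mul_assoc _ (a / _) _]
  refine mul_le_mul_of_nonneg_left ?_ h3
  linarith

/-- Uniqueness in a class with an admissible weight. -/
theorem IsCauchySolution.eq_zero_of_integrable {N : ℕ} {s T b p : ℝ} {ρ : RN N → ℝ}
    {u : RN N → ℝ → ℝ} (hN : 1 ≤ N) (hs0 : 0 < s) (hs1 : s < 1) (hp : 1 ≤ p) (hb : 0 ≤ b)
    (hb' : b ≤ (N : ℝ) + 2 * s) (hρ : Continuous ρ) (hρpos : ∀ x, 0 < ρ x)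
    (hu : IsCauchySolution s T ρ u) (hadm : AdmissibleDecay s b ρ)
    (hw : IntegrableOn (fun z : RN N × ℝ => |u z.1 z.2| ^ p * (1 + ‖z.1‖) ^ (-b)) (slab N T))
    (x : RN N) {t : ℝ} (ht : t ∈ Ioc 0 T) : u x t = 0 := by
  have hmeas : MeasurableSet (slab N T) := MeasurableSet.univ.prod measurableSet_Ioc
  refine eq_zero_of_smoothPow_eq_zero (hu.comp_eq_zero hN hs0 hs1 hb hb' hρ hρpos hadm
    (smoothPow_tangent_le hp) (continuous_smoothPow hp) (continuous_smoothPowDeriv hp)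
    (hasDerivAt_smoothPow hp) (smoothPow_nonneg p) (smoothPow_zero hp) ?_ x ht)
  refine Integrable.mono' hw (ContinuousOn.aestronglyMeasurable ?_ hmeas)
    (Eventually.of_forall fun z => ?_)
  · refine ((continuous_smoothPow hp).comp_continuousOn hu.isEquationSolution.continuousOn).mul ?_
    refine (Continuous.rpow_const (by fun_prop) fun z => Or.inl ?_).continuousOn
    have := norm_nonneg z.1
    positivity
  · rw [Real.norm_of_nonneg (mul_nonneg (smoothPow_nonneg p _) (by positivity))]
    exact mul_le_mul_of_nonneg_right (smoothPow_le hp _) (by positivity)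

/-! ### Comparison of the weights and the case distinction. -/

theorem one_add_norm_rpow_le_psiWeight {N : ℕ} {β b : ℝ} (hβ : 0 ≤ β) (hβb : β ≤ b) (x : RN N) :
    (1 + ‖x‖) ^ (-b) ≤ psiWeight β x := by
  have h1 : (1 + ‖x‖) ^ (-b) ≤ (1 + ‖x‖) ^ (-β) :=
    Real.rpow_le_rpow_of_exponent_le (by linarith [norm_nonneg x]) (by linarith)
  have h2 : ((1 + ‖x‖) ^ 2) ^ (-(β / 2)) ≤ (1 + ‖x‖ ^ 2) ^ (-(β / 2)) :=
    Real.rpow_le_rpow_of_nonpos (by positivity) (by nlinarith [norm_nonneg x]) (by linarith)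
  have e : ((1 + ‖x‖) ^ 2) ^ (-(β / 2)) = (1 + ‖x‖) ^ (-β) := by
    rw [← Real.rpow_natCast, ← Real.rpow_mul (by positivity)]
    congr 1; push_cast; ring
  rw [e] at h2
  exact h1.trans h2

/-- Raising the exponent from `β` to `b` weakens the weight, so the decay rate may be chosen freely
above `β`. -/
theorem IsCauchySolution.integrableOn_of_memWeightedLp {N : ℕ} {s T β b p : ℝ} {ρ : RN N → ℝ}
    {u : RN N → ℝ → ℝ} (hp : 1 ≤ p) (hβ : 0 ≤ β) (hβb : β ≤ b) (hu : IsCauchySolution s T ρ u)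
    (h : MemWeightedLp p T (fun z => psiWeight β z.1) u) :
    IntegrableOn (fun z : RN N × ℝ => |u z.1 z.2| ^ p * (1 + ‖z.1‖) ^ (-b)) (slab N T) := by
  have hmeas : MeasurableSet (slab N T) := MeasurableSet.univ.prod measurableSet_Ioc
  refine Integrable.mono' h.2 (ContinuousOn.aestronglyMeasurable ?_ hmeas)
    (Eventually.of_forall fun z => ?_)
  · refine (hu.isEquationSolution.continuousOn.abs.rpow_const fun z _ => Or.inr (by linarith)).mul ?_
    refine (Continuous.rpow_const (by fun_prop) fun z => Or.inl ?_).continuousOn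
    have := norm_nonneg z.1
    positivity
  · rw [Real.norm_of_nonneg (by positivity)]
    exact mul_le_mul_of_nonneg_left (one_add_norm_rpow_le_psiWeight hβ hβb z.1) (by positivity)

/-- Membership in the solution class already gives the weighted integrability with `p = 1` at the
extreme exponent `b = N + 2s`. -/
theorem IsCauchySolution.integrableOn_of_memL1Ls {N : ℕ} {s T : ℝ} (hs0 : 0 < s) {ρ : RN N → ℝ}
    {u : RN N → ℝ → ℝ} (hu : IsCauchySolution s T ρ u) :
    IntegrableOn (fun z : RN N × ℝ => |u z.1 z.2| ^ (1 : ℝ) *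
      (1 + ‖z.1‖) ^ (-((N : ℝ) + 2 * s))) (slab N T) := by
  have hmeas : MeasurableSet (slab N T) := MeasurableSet.univ.prod measurableSet_Ioc
  have h : IntegrableOn (fun z : RN N × ℝ => u z.1 z.2 / (1 + ‖z.1‖ ^ ((N : ℝ) + 2 * s)))
      (slab N T) := by
    refine hu.memL1Ls.congr_set_ae ?_
    exact (Measure.set_prod_ae_eq (ae_eq_refl (μ := (volume : Measure (RN N))) univ)
      (Ioo_ae_eq_Ioc (μ := (volume : Measure ℝ)) (a := 0) (b := T))).symm
  refine Integrable.mono' (h.norm.const_mul 2) (ContinuousOn.aestronglyMeasurable ?_ hmeas)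
    (Eventually.of_forall fun z => ?_)
  · refine (hu.isEquationSolution.continuousOn.abs.rpow_const fun z _ =>
      Or.inr zero_le_one).mul ?_
    refine (Continuous.rpow_const (by fun_prop) fun z => Or.inl ?_).continuousOn
    have := norm_nonneg z.1
    positivity
  · have h1 := one_add_rpow_neg_le (by positivity : 0 ≤ (N : ℝ) + 2 * s) (norm_nonneg z.1)
    rw [Real.norm_of_nonneg (by positivity), norm_div, Real.rpow_one,
      Real.norm_of_nonneg (by positivity : 0 ≤ 1 + ‖z.1‖ ^ ((N : ℝ) + 2 * s)), Real.norm_eq_abs]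
    calc |u z.1 z.2| * (1 + ‖z.1‖) ^ (-((N : ℝ) + 2 * s))
        ≤ |u z.1 z.2| * (2 / (1 + ‖z.1‖ ^ ((N : ℝ) + 2 * s))) := by gcongr
      _ = _ := by ring

theorem theorem2p5 (N : ℕ) (hN : 1 ≤ N) (s : ℝ) (hs0 : 0 < s) (hs1 : s < 1)
    (T : ℝ) (hT : 0 < T) (p : ℝ) (hp : 1 ≤ p) (α β : ℝ) (hβ : 0 < β)
    (ρ : RN N → ℝ) (hρ : Continuous ρ) (hρpos : ∀ x, 0 < ρ x)
    (hreg :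
      (PowerLowerBound ρ α ∧ β ≤ (N : ℝ) - 2 * s) ∨
      (PowerLowerBound ρ α ∧ (N : ℝ) - 2 * s < β ∧ β < (N : ℝ) ∧ α ≤ 2 * s) ∨
      (β = (N : ℝ) ∧ ((PowerLowerBound ρ α ∧ α < 2 * s) ∨ LogLowerBound ρ s)) ∨
      (PowerLowerBound ρ α ∧ (N : ℝ) < β ∧ α + β ≤ (N : ℝ) + 2 * s))
    (u : RN N → ℝ → ℝ) (hu : IsCauchySolution s T ρ u)
    (hup : ∀ t ∈ Set.Ioc 0 T, MemLs s (fun x => |u x t| ^ p))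
    (huψ : MemWeightedLp p T (fun z => psiWeight β z.1) u) :
    ∀ x, ∀ t ∈ Set.Ioc 0 T, u x t = 0 := by
  intro x t ht
  rcases hreg with ⟨-, hβN⟩ | ⟨hα, -, hβN, hα2⟩ | ⟨rfl, hα⟩ | ⟨hα, hβN, hαβ⟩
  -- The test function decays with exponent `N - 2s ≥ β`, not `β`: this is the exponent at which the
  -- power is `s`-harmonic.
  · exact hu.eq_zero_of_integrable hN hs0 hs1 hp (by linarith) (by linarith) hρ hρpos
      (admissibleDecay_riesz hN hs0 hs1 (by linarith) hρ hρpos)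
      (hu.integrableOn_of_memWeightedLp hp hβ.le hβN huψ) x ht
  · exact hu.eq_zero_of_integrable hN hs0 hs1 hp hβ.le (by linarith) hρ hρpos
      (admissibleDecay_of_lt_dim hN hs0 hs1 hβ.le hβN hρ hρpos hα2 hα)
      (hu.integrableOn_of_memWeightedLp hp hβ.le le_rfl huψ) x ht
  · have hlog : LogLowerBound ρ s := by
      rcases hα with ⟨hα, hα2⟩ | h
      · exact hα.logLowerBound hα2
      · exact h
    exact hu.eq_zero_of_integrable hN hs0 hs1 hp hβ.le (by linarith) hρ hρpos
      (admissibleDecay_dim hN hs0 hs1 hρ hρpos hlog)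
      (hu.integrableOn_of_memWeightedLp hp hβ.le le_rfl huψ) x ht
  · rcases le_or_gt β ((N : ℝ) + 2 * s) with hβ2 | hβ2
    · exact hu.eq_zero_of_integrable hN hs0 hs1 hp hβ.le hβ2 hρ hρpos
        (admissibleDecay_of_dim_lt hN hs0 hs1 hβN hβ2 hρ hρpos hαβ hα)
        (hu.integrableOn_of_memWeightedLp hp hβ.le le_rfl huψ) x ht
    -- Beyond `N + 2s` the operator no longer preserves the decay, so `β` is replaced by `N + 2s`
    -- and `p` by `1`; the condition on `α + β` then yields `α ≤ 0`.
    · exact hu.eq_zero_of_integrable hN hs0 hs1 le_rfl (by positivity) le_rfl hρ hρpos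
        (admissibleDecay_of_dim_lt hN hs0 hs1 (by linarith) le_rfl hρ hρpos (by linarith) hα)
        (hu.integrableOn_of_memL1Ls hs0) x ht
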